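/- We use two-sorted first-order logic with number variables $x,y,z,\dots$ and string variables $X,Y,Z,\dots$ (strings are meant to be finite sets of natural numbers), over the basic vocabulary $\mathcal L^2_A=[0,1,+,\cdot,|\ |;\in,\le,=^1,=^2]$, and write $X(t)$ for $t\in X$, $x<y$ for $x\le y\wedge x\ne y$, and $\langle x,y\rangle$ for $(x+y)(x+y+1)+2y$, $Y(x,y)$ for $Y(\langle x,y\rangle)$. In the standard structure $\underline{\mathbb N}_2$ the domains are $\mathbb N$ and the finite subsets of $\mathbb N$, $|X|$ is $1$ plus the largest element of $X$ ($0$ if $X=\emptyset$), and the other symbols have their usual meaning. $T\vdash\varphi$ means that $\varphi$ is true in every (two-sorted) model of $T$ under every assignment. A $\Sigma^B_0$ formula is an $\mathcal L^2_A$ formula without string quantifiers all of whose number quantifiers are bounded by $\mathcal L^2_A$ terms; a $\Sigma^1_1$ formula is a block of existential string quantifiers followed by a $\Sigma^B_0$ formula. The theory $\mathbf{VTC}^0$ over $\mathcal L^2_A$ has as axioms the universal closures of - B1–B11: $x+1\ne0$; $x+1=y+1\supset x=y$; $x+0=x$; $x+(y+1)=(x+y)+1$; $x\cdot0=0$; $x\cdot(y+1)=(x\cdot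 y)+x$; $(x\le y\wedge y\le x)\supset x=y$; $0\le x$; $(x\le y\wedge y\le z)\supset x\le z$; $x\le y\vee y\le x$; $x\le y\leftrightarrow x<y+1$; - B12: $x\ne0\supset\exists y<x\,(y+1=x)$; L1: $X(y)\supset y<|X|$; L2: $y+1=|X|\supset X(y)$; SE: $X=Y\leftrightarrow(|X|=|Y|\wedge\forall z<|X|\,(X(z)\leftrightarrow Y(z)))$; - $\Sigma^B_0$-COMP: $\exists X\,(|X|\le a\wedge\forall z<a\,(X(z)\leftrightarrow\varphi(z)))$ for each $\Sigma^B_0$ formula $\varphi$ (possibly with parameters) not containing $X$; - NUMONES: $\forall X\exists Y\big([\forall z\le|X|\,\exists!y\le|X|\;Y(z,y)]\wedge Y(0,0)\wedge\forall z<|X|\,\forall y\le|X|\,(Y(z,y)\supset[(X(z)\supset Y(z+1,y+1))\wedge(\neg X(z)\supset Y(z+1,y))])\big)$. The vocabulary $\mathcal L_{\mathbf{FTC}^0}$ is the smallest one that contains $\mathcal L^2_A$, number functions $\mathit{pd}(x)$, $f_{SE}(X,Y)$, $\mathit{numones}(z,X)$, and, for every open (quantifier-free) formula $\alpha(z,\vec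 x,\vec X)$ over $\mathcal L_{\mathbf{FTC}^0}$ and every number term $t(\vec x,\vec X)$ of $\mathcal L^2_A$, a string function $F_{\alpha,t}(\vec x,\vec X)$ and a number function $f_{\alpha,t}(\vec x,\vec X)$. The universal theory $\overline{\mathbf{VTC}}^0$ over $\mathcal L_{\mathbf{FTC}^0}$ has as axioms the universal closures of the open formulas B1–B11, L1, L2 and - $\mathit{pd}(0)=0$; $x\ne0\supset \mathit{pd}(x)+1=x$; - $X=Y\supset[|X|=|Y|\wedge(z<|X|\supset(X(z)\leftrightarrow Y(z)))]$; $(|X|=|Y|\wedge f_{SE}(X,Y)=|X|)\supset X=Y$; - $f_{SE}(X,Y)\le|X|$; $f_{SE}(X,Y)<|X|\supset\neg\big(X(f_{SE}(X,Y))\leftrightarrow Y(f_{SE}(X,Y))\big)$; $z<f_{SE}(X,Y)\supset(X(z)\leftrightarrow Y(z))$; - $\mathit{numones}(0,X)=0$; $X(z)\supset\mathit{numones}(z+1,X)=\mathit{numones}(z,X)+1$; $\neg X(z)\supset\mathit{numones}(z+1,X)=\mathit{numones}(z,X)$; - for all $\alpha,t$: $F_{\alpha,t}(\vec x,\vec X)(z)\leftrightarrow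 z<t\wedge\alpha(z,\vec x,\vec X)$; $f_{\alpha,t}(\vec x,\vec X)\le t$; $f_{\alpha,t}(\vec x,\vec X)<t\supset\alpha(f_{\alpha,t}(\vec x,\vec X),\vec x,\vec X)$; $z<f_{\alpha,t}(\vec x,\vec X)\supset\neg\alpha(z,\vec x,\vec X)$. Every function symbol of $\mathcal L_{\mathbf{FTC}^0}$ represents a function over $\underline{\mathbb N}_2$, determined by these defining axioms. **Corollary.** (1) $\overline{\mathbf{VTC}}^0$ is a conservative extension of $\mathbf{VTC}^0$: for every $\mathcal L^2_A$ formula $\varphi$, $\overline{\mathbf{VTC}}^0\vdash\varphi$ if and only if $\mathbf{VTC}^0\vdash\varphi$. (2) Every function of $\mathcal L_{\mathbf{FTC}^0}$ is $\Sigma^1_1$-definable in $\mathbf{VTC}^0$: for every string function symbol $F(\vec x,\vec X)$ of $\mathcal L_{\mathbf{FTC}^0}$ there is a $\Sigma^1_1$ formula $\varphi(\vec x,\vec X,Y)$ of $\mathcal L^2_A$ such that $\mathbf{VTC}^0\vdash\exists!Y\,\varphi(\vec x,\vec X,Y)$ and $Y=F(\vec x,\vec X)\leftrightarrow\varphi(\vec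 x,\vec X,Y)$ holds in $\underline{\mathbb N}_2$ and is a theorem of $\overline{\mathbf{VTC}}^0$; and likewise for every number function symbol $f(\vec x,\vec X)$, with a number variable $y$ in place of $Y$. -/

import Mathlib

universe u

namespace TwoSorted

/-! ### Two-sorted syntax -/

/-- The two sorts: numbers and strings (finite sets of numbers). -/
inductive Srt : Type
  | num
  | str

/-- A two-sorted vocabulary is given by its function symbols: `V s k l` is the type of function
symbols with values of sort `s`, taking `k` number arguments and `l` string arguments.
The predicate symbols of every vocabulary are the equality of each sort, `≤` and `∈`. -/
abbrev Vocabulary : Type 1 := Srt → ℕ → ℕ → Type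

/-- The function symbols `0, 1, +, ·, |·|` of the basic vocabulary `L²_A`. -/
inductive L2A : Srt → ℕ → ℕ → Type
  | zero : L2A .num 0 0
  | one : L2A .num 0 0
  | add : L2A .num 2 0
  | mul : L2A .num 2 0
  | len : L2A .num 0 1

/-- `Term V s n m`: terms of sort `s` over `V` whose variables are among the number variables
`x₀, …, x₍ₙ₋₁₎` and the string variables `X₀, …, X₍ₘ₋₁₎`. -/
inductive Term (V : Vocabulary) : Srt → ℕ → ℕ → Type
  | nvar {n m : ℕ} (i : Fin n) : Term V .num n m
  | svar {n m : ℕ} (i : Fin m) : Term V .str n m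
  | app {s : Srt} {k l n m : ℕ} (f : V s k l) (xs : Fin k → Term V .num n m)
      (Xs : Fin l → Term V .str n m) : Term V s n m

/-- `Formula V q n m`: formulas over `V` with free variables among `x₀, …, x₍ₙ₋₁₎` and
`X₀, …, X₍ₘ₋₁₎`. Quantifiers are available only when the flag `q` is `true`, so
`Formula V false n m` is the type of open (quantifier-free) formulas and `Formula V true n m`
the type of all formulas. A number (string) quantifier binds the number (string) variable of
index `0` of its scope; the other variables of that sort have their index shifted by one. -/
inductive Formula (V : Vocabulary) : Bool → ℕ → ℕ → Type
  | tru {q : Bool} {n m : ℕ} : Formula V q n m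
  | fls {q : Bool} {n m : ℕ} : Formula V q n m
  | eq {q : Bool} {n m : ℕ} {s : Srt} (t u : Term V s n m) : Formula V q n m
  | le {q : Bool} {n m : ℕ} (t u : Term V .num n m) : Formula V q n m
  | mem {q : Bool} {n m : ℕ} (t : Term V .num n m) (T : Term V .str n m) : Formula V q n m
  | not {q : Bool} {n m : ℕ} (φ : Formula V q n m) : Formula V q n m
  | and {q : Bool} {n m : ℕ} (φ ψ : Formula V q n m) : Formula V q n m
  | or {q : Bool} {n m : ℕ} (φ ψ : Formula V q n m) : Formula V q n m
  | exN {n m : ℕ} (φ : Formula V true (n + 1) m) : Formula V true n m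
  | allN {n m : ℕ} (φ : Formula V true (n + 1) m) : Formula V true n m
  | exS {n m : ℕ} (φ : Formula V true n (m + 1)) : Formula V true n m
  | allS {n m : ℕ} (φ : Formula V true n (m + 1)) : Formula V true n m

/-- Open formulas over `V`. -/
abbrev OpenFormula (V : Vocabulary) (n m : ℕ) : Type := Formula V false n m

/-- Sentences over `V`. -/
abbrev Sentence (V : Vocabulary) : Type := Formula V true 0 0

/-- The vocabulary of the functions of `FTC⁰`: the least vocabulary that contains `L²_A`, `pd`,
`f_SE` and `numones`, and, for every open formula `α(z, x⃗, X⃗)` over the vocabulary itself and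
every number term `t(x⃗, X⃗)` of `L²_A`, a string function symbol `F_{α,t}(x⃗, X⃗)` and a number
function symbol `f_{α,t}(x⃗, X⃗)`. In `α` the variable `z` has index `0`. -/
inductive LFTC0 : Srt → ℕ → ℕ → Type
  | base {s : Srt} {k l : ℕ} (f : L2A s k l) : LFTC0 s k l
  | pd : LFTC0 .num 1 0
  | fSE : LFTC0 .num 0 2
  | numones : LFTC0 .num 1 1
  | strFn {n m : ℕ} (α : Formula LFTC0 false (n + 1) m) (t : Term L2A .num n m) : LFTC0 .str n m
  | numFn {n m : ℕ} (α : Formula LFTC0 false (n + 1) m) (t : Term L2A .num n m) : LFTC0 .num n m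

/-- Vocabularies that extend `L²_A`. -/
class ExtendsL2A (V : Vocabulary) where
  base : {s : Srt} → {k l : ℕ} → L2A s k l → V s k l

instance : ExtendsL2A L2A := ⟨fun f => f⟩

instance : ExtendsL2A LFTC0 := ⟨fun f => .base f⟩

section Abbreviations

variable {V : Vocabulary}

namespace Term

instance [ExtendsL2A V] {n m : ℕ} : Zero (Term V .num n m) :=
  ⟨.app (ExtendsL2A.base .zero) ![] ![]⟩

instance [ExtendsL2A V] {n m : ℕ} : One (Term V .num n m) :=
  ⟨.app (ExtendsL2A.base .one) ![] ![]⟩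

instance [ExtendsL2A V] {n m : ℕ} : Add (Term V .num n m) :=
  ⟨fun t u => .app (ExtendsL2A.base .add) ![t, u] ![]⟩

instance [ExtendsL2A V] {n m : ℕ} : Mul (Term V .num n m) :=
  ⟨fun t u => .app (ExtendsL2A.base .mul) ![t, u] ![]⟩

/-- The term `|T|`. -/
def len [ExtendsL2A V] {n m : ℕ} (T : Term V .str n m) : Term V .num n m :=
  .app (ExtendsL2A.base .len) ![] ![T]

/-- The pairing term `⟨t, u⟩ = (t + u)(t + u + 1) + 2u`. -/
def pair [ExtendsL2A V] {n m : ℕ} (t u : Term V .num n m) : Term V .num n m :=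
  (t + u) * (t + u + 1) + (1 + 1) * u

/-- Simultaneous substitution of terms for variables. -/
def subst {n m n' m' : ℕ} (σ : Fin n → Term V .num n' m') (τ : Fin m → Term V .str n' m') :
    {s : Srt} → Term V s n m → Term V s n' m'
  | _, .nvar i => σ i
  | _, .svar i => τ i
  | _, .app f xs Xs => .app f (fun i => (xs i).subst σ τ) (fun i => (Xs i).subst σ τ)

/-- Renaming of variables. -/
def rename {n m n' m' : ℕ} (f : Fin n → Fin n') (g : Fin m → Fin m') {s : Srt}
    (t : Term V s n m) : Term V s n' m' :=
  t.subst (fun i => .nvar (f i)) (fun i => .svar (g i))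

/-- The term `t` in a context with one more number variable, which gets index `0`. -/
def shiftN {n m : ℕ} {s : Srt} (t : Term V s n m) : Term V s (n + 1) m := t.rename Fin.succ id

/-- The term `t` in a context with one more string variable, which gets index `0`. -/
def shiftS {n m : ℕ} {s : Srt} (t : Term V s n m) : Term V s n (m + 1) := t.rename id Fin.succ

/-- A term of `L²_A` as a term of a larger vocabulary. -/
def lift [ExtendsL2A V] {n m : ℕ} : {s : Srt} → Term L2A s n m → Term V s n m
  | _, .nvar i => .nvar i
  | _, .svar i => .svar i
  | _, .app f xs Xs =>
      .app (ExtendsL2A.base f) (fun i => (xs i).lift) (fun i => (Xs i).lift)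

/-- The term `f(x⃗, X⃗)` in which the function symbol `f` is applied to all the variables. -/
def ofSymbol {s : Srt} {n m : ℕ} (f : V s n m) : Term V s n m :=
  .app f (fun i => .nvar i) (fun i => .svar i)

end Term

namespace Formula

/-- `φ ⊃ ψ`. -/
def imp {q : Bool} {n m : ℕ} (φ ψ : Formula V q n m) : Formula V q n m := .or (.not φ) ψ

/-- `φ ↔ ψ`. -/
def iff {q : Bool} {n m : ℕ} (φ ψ : Formula V q n m) : Formula V q n m :=
  .and (φ.imp ψ) (ψ.imp φ)

/-- `t < u`, that is `t ≤ u ∧ t ≠ u`. -/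
def lt {q : Bool} {n m : ℕ} (t u : Term V .num n m) : Formula V q n m :=
  .and (.le t u) (.not (.eq t u))

/-- `∃ x ≤ t, φ`. -/
def exNLe {n m : ℕ} (t : Term V .num n m) (φ : Formula V true (n + 1) m) : Formula V true n m :=
  .exN (.and (.le (.nvar 0) t.shiftN) φ)

/-- `∀ x ≤ t, φ`. -/
def allNLe {n m : ℕ} (t : Term V .num n m) (φ : Formula V true (n + 1) m) : Formula V true n m :=
  .allN (imp (.le (.nvar 0) t.shiftN) φ)

/-- `∃ x < t, φ`. -/
def exNLt {n m : ℕ} (t : Term V .num n m) (φ : Formula V true (n + 1) m) : Formula V true n m :=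
  .exN (.and (lt (.nvar 0) t.shiftN) φ)

/-- `∀ x < t, φ`. -/
def allNLt {n m : ℕ} (t : Term V .num n m) (φ : Formula V true (n + 1) m) : Formula V true n m :=
  .allN (imp (lt (.nvar 0) t.shiftN) φ)

/-- `∃ X ≤ t, φ`, that is `∃ X, |X| ≤ t ∧ φ`. -/
def exSLe [ExtendsL2A V] {n m : ℕ} (t : Term V .num n m) (φ : Formula V true n (m + 1)) :
    Formula V true n m :=
  .exS (.and (.le (Term.len (.svar 0)) t.shiftS) φ)

/-- An open formula as a formula. -/
def toFull {n m : ℕ} : {q : Bool} → Formula V q n m → Formula V true n m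
  | _, .tru => .tru
  | _, .fls => .fls
  | _, .eq t u => .eq t u
  | _, .le t u => .le t u
  | _, .mem t T => .mem t T
  | _, .not φ => .not φ.toFull
  | _, .and φ ψ => .and φ.toFull ψ.toFull
  | _, .or φ ψ => .or φ.toFull ψ.toFull
  | _, .exN φ => .exN φ
  | _, .allN φ => .allN φ
  | _, .exS φ => .exS φ
  | _, .allS φ => .allS φ

/-- Simultaneous substitution of terms for the variables of an open formula. -/
def subst {n m n' m' : ℕ} (σ : Fin n → Term V .num n' m') (τ : Fin m → Term V .str n' m') :
    OpenFormula V n m → OpenFormula V n' m'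
  | .tru => .tru
  | .fls => .fls
  | .eq t u => .eq (t.subst σ τ) (u.subst σ τ)
  | .le t u => .le (t.subst σ τ) (u.subst σ τ)
  | .mem t T => .mem (t.subst σ τ) (T.subst σ τ)
  | .not φ => .not (φ.subst σ τ)
  | .and φ ψ => .and (φ.subst σ τ) (ψ.subst σ τ)
  | .or φ ψ => .or (φ.subst σ τ) (ψ.subst σ τ)

/-- Renaming of free variables. -/
def rename : {q : Bool} → {n m n' m' : ℕ} → (Fin n → Fin n') → (Fin m → Fin m') →
    Formula V q n m → Formula V q n' m'
  | _, _, _, _, _, _, _, .tru => .tru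
  | _, _, _, _, _, _, _, .fls => .fls
  | _, _, _, _, _, f, g, .eq t u => .eq (t.rename f g) (u.rename f g)
  | _, _, _, _, _, f, g, .le t u => .le (t.rename f g) (u.rename f g)
  | _, _, _, _, _, f, g, .mem t T => .mem (t.rename f g) (T.rename f g)
  | _, _, _, _, _, f, g, .not φ => .not (φ.rename f g)
  | _, _, _, _, _, f, g, .and φ ψ => .and (φ.rename f g) (ψ.rename f g)
  | _, _, _, _, _, f, g, .or φ ψ => .or (φ.rename f g) (ψ.rename f g)
  | _, _, _, _, _, f, g, .exN φ => .exN (φ.rename (Fin.cons 0 (fun i => (f i).succ)) g)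
  | _, _, _, _, _, f, g, .allN φ => .allN (φ.rename (Fin.cons 0 (fun i => (f i).succ)) g)
  | _, _, _, _, _, f, g, .exS φ => .exS (φ.rename f (Fin.cons 0 (fun i => (g i).succ)))
  | _, _, _, _, _, f, g, .allS φ => .allS (φ.rename f (Fin.cons 0 (fun i => (g i).succ)))

/-- A formula of `L²_A` as a formula of a larger vocabulary. -/
def lift [ExtendsL2A V] : {q : Bool} → {n m : ℕ} → Formula L2A q n m → Formula V q n m
  | _, _, _, .tru => .tru
  | _, _, _, .fls => .fls
  | _, _, _, .eq t u => .eq t.lift u.lift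
  | _, _, _, .le t u => .le t.lift u.lift
  | _, _, _, .mem t T => .mem t.lift T.lift
  | _, _, _, .not φ => .not φ.lift
  | _, _, _, .and φ ψ => .and φ.lift ψ.lift
  | _, _, _, .or φ ψ => .or φ.lift ψ.lift
  | _, _, _, .exN φ => .exN φ.lift
  | _, _, _, .allN φ => .allN φ.lift
  | _, _, _, .exS φ => .exS φ.lift
  | _, _, _, .allS φ => .allS φ.lift

/-- `∃! Y, φ(x⃗, X⃗, Y)`, that is `∃ Y, φ(Y) ∧ ∀ Y', φ(Y') ⊃ Y' = Y`, where `Y` has index `0`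
in `φ`. -/
def exUniqueS {n m : ℕ} (φ : Formula V true n (m + 1)) : Formula V true n m :=
  .exS (.and φ (.allS (imp (φ.rename id (Fin.cons 0 (fun i => i.succ.succ)))
    (.eq (.svar 0) (.svar 1)))))

/-- `∃! y, φ(x⃗, X⃗, y)`, that is `∃ y, φ(y) ∧ ∀ y', φ(y') ⊃ y' = y`, where `y` has index `0`
in `φ`. -/
def exUniqueN {n m : ℕ} (φ : Formula V true (n + 1) m) : Formula V true n m :=
  .exN (.and φ (.allN (imp (φ.rename (Fin.cons 0 (fun i => i.succ.succ)) id)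
    (.eq (.nvar 0) (.nvar 1)))))

/-- Universal quantification over all free string variables. -/
def closeS {n : ℕ} : {m : ℕ} → Formula V true n m → Formula V true n 0
  | 0, φ => φ
  | _ + 1, φ => closeS (.allS φ)

/-- Universal quantification over all free number variables. -/
def closeN {m : ℕ} : {n : ℕ} → Formula V true n m → Formula V true 0 m
  | 0, φ => φ
  | _ + 1, φ => closeN (.allN φ)

/-- The universal closure of a formula. -/
def closure {n m : ℕ} (φ : Formula V true n m) : Sentence V := closeN (closeS φ)

/-- The `Σ₀ᴮ` formulas of `L²_A`: no string quantifiers, and all number quantifiers bounded. -/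
inductive IsSigma0B : {n m : ℕ} → Formula L2A true n m → Prop
  | tru {n m : ℕ} : IsSigma0B (.tru : Formula L2A true n m)
  | fls {n m : ℕ} : IsSigma0B (.fls : Formula L2A true n m)
  | eq {n m : ℕ} {s : Srt} (t u : Term L2A s n m) : IsSigma0B (.eq t u)
  | le {n m : ℕ} (t u : Term L2A .num n m) : IsSigma0B (.le t u)
  | mem {n m : ℕ} (t : Term L2A .num n m) (T : Term L2A .str n m) : IsSigma0B (.mem t T)
  | not {n m : ℕ} {φ : Formula L2A true n m} : IsSigma0B φ → IsSigma0B (.not φ)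
  | and {n m : ℕ} {φ ψ : Formula L2A true n m} :
      IsSigma0B φ → IsSigma0B ψ → IsSigma0B (.and φ ψ)
  | or {n m : ℕ} {φ ψ : Formula L2A true n m} :
      IsSigma0B φ → IsSigma0B ψ → IsSigma0B (.or φ ψ)
  | exNLe {n m : ℕ} (t : Term L2A .num n m) {φ : Formula L2A true (n + 1) m} :
      IsSigma0B φ → IsSigma0B (exNLe t φ)
  | allNLe {n m : ℕ} (t : Term L2A .num n m) {φ : Formula L2A true (n + 1) m} :
      IsSigma0B φ → IsSigma0B (allNLe t φ)
  | exNLt {n m : ℕ} (t : Term L2A .num n m) {φ : Formula L2A true (n + 1) m} :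
      IsSigma0B φ → IsSigma0B (exNLt t φ)
  | allNLt {n m : ℕ} (t : Term L2A .num n m) {φ : Formula L2A true (n + 1) m} :
      IsSigma0B φ → IsSigma0B (allNLt t φ)

/-- The `Σ¹₁` formulas of `L²_A`: a (possibly empty) block of existential string quantifiers
followed by a `Σ₀ᴮ` formula. -/
inductive IsSigma11 : {n m : ℕ} → Formula L2A true n m → Prop
  | sigma0B {n m : ℕ} {φ : Formula L2A true n m} : IsSigma0B φ → IsSigma11 φ
  | exS {n m : ℕ} {φ : Formula L2A true n (m + 1)} : IsSigma11 φ → IsSigma11 (.exS φ)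

end Formula

end Abbreviations

/-! ### Semantics, theories and consequence -/

/-- Two-sorted structures: two nonempty domains, with the function symbols and the predicates
`≤` and `∈` interpreted arbitrarily; the equality symbols are interpreted by equality. -/
structure Struct (V : Vocabulary) : Type (u + 1) where
  U : Srt → Type u
  nonempty : ∀ s, Nonempty (U s)
  fn : {s : Srt} → {k l : ℕ} → V s k l → (Fin k → U .num) → (Fin l → U .str) → U s
  le : U .num → U .num → Prop
  mem : U .num → U .str → Prop

section Semantics

variable {V : Vocabulary}

/-- The value of a term under an assignment. -/
def Term.val (M : Struct.{u} V) {n m : ℕ} (x : Fin n → M.U .num) (X : Fin m → M.U .str) :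
    {s : Srt} → Term V s n m → M.U s
  | _, .nvar i => x i
  | _, .svar i => X i
  | _, .app f xs Xs => M.fn f (fun i => (xs i).val M x X) (fun i => (Xs i).val M x X)

/-- Truth of a formula under an assignment. -/
def Formula.Holds (M : Struct.{u} V) : {q : Bool} → {n m : ℕ} →
    (Fin n → M.U .num) → (Fin m → M.U .str) → Formula V q n m → Prop
  | _, _, _, _, _, .tru => True
  | _, _, _, _, _, .fls => False
  | _, _, _, x, X, .eq t u => t.val M x X = u.val M x X
  | _, _, _, x, X, .le t u => M.le (t.val M x X) (u.val M x X)
  | _, _, _, x, X, .mem t T => M.mem (t.val M x X) (T.val M x X)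
  | _, _, _, x, X, .not φ => ¬ φ.Holds M x X
  | _, _, _, x, X, .and φ ψ => φ.Holds M x X ∧ ψ.Holds M x X
  | _, _, _, x, X, .or φ ψ => φ.Holds M x X ∨ ψ.Holds M x X
  | _, _, _, x, X, .exN φ => ∃ a : M.U .num, φ.Holds M (Fin.cons a x) X
  | _, _, _, x, X, .allN φ => ∀ a : M.U .num, φ.Holds M (Fin.cons a x) X
  | _, _, _, x, X, .exS φ => ∃ A : M.U .str, φ.Holds M x (Fin.cons A X)
  | _, _, _, x, X, .allS φ => ∀ A : M.U .str, φ.Holds M x (Fin.cons A X)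

/-- A theory over `V`, given by a set of sentences as axioms. -/
abbrev Theory (V : Vocabulary) : Type := Set (Sentence V)

/-- `M` is a model of `T`. -/
def Struct.Models (M : Struct.{u} V) (T : Theory V) : Prop :=
  ∀ φ ∈ T, φ.Holds M (fun i => i.elim0) (fun i => i.elim0)

/-- `T ⊢ φ`: the formula `φ` is a theorem of `T`, that is, a logical consequence of `T`: it is
true in all models of `T` under all assignments. By the completeness theorem this is the same as
derivability, and it does not depend on the universe `u`, since there are only countably many
symbols in the vocabularies considered. -/
def Theory.Proves (T : Theory V) {q : Bool} {n m : ℕ} (φ : Formula V q n m) : Prop :=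
  ∀ M : Struct.{u} V, M.Models T →
    ∀ (x : Fin n → M.U .num) (X : Fin m → M.U .str), φ.Holds M x X

/-- `T'` is a conservative extension of `T`: it proves all theorems of `T`, and all its theorems
in the vocabulary of `T` (which is `L²_A`) are theorems of `T`. -/
def Theory.IsConservativeExtension [ExtendsL2A V] (T' : Theory V) (T : Theory L2A) : Prop :=
  (∀ (n m : ℕ) (φ : Formula L2A true n m),
      Theory.Proves.{u} T φ → Theory.Proves.{u} T' (φ.lift : Formula V true n m)) ∧
  (∀ (n m : ℕ) (φ : Formula L2A true n m),
      Theory.Proves.{u} T' (φ.lift : Formula V true n m) → Theory.Proves.{u} T φ)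

end Semantics

/-! ### The theory `VTC⁰` -/

open Formula Term in
/-- The open axioms B1 – B11, L1 and L2, over a vocabulary that extends `L²_A`. Here `nvar 0`,
`nvar 1`, `nvar 2` stand for `x`, `y`, `z`, and `svar 0` for `X`; in L1 and L2, `nvar 0` stands
for `y`. -/
inductive BasicOpen (V : Vocabulary) [ExtendsL2A V] : (n m : ℕ) → OpenFormula V n m → Prop
  | B1 : BasicOpen V 1 0 (.not (.eq (nvar 0 + 1) 0))
  | B2 : BasicOpen V 2 0 (imp (.eq (nvar 0 + 1) (nvar 1 + 1)) (.eq (nvar 0) (nvar 1)))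
  | B3 : BasicOpen V 1 0 (.eq (nvar 0 + 0) (nvar 0))
  | B4 : BasicOpen V 2 0 (.eq (nvar 0 + (nvar 1 + 1)) ((nvar 0 + nvar 1) + 1))
  | B5 : BasicOpen V 1 0 (.eq (nvar 0 * 0) 0)
  | B6 : BasicOpen V 2 0 (.eq (nvar 0 * (nvar 1 + 1)) ((nvar 0 * nvar 1) + nvar 0))
  | B7 : BasicOpen V 2 0
      (imp (.and (.le (nvar 0) (nvar 1)) (.le (nvar 1) (nvar 0))) (.eq (nvar 0) (nvar 1)))
  | B8 : BasicOpen V 1 0 (.le 0 (nvar 0))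
  | B9 : BasicOpen V 3 0
      (imp (.and (.le (nvar 0) (nvar 1)) (.le (nvar 1) (nvar 2))) (.le (nvar 0) (nvar 2)))
  | B10 : BasicOpen V 2 0 (.or (.le (nvar 0) (nvar 1)) (.le (nvar 1) (nvar 0)))
  | B11 : BasicOpen V 2 0 (iff (.le (nvar 0) (nvar 1)) (lt (nvar 0) (nvar 1 + 1)))
  | L1 : BasicOpen V 1 1 (imp (.mem (nvar 0) (svar 0)) (lt (nvar 0) (len (svar 0))))
  | L2 : BasicOpen V 1 1 (imp (.eq (nvar 0 + 1) (len (svar 0))) (.mem (nvar 0) (svar 0)))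

open Formula Term in
/-- The formula `φ_NUMONES(X, Y)`, where `X` is `svar 0` and `Y` is `svar 1`, and `Y(z, y)` is
`⟨z, y⟩ ∈ Y`:
`[∀ z ≤ |X| ∃! y ≤ |X| Y(z, y)] ∧ Y(0, 0) ∧ ∀ z < |X| ∀ y ≤ |X|,
  Y(z, y) ⊃ [(X(z) ⊃ Y(z + 1, y + 1)) ∧ (¬ X(z) ⊃ Y(z + 1, y))]`. -/
def phiNUMONES : Formula L2A true 0 2 :=
  .and
    (.and
      -- `z` is `nvar 0`; then `y` is `nvar 0` and `z` is `nvar 1`;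
      -- then `y'` is `nvar 0`, `y` is `nvar 1` and `z` is `nvar 2`
      (allNLe (len (svar 0)) (exNLe (len (svar 0))
        (.and (.mem (pair (nvar 1) (nvar 0)) (svar 1))
          (allNLe (len (svar 0))
            (imp (.mem (pair (nvar 2) (nvar 0)) (svar 1)) (.eq (nvar 0) (nvar 1)))))))
      (.mem (pair 0 0) (svar 1)))
    (allNLt (len (svar 0)) (allNLe (len (svar 0))
      -- `y` is `nvar 0` and `z` is `nvar 1`
      (imp (.mem (pair (nvar 1) (nvar 0)) (svar 1))
        (.and
          (imp (.mem (nvar 1) (svar 0)) (.mem (pair (nvar 1 + 1) (nvar 0 + 1)) (svar 1)))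
          (imp (.not (.mem (nvar 1) (svar 0)))
            (.mem (pair (nvar 1 + 1) (nvar 0)) (svar 1)))))))

open Formula Term in
/-- The axioms of `V⁰`: 2-BASIC and `Σ₀ᴮ`-COMP. -/
inductive V0Axiom : (n m : ℕ) → Formula L2A true n m → Prop
  | basic {n m : ℕ} {α : OpenFormula L2A n m} (h : BasicOpen L2A n m α) : V0Axiom n m α.toFull
  /-- `x ≠ 0 ⊃ ∃ y < x (y + 1 = x)` -/
  | B12 : V0Axiom 1 0
      (imp (.not (.eq (nvar 0) 0)) (exNLt (nvar 0) (.eq (nvar 0 + 1) (nvar 1))))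
  /-- `X = Y ↔ [|X| = |Y| ∧ ∀ z < |X| (X(z) ↔ Y(z))]` -/
  | SE : V0Axiom 0 2
      (iff (.eq (svar 0) (svar 1))
        (.and (.eq (len (svar 0)) (len (svar 1)))
          (allNLt (len (svar 0)) (iff (.mem (nvar 0) (svar 0)) (.mem (nvar 0) (svar 1))))))
  /-- `∃ X ≤ a ∀ z < a (X(z) ↔ φ(z))`, where `a` is a number variable and `φ` is a `Σ₀ᴮ` formula
  that does not contain `X` but may contain other free variables, among them `a`. In `φ` the
  variable `z` has index `0`. -/
  | comp {n m : ℕ} (a : Fin n) (φ : Formula L2A true (n + 1) m) (hφ : IsSigma0B φ) :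
      V0Axiom n m
        (exSLe (nvar a) (allNLt (nvar a)
          (iff (.mem (nvar 0) (svar 0)) (φ.rename id Fin.succ))))

/-- The theory `V⁰`. -/
def V0 : Theory L2A := {σ | ∃ (n m : ℕ) (φ : Formula L2A true n m), V0Axiom n m φ ∧ σ = φ.closure}

/-- The axiom NUMONES: `∀ X ∃ Y φ_NUMONES(X, Y)`. -/
def NUMONES : Sentence L2A := .allS (.exS (phiNUMONES.rename id ![1, 0]))

/-- The theory `VTC⁰`. -/
def VTC0 : Theory L2A := V0 ∪ {NUMONES}

/-! ### The universal theory `VTC⁰`-bar -/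

open Formula Term in
/-- The open formulas whose universal closures are the axioms of `VTC⁰`-bar. -/
inductive VTC0barAxiom : (n m : ℕ) → OpenFormula LFTC0 n m → Prop
  /-- B1 – B11, L1, L2 -/
  | basic {n m : ℕ} {α : OpenFormula LFTC0 n m} (h : BasicOpen LFTC0 n m α) : VTC0barAxiom n m α
  /-- `pd(0) = 0` -/
  | B12' : VTC0barAxiom 0 0 (.eq (app .pd ![0] ![]) 0)
  /-- `x ≠ 0 ⊃ pd(x) + 1 = x` -/
  | B12'' : VTC0barAxiom 1 0
      (imp (.not (.eq (nvar 0) 0)) (.eq (app .pd ![nvar 0] ![] + 1) (nvar 0)))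
  /-- `X = Y ⊃ [|X| = |Y| ∧ (z < |X| ⊃ (X(z) ↔ Y(z)))]` -/
  | SE' : VTC0barAxiom 1 2
      (imp (.eq (svar 0) (svar 1))
        (.and (.eq (len (svar 0)) (len (svar 1)))
          (imp (lt (nvar 0) (len (svar 0)))
            (iff (.mem (nvar 0) (svar 0)) (.mem (nvar 0) (svar 1))))))
  /-- `(|X| = |Y| ∧ f_SE(X, Y) = |X|) ⊃ X = Y` -/
  | SE'' : VTC0barAxiom 0 2
      (imp (.and (.eq (len (svar 0)) (len (svar 1)))
          (.eq (app .fSE ![] ![svar 0, svar 1]) (len (svar 0))))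
        (.eq (svar 0) (svar 1)))
  /- The defining axioms of `f_SE(X, Y) = min z < |X| (X(z) ↮ Y(z))`. -/
  /-- `f_SE(X, Y) ≤ |X|` -/
  | fSE1 : VTC0barAxiom 0 2 (.le (app .fSE ![] ![svar 0, svar 1]) (len (svar 0)))
  /-- `f_SE(X, Y) < |X| ⊃ (X(f_SE(X, Y)) ↮ Y(f_SE(X, Y)))` -/
  | fSE2 : VTC0barAxiom 0 2
      (imp (lt (app .fSE ![] ![svar 0, svar 1]) (len (svar 0)))
        (.not (iff (.mem (app .fSE ![] ![svar 0, svar 1]) (svar 0))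
          (.mem (app .fSE ![] ![svar 0, svar 1]) (svar 1)))))
  /-- `z < f_SE(X, Y) ⊃ (X(z) ↔ Y(z))` -/
  | fSE3 : VTC0barAxiom 1 2
      (imp (lt (nvar 0) (app .fSE ![] ![svar 0, svar 1]))
        (iff (.mem (nvar 0) (svar 0)) (.mem (nvar 0) (svar 1))))
  /-- `numones(0, X) = 0` -/
  | numones1 : VTC0barAxiom 0 1 (.eq (app .numones ![0] ![svar 0]) 0)
  /-- `X(z) ⊃ numones(z + 1, X) = numones(z, X) + 1` -/
  | numones2 : VTC0barAxiom 1 1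
      (imp (.mem (nvar 0) (svar 0))
        (.eq (app .numones ![nvar 0 + 1] ![svar 0]) (app .numones ![nvar 0] ![svar 0] + 1)))
  /-- `¬ X(z) ⊃ numones(z + 1, X) = numones(z, X)` -/
  | numones3 : VTC0barAxiom 1 1
      (imp (.not (.mem (nvar 0) (svar 0)))
        (.eq (app .numones ![nvar 0 + 1] ![svar 0]) (app .numones ![nvar 0] ![svar 0])))
  /-- `F_{α,t}(x⃗, X⃗)(z) ↔ z < t ∧ α(z, x⃗, X⃗)`, where `z` has index `0` -/
  | strFn {n m : ℕ} (α : OpenFormula LFTC0 (n + 1) m) (t : Term L2A .num n m) :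
      VTC0barAxiom (n + 1) m
        (iff (.mem (nvar 0) (ofSymbol (LFTC0.strFn α t)).shiftN)
          (.and (lt (nvar 0) (t.lift : Term LFTC0 .num n m).shiftN) α))
  /-- `f_{α,t}(x⃗, X⃗) ≤ t(x⃗, X⃗)` -/
  | numFn1 {n m : ℕ} (α : OpenFormula LFTC0 (n + 1) m) (t : Term L2A .num n m) :
      VTC0barAxiom n m (.le (ofSymbol (LFTC0.numFn α t)) t.lift)
  /-- `f_{α,t}(x⃗, X⃗) < t(x⃗, X⃗) ⊃ α(f_{α,t}(x⃗, X⃗), x⃗, X⃗)` -/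
  | numFn2 {n m : ℕ} (α : OpenFormula LFTC0 (n + 1) m) (t : Term L2A .num n m) :
      VTC0barAxiom n m
        (imp (lt (ofSymbol (LFTC0.numFn α t)) t.lift)
          (α.subst (Fin.cons (ofSymbol (LFTC0.numFn α t)) (fun i => nvar i)) (fun i => svar i)))
  /-- `z < f_{α,t}(x⃗, X⃗) ⊃ ¬ α(z, x⃗, X⃗)`, where `z` has index `0` -/
  | numFn3 {n m : ℕ} (α : OpenFormula LFTC0 (n + 1) m) (t : Term L2A .num n m) :
      VTC0barAxiom (n + 1) m
        (imp (lt (nvar 0) (ofSymbol (LFTC0.numFn α t)).shiftN) (.not α))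

/-- The universal theory `VTC⁰`-bar. -/
def VTC0bar : Theory LFTC0 :=
  {σ | ∃ (n m : ℕ) (α : OpenFormula LFTC0 n m), VTC0barAxiom n m α ∧ σ = α.toFull.closure}

/-! ### The standard structure and the functions represented by the symbols -/

/-- The standard domains: `ℕ` and the finite subsets of `ℕ`. -/
abbrev Srt.Std : Srt → Type
  | .num => ℕ
  | .str => Finset ℕ

/-- The intended interpretation of the symbols of `L²_A`. Here `|X|` is `0` if `X` is empty, and
`1` plus the largest element of `X` otherwise. -/
def L2A.std : {s : Srt} → {k l : ℕ} → L2A s k l → (Fin k → ℕ) → (Fin l → Finset ℕ) → s.Std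
  | _, _, _, .zero, _, _ => (0 : ℕ)
  | _, _, _, .one, _, _ => (1 : ℕ)
  | _, _, _, .add, x, _ => x 0 + x 1
  | _, _, _, .mul, x, _ => x 0 * x 1
  | _, _, _, .len, _, X => ((X 0).sup (fun i => i + 1) : ℕ)

/-- The standard structure for `L²_A`. -/
abbrev stdL2A : Struct.{0} L2A where
  U := Srt.Std
  nonempty := fun s => match s with
    | .num => ⟨(0 : ℕ)⟩
    | .str => ⟨(∅ : Finset ℕ)⟩
  fn := fun f x X => f.std x X
  le := fun a b => (show ℕ from a) ≤ (show ℕ from b)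
  mem := fun a A => (show ℕ from a) ∈ (show Finset ℕ from A)

open Classical in
mutual

/-- The function on `ℕ` and the finite subsets of `ℕ` represented by a function symbol. -/
noncomputable def LFTC0.std : {s : Srt} → {k l : ℕ} → LFTC0 s k l →
    (Fin k → ℕ) → (Fin l → Finset ℕ) → s.Std
  | _, _, _, .base f, x, X => f.std x X
  | _, _, _, .pd, x, _ => x 0 - 1
  | _, _, _, .fSE, _, X =>
      (sInf {z : ℕ | ¬ (z ∈ X 0 ↔ z ∈ X 1) ∨ z = (X 0).sup (fun i => i + 1)} : ℕ)
  | _, _, _, .numones, x, X => ((X 0).filter (fun i => i < x 0)).card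
  | _, _, _, .strFn α t, x, X =>
      (Finset.range (t.val stdL2A x X)).filter (fun z => α.stdHolds (Fin.cons z x) X)
  | _, _, _, .numFn α t, x, X =>
      (sInf {z : ℕ | α.stdHolds (Fin.cons z x) X ∨ z = t.val stdL2A x X} : ℕ)

/-- The standard value of a term. -/
noncomputable def Term.stdVal : {s : Srt} → {n m : ℕ} → Term LFTC0 s n m →
    (Fin n → ℕ) → (Fin m → Finset ℕ) → s.Std
  | _, _, _, .nvar i, x, _ => x i
  | _, _, _, .svar i, _, X => X i
  | _, _, _, .app f xs Xs, x, X =>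
      f.std (fun i => (xs i).stdVal x X) (fun i => (Xs i).stdVal x X)

/-- The standard truth value of a formula. -/
noncomputable def Formula.stdHolds : {q : Bool} → {n m : ℕ} → Formula LFTC0 q n m →
    (Fin n → ℕ) → (Fin m → Finset ℕ) → Prop
  | _, _, _, .tru, _, _ => True
  | _, _, _, .fls, _, _ => False
  | _, _, _, .eq t u, x, X => t.stdVal x X = u.stdVal x X
  | _, _, _, .le t u, x, X => (show ℕ from t.stdVal x X) ≤ (show ℕ from u.stdVal x X)
  | _, _, _, .mem t T, x, X => (show ℕ from t.stdVal x X) ∈ (show Finset ℕ from T.stdVal x X)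
  | _, _, _, .not φ, x, X => ¬ φ.stdHolds x X
  | _, _, _, .and φ ψ, x, X => φ.stdHolds x X ∧ ψ.stdHolds x X
  | _, _, _, .or φ ψ, x, X => φ.stdHolds x X ∨ ψ.stdHolds x X
  | _, _, _, .exN φ, x, X => ∃ a : ℕ, φ.stdHolds (Fin.cons a x) X
  | _, _, _, .allN φ, x, X => ∀ a : ℕ, φ.stdHolds (Fin.cons a x) X
  | _, _, _, .exS φ, x, X => ∃ A : Finset ℕ, φ.stdHolds x (Fin.cons A X)
  | _, _, _, .allS φ, x, X => ∀ A : Finset ℕ, φ.stdHolds x (Fin.cons A X)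

end

/-- `φ(x⃗, X⃗, Y)` is a `Σ¹₁`-definition in `T` of the string function `F`. In `φ` the variable `Y`
has index `0` among the string variables. -/
def IsSigma11DefS (T : Theory L2A) {k l : ℕ}
    (F : (Fin k → ℕ) → (Fin l → Finset ℕ) → Finset ℕ) (φ : Formula L2A true k (l + 1)) : Prop :=
  φ.IsSigma11 ∧
  (∀ (x : Fin k → ℕ) (X : Fin l → Finset ℕ) (Y : Finset ℕ),
    Y = F x X ↔ φ.Holds stdL2A x (Fin.cons Y X)) ∧
  Theory.Proves.{u} T φ.exUniqueS

/-- `φ(x⃗, X⃗, y)` is a `Σ¹₁`-definition in `T` of the number function `f`. In `φ` the variable `y`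
has index `0` among the number variables. -/
def IsSigma11DefN (T : Theory L2A) {k l : ℕ}
    (f : (Fin k → ℕ) → (Fin l → Finset ℕ) → ℕ) (φ : Formula L2A true (k + 1) l) : Prop :=
  φ.IsSigma11 ∧
  (∀ (x : Fin k → ℕ) (X : Fin l → Finset ℕ) (y : ℕ),
    y = f x X ↔ φ.Holds stdL2A (Fin.cons y x) X) ∧
  Theory.Proves.{u} T φ.exUniqueN

end TwoSorted

open TwoSorted

/-!
Over every model of `VTC⁰` the function symbols of `L_FTC⁰` have interpretations that satisfy their
defining axioms, and these interpretations have `Σ¹₁` graphs, by formulas that do not depend on the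
model. Both facts come from one strengthening of the induction over the symbols: a symbol acts not
only on single arguments but on *arrays* of arguments.

A string `D` is read as an array: its row `rowS D u = {z | ⟨u, z⟩ ∈ D}` is a string, and the length
`rowN D u` of that row is a number. A function is *coded* (`Coded`) if for all arrays of arguments
there is an array of its values at all indices below a given bound. Coded functions are closed
under composition (`Coded.comp`), and the relations defined by open formulas in coded functions
admit comprehension over arrays (`codedRel_holds`). Since indices may be pairs
(`CodedRel.exists_pairs`), this yields comprehension and minimization for such relations, so that
the interpretations of `F_{α,t}` and `f_{α,t}` exist and are coded again (`IsStrFn.coded`,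
`IsNumFn.coded`). The counting function is coded because one instance of NUMONES suffices for a
whole array: the rows of the array are concatenated to a single string, and the number of elements
of an initial segment of a row is a difference of two counts in the concatenation
(`IsNumones.add_eq`). Hence every model of `VTC⁰` expands to a model of `VTC⁰`-bar
(`symSpec_interp`, `exists_expansion`). Conversely, in a model of `VTC⁰`-bar the functions
`f_{α,t}` eliminate bounded quantifiers, which gives `Σ₀ᴮ`-COMP (`isV0_of_models`), and
comprehension for the graph of `numones` gives NUMONES. This proves the conservativity.

For the definability the same closure properties are established for the relation "`W` is an array
of values of `F` at the entries of the arrays `D⃗`, `E⃗`" being `Σ¹₁` definable, uniformly in all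
models (`SigCoded`, `sigCoded`): each closure step guesses the auxiliary arrays, which exist by
codedness, by existential string quantifiers, and checks a `Σ₀ᴮ` condition. Arrays of length one
give `Σ¹₁` formulas for the graphs (`exists_graph_str`, `exists_graph_num`). Since the standard
structure is one of the models (`symSpec_std`), the same formulas are correct in it.

The `Σ₀ᴮ` formulas themselves are found by type class search: `Sig0` and `Poly` are inductive
classes of relations and functions that are definable uniformly over a family of structures, and
`SigF` allows functions with `Σ₀ᴮ` graphs, such as `rowN`, to be used like terms.
-/

universe w

namespace TwoSorted

open Struct

/-! ### Semantics of the syntactic operations -/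

section Operations

variable {V : Vocabulary}

/-- The `L²_A`-reduct of a structure. -/
def Struct.reduct [ExtendsL2A V] (N : Struct.{u} V) : Struct.{u} L2A where
  U := N.U
  nonempty := N.nonempty
  fn := fun f => N.fn (ExtendsL2A.base f)
  le := N.le
  mem := N.mem

namespace Term

@[simp] theorem val_nvar (M : Struct.{u} V) {n m : ℕ} (x : Fin n → M.U .num)
    (X : Fin m → M.U .str) (i : Fin n) : (nvar i : Term V .num n m).val M x X = x i := rfl

@[simp] theorem val_svar (M : Struct.{u} V) {n m : ℕ} (x : Fin n → M.U .num)
    (X : Fin m → M.U .str) (i : Fin m) : (svar i : Term V .str n m).val M x X = X i := rfl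

theorem val_subst (M : Struct.{u} V) {n m n' m' : ℕ} (σ : Fin n → Term V .num n' m')
    (τ : Fin m → Term V .str n' m') (x : Fin n' → M.U .num) (X : Fin m' → M.U .str) {s : Srt}
    (t : Term V s n m) :
    (t.subst σ τ).val M x X =
      t.val M (fun i => (σ i).val M x X) (fun i => (τ i).val M x X) := by
  induction t with
  | nvar i => rfl
  | svar i => rfl
  | app f xs Xs ih1 ih2 => simp only [subst, val, ih1, ih2]

@[simp] theorem val_rename (M : Struct.{u} V) {n m n' m' : ℕ} (f : Fin n → Fin n')
    (g : Fin m → Fin m') (x : Fin n' → M.U .num) (X : Fin m' → M.U .str) {s : Srt}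
    (t : Term V s n m) :
    (t.rename f g).val M x X = t.val M (fun i => x (f i)) (fun i => X (g i)) :=
  val_subst M _ _ x X t

@[simp] theorem val_shiftN (M : Struct.{u} V) {n m : ℕ} (x : Fin n → M.U .num)
    (X : Fin m → M.U .str) (a : M.U .num) {s : Srt} (t : Term V s n m) :
    t.shiftN.val M (Fin.cons a x) X = t.val M x X := by
  simp [shiftN]

@[simp] theorem val_shiftS (M : Struct.{u} V) {n m : ℕ} (x : Fin n → M.U .num)
    (X : Fin m → M.U .str) (A : M.U .str) {s : Srt} (t : Term V s n m) :
    t.shiftS.val M x (Fin.cons A X) = t.val M x X := by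
  simp [shiftS]

theorem val_lift [ExtendsL2A V] (N : Struct.{u} V) {n m : ℕ} (x : Fin n → N.U .num)
    (X : Fin m → N.U .str) {s : Srt} (t : Term L2A s n m) :
    (t.lift : Term V s n m).val N x X = t.val N.reduct x X := by
  induction t with
  | nvar i => rfl
  | svar i => rfl
  | app f xs Xs ih1 ih2 => simp only [lift, val, ih1, ih2]; rfl

theorem rename_nvar_zero {n m n' m' : ℕ} (f : Fin n → Fin n') (g : Fin m → Fin m') :
    (nvar 0 : Term V .num (n + 1) m).rename (Fin.cons 0 (fun i => (f i).succ)) g = nvar 0 := rfl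

theorem shiftN_rename {n m n' m' : ℕ} (f : Fin n → Fin n') (g : Fin m → Fin m') {s : Srt}
    (t : Term V s n m) :
    t.shiftN.rename (Fin.cons 0 (fun i => (f i).succ)) g = (t.rename f g).shiftN := by
  induction t with
  | nvar i => rfl
  | svar i => rfl
  | app h xs Xs ih1 ih2 =>
    simp only [shiftN, rename, subst] at ih1 ih2 ⊢
    simp only [ih1, ih2]

end Term

namespace Formula

section

variable {M : Struct.{u} V} {q : Bool} {n m : ℕ} {x : Fin n → M.U .num} {X : Fin m → M.U .str}

@[simp] theorem holds_tru : (tru : Formula V q n m).Holds M x X ↔ True := Iff.rfl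

@[simp] theorem holds_fls : (fls : Formula V q n m).Holds M x X ↔ False := Iff.rfl

@[simp] theorem holds_eq {s : Srt} (t u : Term V s n m) :
    (eq t u : Formula V q n m).Holds M x X ↔ t.val M x X = u.val M x X := Iff.rfl

theorem holds_le (t u : Term V .num n m) :
    (le t u : Formula V q n m).Holds M x X ↔ M.le (t.val M x X) (u.val M x X) := Iff.rfl

theorem holds_mem (t : Term V .num n m) (T : Term V .str n m) :
    (mem t T : Formula V q n m).Holds M x X ↔ M.mem (t.val M x X) (T.val M x X) := Iff.rfl

@[simp] theorem holds_not (φ : Formula V q n m) : (not φ).Holds M x X ↔ ¬ φ.Holds M x X := Iff.rfl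

@[simp] theorem holds_and (φ ψ : Formula V q n m) :
    (and φ ψ).Holds M x X ↔ φ.Holds M x X ∧ ψ.Holds M x X := Iff.rfl

@[simp] theorem holds_or (φ ψ : Formula V q n m) :
    (or φ ψ).Holds M x X ↔ φ.Holds M x X ∨ ψ.Holds M x X := Iff.rfl

@[simp] theorem holds_exN (φ : Formula V true (n + 1) m) :
    (exN φ).Holds M x X ↔ ∃ a, φ.Holds M (Fin.cons a x) X := Iff.rfl

@[simp] theorem holds_allN (φ : Formula V true (n + 1) m) :
    (allN φ).Holds M x X ↔ ∀ a, φ.Holds M (Fin.cons a x) X := Iff.rfl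

@[simp] theorem holds_exS (φ : Formula V true n (m + 1)) :
    (exS φ).Holds M x X ↔ ∃ A, φ.Holds M x (Fin.cons A X) := Iff.rfl

@[simp] theorem holds_allS (φ : Formula V true n (m + 1)) :
    (allS φ).Holds M x X ↔ ∀ A, φ.Holds M x (Fin.cons A X) := Iff.rfl

@[simp] theorem holds_imp (φ ψ : Formula V q n m) :
    (imp φ ψ).Holds M x X ↔ (φ.Holds M x X → ψ.Holds M x X) := by
  simp only [imp, holds_or, holds_not]; tauto

@[simp] theorem holds_iff (φ ψ : Formula V q n m) :
    (iff φ ψ).Holds M x X ↔ (φ.Holds M x X ↔ ψ.Holds M x X) := by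
  simp only [iff, holds_and, holds_imp]; tauto

theorem holds_lt (t u : Term V .num n m) :
    (lt t u : Formula V q n m).Holds M x X ↔
      M.le (t.val M x X) (u.val M x X) ∧ t.val M x X ≠ u.val M x X := Iff.rfl

theorem holds_exNLe (t : Term V .num n m) (φ : Formula V true (n + 1) m) :
    (exNLe t φ).Holds M x X ↔ ∃ a, M.le a (t.val M x X) ∧ φ.Holds M (Fin.cons a x) X := by
  simp [exNLe, Term.val, holds_le]

theorem holds_allNLe (t : Term V .num n m) (φ : Formula V true (n + 1) m) :
    (allNLe t φ).Holds M x X ↔ ∀ a, M.le a (t.val M x X) → φ.Holds M (Fin.cons a x) X := by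
  simp [allNLe, Term.val, holds_le]

theorem holds_exNLt (t : Term V .num n m) (φ : Formula V true (n + 1) m) :
    (exNLt t φ).Holds M x X ↔
      ∃ a, (M.le a (t.val M x X) ∧ a ≠ t.val M x X) ∧ φ.Holds M (Fin.cons a x) X := by
  simp [exNLt, Term.val, holds_lt]

theorem holds_allNLt (t : Term V .num n m) (φ : Formula V true (n + 1) m) :
    (allNLt t φ).Holds M x X ↔
      ∀ a, (M.le a (t.val M x X) ∧ a ≠ t.val M x X) → φ.Holds M (Fin.cons a x) X := by
  simp [allNLt, Term.val, holds_lt]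

end

@[simp] theorem holds_toFull (M : Struct.{u} V) {q : Bool} {n m : ℕ} (φ : Formula V q n m)
    (x : Fin n → M.U .num) (X : Fin m → M.U .str) :
    φ.toFull.Holds M x X ↔ φ.Holds M x X := by
  induction φ with
  | tru | fls | eq | le | mem => rfl
  | not φ ih => simp only [toFull, holds_not, ih]
  | and φ ψ ih1 ih2 => simp only [toFull, holds_and, ih1, ih2]
  | or φ ψ ih1 ih2 => simp only [toFull, holds_or, ih1, ih2]
  | exN | allN | exS | allS => rfl

theorem cons_comp_lift {n n' : ℕ} {α : Type*} (f : Fin n → Fin n') (x : Fin n' → α)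
    (a : α) :
    (fun i => (Fin.cons a x : Fin (n' + 1) → α)
      ((Fin.cons 0 (fun i => (f i).succ) : Fin (n + 1) → Fin (n' + 1)) i)) =
      Fin.cons a (fun i => x (f i)) := by
  funext i
  refine Fin.cases ?_ (fun i => ?_) i <;> simp

@[simp] theorem holds_rename (M : Struct.{u} V) {q : Bool} {n m : ℕ} (φ : Formula V q n m) :
    ∀ {n' m' : ℕ} (f : Fin n → Fin n') (g : Fin m → Fin m') (x : Fin n' → M.U .num)
      (X : Fin m' → M.U .str),
      (φ.rename f g).Holds M x X ↔ φ.Holds M (fun i => x (f i)) (fun i => X (g i)) := by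
  induction φ with
  | tru | fls => intros; rfl
  | eq | le | mem => intros; simp [rename, holds_le, holds_mem]
  | not φ ih => intros; simp only [rename, holds_not, ih]
  | and φ ψ ih1 ih2 => intros; simp only [rename, holds_and, ih1, ih2]
  | or φ ψ ih1 ih2 => intros; simp only [rename, holds_or, ih1, ih2]
  | exN φ ih => intros; simp only [rename, holds_exN, ih, cons_comp_lift]
  | allN φ ih => intros; simp only [rename, holds_allN, ih, cons_comp_lift]
  | exS φ ih => intros; simp only [rename, holds_exS, ih, cons_comp_lift]
  | allS φ ih => intros; simp only [rename, holds_allS, ih, cons_comp_lift]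

theorem holds_subst (M : Struct.{u} V) {n m n' m' : ℕ} (σ : Fin n → Term V .num n' m')
    (τ : Fin m → Term V .str n' m') (x : Fin n' → M.U .num) (X : Fin m' → M.U .str) :
    ∀ φ : OpenFormula V n m, (φ.subst σ τ).Holds M x X ↔
      φ.Holds M (fun i => (σ i).val M x X) (fun i => (τ i).val M x X)
  | .tru => by simp [subst]
  | .fls => by simp [subst]
  | .eq t u => by simp [subst, Term.val_subst]
  | .le t u => by simp [subst, Term.val_subst, holds_le]
  | .mem t T => by simp [subst, Term.val_subst, holds_mem]
  | .not φ => by simp only [subst, holds_not, holds_subst M σ τ x X φ]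
  | .and φ ψ => by simp only [subst, holds_and, holds_subst M σ τ x X φ, holds_subst M σ τ x X ψ]
  | .or φ ψ => by simp only [subst, holds_or, holds_subst M σ τ x X φ, holds_subst M σ τ x X ψ]

theorem holds_lift [ExtendsL2A V] (N : Struct.{u} V) {q : Bool} {n m : ℕ} (φ : Formula L2A q n m)
    (x : Fin n → N.U .num) (X : Fin m → N.U .str) :
    (φ.lift : Formula V q n m).Holds N x X ↔ φ.Holds N.reduct x X := by
  induction φ with
  | tru | fls => rfl
  | eq t u => simp only [lift, holds_eq, Term.val_lift]; rfl
  | le t u => simp only [lift, holds_le, Term.val_lift]; rfl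
  | mem t u => simp only [lift, holds_mem, Term.val_lift]; rfl
  | not φ ih => simp only [lift, holds_not, ih]; rfl
  | and φ ψ ih1 ih2 => simp only [lift, holds_and, ih1, ih2]; rfl
  | or φ ψ ih1 ih2 => simp only [lift, holds_or, ih1, ih2]; rfl
  | exN φ ih => simp only [lift, holds_exN, ih]; rfl
  | allN φ ih => simp only [lift, holds_allN, ih]; rfl
  | exS φ ih => simp only [lift, holds_exS, ih]; rfl
  | allS φ ih => simp only [lift, holds_allS, ih]; rfl

theorem holds_exUniqueS (M : Struct.{u} V) {n m : ℕ} (φ : Formula V true n (m + 1))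
    (x : Fin n → M.U .num) (X : Fin m → M.U .str) :
    φ.exUniqueS.Holds M x X ↔ ∃! A, φ.Holds M x (Fin.cons A X) := by
  have h : ∀ A B, (fun i : Fin (m + 1) => (Fin.cons B (Fin.cons A X) : Fin (m + 2) → M.U .str)
      ((Fin.cons 0 (fun i => i.succ.succ) : Fin (m + 1) → Fin (m + 2)) i)) = Fin.cons B X := by
    intro A B; funext i; refine Fin.cases ?_ (fun i => ?_) i <;> simp
  simp only [exUniqueS, holds_exS, holds_and, holds_allS, holds_imp, holds_rename, h, id]
  rfl

theorem holds_exUniqueN (M : Struct.{u} V) {n m : ℕ} (φ : Formula V true (n + 1) m)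
    (x : Fin n → M.U .num) (X : Fin m → M.U .str) :
    φ.exUniqueN.Holds M x X ↔ ∃! a, φ.Holds M (Fin.cons a x) X := by
  have h : ∀ A B, (fun i : Fin (n + 1) => (Fin.cons B (Fin.cons A x) : Fin (n + 2) → M.U .num)
      ((Fin.cons 0 (fun i => i.succ.succ) : Fin (n + 1) → Fin (n + 2)) i)) = Fin.cons B x := by
    intro A B; funext i; refine Fin.cases ?_ (fun i => ?_) i <;> simp
  simp only [exUniqueN, holds_exN, holds_and, holds_allN, holds_imp, holds_rename, h, id]
  rfl

theorem holds_closeS (M : Struct.{u} V) {n : ℕ} (x : Fin n → M.U .num) :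
    ∀ {m : ℕ} (φ : Formula V true n m) (X₀ : Fin 0 → M.U .str),
      φ.closeS.Holds M x X₀ ↔ ∀ X, φ.Holds M x X
  | 0, φ, X₀ => by
      simp only [closeS]
      exact ⟨fun h X => Subsingleton.elim X₀ X ▸ h, fun h => h _⟩
  | m + 1, φ, X₀ => by
      simp only [closeS]
      rw [holds_closeS M x]
      exact ⟨fun h X => by simpa using h (Fin.tail X) (X 0), fun h X A => h _⟩

theorem holds_closeN (M : Struct.{u} V) {m : ℕ} (X : Fin m → M.U .str) :
    ∀ {n : ℕ} (φ : Formula V true n m) (x₀ : Fin 0 → M.U .num),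
      φ.closeN.Holds M x₀ X ↔ ∀ x, φ.Holds M x X
  | 0, φ, X₀ => by
      simp only [closeN]
      exact ⟨fun h X => Subsingleton.elim X₀ X ▸ h, fun h => h _⟩
  | n + 1, φ, X₀ => by
      simp only [closeN]
      rw [holds_closeN M X]
      exact ⟨fun h x => by simpa using h (Fin.tail x) (x 0), fun h X A => h _⟩

theorem holds_closure (M : Struct.{u} V) {n m : ℕ} (φ : Formula V true n m)
    (x₀ : Fin 0 → M.U .num) (X₀ : Fin 0 → M.U .str) :
    φ.closure.Holds M x₀ X₀ ↔ ∀ x X, φ.Holds M x X := by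
  simp only [closure, holds_closeN, holds_closeS]

theorem IsSigma0B.rename {n m : ℕ} {φ : Formula L2A true n m} (h : IsSigma0B φ) :
    ∀ {n' m' : ℕ} (f : Fin n → Fin n') (g : Fin m → Fin m'), IsSigma0B (φ.rename f g) := by
  induction h with
  | tru => intros; exact .tru
  | fls => intros; exact .fls
  | eq => intros; exact .eq _ _
  | le => intros; exact .le _ _
  | mem => intros; exact .mem _ _
  | not _ ih => intros; exact .not (ih _ _)
  | and _ _ ih1 ih2 => intros; exact .and (ih1 _ _) (ih2 _ _)
  | or _ _ ih1 ih2 => intros; exact .or (ih1 _ _) (ih2 _ _)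
  | exNLe t _ ih =>
    intro n' m' f g
    have := IsSigma0B.exNLe (t.rename f g) (ih (Fin.cons 0 fun i => (f i).succ) g)
    simpa only [Formula.exNLe, Formula.rename, Term.shiftN_rename,
      Term.rename_nvar_zero] using this
  | allNLe t _ ih =>
    intro n' m' f g
    have := IsSigma0B.allNLe (t.rename f g) (ih (Fin.cons 0 fun i => (f i).succ) g)
    simpa only [Formula.allNLe, imp, Formula.rename, Term.shiftN_rename,
      Term.rename_nvar_zero] using this
  | exNLt t _ ih =>
    intro n' m' f g
    have := IsSigma0B.exNLt (t.rename f g) (ih (Fin.cons 0 fun i => (f i).succ) g)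
    simpa only [Formula.exNLt, lt, Formula.rename, Term.shiftN_rename,
      Term.rename_nvar_zero] using this
  | allNLt t _ ih =>
    intro n' m' f g
    have := IsSigma0B.allNLt (t.rename f g) (ih (Fin.cons 0 fun i => (f i).succ) g)
    simpa only [Formula.allNLt, lt, imp, Formula.rename, Term.shiftN_rename,
      Term.rename_nvar_zero] using this

theorem IsSigma11.rename {n m : ℕ} {φ : Formula L2A true n m} (h : IsSigma11 φ) :
    ∀ {n' m' : ℕ} (f : Fin n → Fin n') (g : Fin m → Fin m'), IsSigma11 (φ.rename f g) := by
  induction h with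
  | sigma0B h => intros; exact .sigma0B (h.rename _ _)
  | exS _ ih => intros; exact .exS (ih _ _)

/-- Up to equivalence, the `Σ¹₁` formulas are closed under conjunction: the blocks of quantifiers
of the two conjuncts are put one after the other. -/
theorem IsSigma11.exists_and {n m : ℕ} {φ : Formula L2A true n m} (h : IsSigma11 φ) :
    ∀ {ψ : Formula L2A true n m}, IsSigma11 ψ → ∃ χ : Formula L2A true n m, IsSigma11 χ ∧
      ∀ (M : Struct.{u} L2A) (x : Fin n → M.U .num) (X : Fin m → M.U .str),
        χ.Holds M x X ↔ φ.Holds M x X ∧ ψ.Holds M x X := by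
  induction h with
  | @sigma0B m φ h =>
    intro ψ h'
    induction h' with
    | sigma0B h' => exact ⟨_, .sigma0B (h.and h'), fun _ _ _ => Iff.rfl⟩
    | @exS m ψ _ ih =>
      obtain ⟨χ, hχ, H⟩ := ih (φ := φ.rename id Fin.succ) (h.rename _ _)
      refine ⟨_, hχ.exS, fun M x X => ?_⟩
      simp [H]
  | @exS m φ _ ih =>
    intro ψ h'
    obtain ⟨χ, hχ, H⟩ := ih (h'.rename id Fin.succ)
    refine ⟨_, hχ.exS, fun M x X => ?_⟩
    simp [H]

end Formula

/-- A formula whose universal closure is an axiom holds in all models under all assignments. -/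
theorem Struct.holds_closure_of_models {M : Struct.{u} V} {T : Theory V} (h : M.Models T) {n m : ℕ}
    {φ : Formula V true n m} (hφ : φ.closure ∈ T) (x : Fin n → M.U .num) (X : Fin m → M.U .str) :
    φ.Holds M x X :=
  (Formula.holds_closure M φ _ _).1 (h _ hφ) x X

end Operations

/-! ### Structures for `L²_A` and the axioms of `V⁰` -/

namespace Struct

variable {M : Struct.{u} L2A}

instance : Zero (M.U .num) := ⟨M.fn .zero ![] ![]⟩
instance : One (M.U .num) := ⟨M.fn .one ![] ![]⟩
instance : Add (M.U .num) := ⟨fun a b => M.fn .add ![a, b] ![]⟩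
instance : Mul (M.U .num) := ⟨fun a b => M.fn .mul ![a, b] ![]⟩
instance : LE (M.U .num) := ⟨M.le⟩
instance : LT (M.U .num) := ⟨fun a b => a ≤ b ∧ a ≠ b⟩
instance : Membership (M.U .num) (M.U .str) := ⟨fun A a => M.mem a A⟩

/-- The length `|A|`. -/
def len (A : M.U .str) : M.U .num := M.fn .len ![] ![A]

/-- The pairing function `⟨a, b⟩ = (a + b)(a + b + 1) + 2b`. -/
def pr (a b : M.U .num) : M.U .num := (a + b) * (a + b + 1) + (1 + 1) * b

theorem lt_def (a b : M.U .num) : a < b ↔ a ≤ b ∧ a ≠ b := Iff.rfl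

end Struct

section Values

variable {V : Vocabulary} [ExtendsL2A V] (N : Struct.{u} V) {n m : ℕ}
  (x : Fin n → N.U .num) (X : Fin m → N.U .str)

theorem Term.val_zero : (0 : Term V .num n m).val N x X = (0 : N.reduct.U .num) := by
  change N.fn _ _ _ = N.fn _ _ _
  congr 1 <;> exact Subsingleton.elim _ _

theorem Term.val_one : (1 : Term V .num n m).val N x X = (1 : N.reduct.U .num) := by
  change N.fn _ _ _ = N.fn _ _ _
  congr 1 <;> exact Subsingleton.elim _ _

theorem Term.val_add (t u : Term V .num n m) : (t + u).val N x X =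
    (show N.reduct.U .num from t.val N x X) + (show N.reduct.U .num from u.val N x X) := by
  change N.fn _ _ _ = N.fn _ _ _
  congr 1
  · funext i; fin_cases i <;> rfl
  · exact Subsingleton.elim _ _

theorem Term.val_mul (t u : Term V .num n m) : (t * u).val N x X =
    (show N.reduct.U .num from t.val N x X) * (show N.reduct.U .num from u.val N x X) := by
  change N.fn _ _ _ = N.fn _ _ _
  congr 1
  · funext i; fin_cases i <;> rfl
  · exact Subsingleton.elim _ _

theorem Term.val_len (T : Term V .str n m) : T.len.val N x X =
    Struct.len (show N.reduct.U .str from T.val N x X) := by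
  change N.fn _ _ _ = N.fn _ _ _
  congr 1
  · exact Subsingleton.elim _ _
  · funext i; fin_cases i; rfl

theorem Term.val_pair (t u : Term V .num n m) : (t.pair u).val N x X =
    pr (show N.reduct.U .num from t.val N x X) (show N.reduct.U .num from u.val N x X) := by
  simp only [pair, val_add, val_mul, val_one, pr]
  rfl

end Values

section L2AValues

variable (M : Struct.{u} L2A) {n m : ℕ} (x : Fin n → M.U .num) (X : Fin m → M.U .str)

@[simp] theorem Term.val_zero' : (0 : Term L2A .num n m).val M x X = 0 := val_zero M x X
@[simp] theorem Term.val_one' : (1 : Term L2A .num n m).val M x X = 1 := val_one M x X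
@[simp] theorem Term.val_add' (t u : Term L2A .num n m) :
    (t + u).val M x X = t.val M x X + u.val M x X := val_add M x X t u
@[simp] theorem Term.val_mul' (t u : Term L2A .num n m) :
    (t * u).val M x X = t.val M x X * u.val M x X := val_mul M x X t u
@[simp] theorem Term.val_len' (T : Term L2A .str n m) :
    T.len.val M x X = Struct.len (T.val M x X) := val_len M x X T
@[simp] theorem Term.val_pair' (t u : Term L2A .num n m) :
    (t.pair u).val M x X = pr (t.val M x X) (u.val M x X) := val_pair M x X t u

theorem Term.val_app_zero (xs : Fin 0 → Term L2A .num n m) (Xs : Fin 0 → Term L2A .str n m) :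
    (app L2A.zero xs Xs).val M x X = (0 : M.U .num) := by
  change M.fn _ _ _ = M.fn _ _ _
  congr 1 <;> exact Subsingleton.elim _ _

theorem Term.val_app_one (xs : Fin 0 → Term L2A .num n m) (Xs : Fin 0 → Term L2A .str n m) :
    (app L2A.one xs Xs).val M x X = (1 : M.U .num) := by
  change M.fn _ _ _ = M.fn _ _ _
  congr 1 <;> exact Subsingleton.elim _ _

theorem Term.val_app_add (xs : Fin 2 → Term L2A .num n m) (Xs : Fin 0 → Term L2A .str n m) :
    (app L2A.add xs Xs).val M x X = (xs 0).val M x X + (xs 1).val M x X := by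
  change M.fn _ _ _ = M.fn _ _ _
  congr 1
  · funext i; fin_cases i <;> rfl
  · exact Subsingleton.elim _ _

theorem Term.val_app_mul (xs : Fin 2 → Term L2A .num n m) (Xs : Fin 0 → Term L2A .str n m) :
    (app L2A.mul xs Xs).val M x X = (xs 0).val M x X * (xs 1).val M x X := by
  change M.fn _ _ _ = M.fn _ _ _
  congr 1
  · funext i; fin_cases i <;> rfl
  · exact Subsingleton.elim _ _

theorem Term.val_app_len (xs : Fin 0 → Term L2A .num n m) (Xs : Fin 1 → Term L2A .str n m) :
    (app L2A.len xs Xs).val M x X = Struct.len ((Xs 0).val M x X) := by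
  change M.fn _ _ _ = M.fn _ _ _
  congr 1
  · exact Subsingleton.elim _ _
  · funext i; fin_cases i; rfl

namespace Formula

variable {M x X} {q : Bool}

@[simp] theorem holds_le' (t u : Term L2A .num n m) :
    (le t u : Formula L2A q n m).Holds M x X ↔ t.val M x X ≤ u.val M x X := Iff.rfl

@[simp] theorem holds_mem' (t : Term L2A .num n m) (T : Term L2A .str n m) :
    (mem t T : Formula L2A q n m).Holds M x X ↔ t.val M x X ∈ T.val M x X := Iff.rfl

@[simp] theorem holds_lt' (t u : Term L2A .num n m) :
    (lt t u : Formula L2A q n m).Holds M x X ↔ t.val M x X < u.val M x X := Iff.rfl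

@[simp] theorem holds_exNLe' (t : Term L2A .num n m) (φ : Formula L2A true (n + 1) m) :
    (exNLe t φ).Holds M x X ↔ ∃ a, a ≤ t.val M x X ∧ φ.Holds M (Fin.cons a x) X :=
  holds_exNLe t φ

@[simp] theorem holds_allNLe' (t : Term L2A .num n m) (φ : Formula L2A true (n + 1) m) :
    (allNLe t φ).Holds M x X ↔ ∀ a, a ≤ t.val M x X → φ.Holds M (Fin.cons a x) X :=
  holds_allNLe t φ

@[simp] theorem holds_exNLt' (t : Term L2A .num n m) (φ : Formula L2A true (n + 1) m) :
    (exNLt t φ).Holds M x X ↔ ∃ a, a < t.val M x X ∧ φ.Holds M (Fin.cons a x) X :=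
  holds_exNLt t φ

@[simp] theorem holds_allNLt' (t : Term L2A .num n m) (φ : Formula L2A true (n + 1) m) :
    (allNLt t φ).Holds M x X ↔ ∀ a, a < t.val M x X → φ.Holds M (Fin.cons a x) X :=
  holds_allNLt t φ

end Formula

end L2AValues

/-- The axioms B1 – B11, L1 and L2, read in a structure. -/
class IsBasic (M : Struct.{u} L2A) : Prop where
  b1 : ∀ a : M.U .num, a + 1 ≠ 0
  b2 : ∀ a b : M.U .num, a + 1 = b + 1 → a = b
  b3 : ∀ a : M.U .num, a + 0 = a
  b4 : ∀ a b : M.U .num, a + (b + 1) = a + b + 1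
  b5 : ∀ a : M.U .num, a * 0 = 0
  b6 : ∀ a b : M.U .num, a * (b + 1) = a * b + a
  b7 : ∀ a b : M.U .num, a ≤ b ∧ b ≤ a → a = b
  b8 : ∀ a : M.U .num, 0 ≤ a
  b9 : ∀ a b c : M.U .num, a ≤ b ∧ b ≤ c → a ≤ c
  b10 : ∀ a b : M.U .num, a ≤ b ∨ b ≤ a
  b11 : ∀ a b : M.U .num, a ≤ b ↔ a < b + 1
  l1 : ∀ (a : M.U .num) (A : M.U .str), a ∈ A → a < len A
  l2 : ∀ (a : M.U .num) (A : M.U .str), a + 1 = len A → a ∈ A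

/-- The axioms of `V⁰`, read in a structure. -/
class IsV0 (M : Struct.{u} L2A) : Prop extends IsBasic M where
  b12 : ∀ a : M.U .num, a ≠ 0 → ∃ b, b < a ∧ b + 1 = a
  se : ∀ A B : M.U .str, A = B ↔ len A = len B ∧ ∀ z, z < len A → (z ∈ A ↔ z ∈ B)
  comp : ∀ {n m : ℕ} (φ : Formula L2A true (n + 1) m), φ.IsSigma0B →
    ∀ (x : Fin n → M.U .num) (X : Fin m → M.U .str) (a : M.U .num),
      ∃ A, len A ≤ a ∧ ∀ z, z < a → (z ∈ A ↔ φ.Holds M (Fin.cons z x) X)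

theorem isBasic_iff {V : Vocabulary} [ExtendsL2A V] (N : Struct.{u} V) :
    IsBasic N.reduct ↔ ∀ (n m : ℕ) (α : OpenFormula V n m), BasicOpen V n m α →
      ∀ x X, α.Holds N x X := by
  constructor
  · intro h n m α hα x X
    cases hα <;>
      simp only [Formula.holds_not, Formula.holds_eq, Formula.holds_imp, Formula.holds_le,
        Formula.holds_and, Formula.holds_or, Formula.holds_iff, Formula.holds_lt,
        Formula.holds_mem, Term.val_zero, Term.val_one, Term.val_add, Term.val_mul, Term.val_len]
    exacts [h.b1 _, h.b2 _ _, h.b3 _, h.b4 _ _, h.b5 _, h.b6 _ _, h.b7 _ _, h.b8 _, h.b9 _ _ _,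
      h.b10 _ _, h.b11 _ _, h.l1 _ _, h.l2 _ _]
  · intro h
    have h1 := h _ _ _ .B1
    have h2 := h _ _ _ .B2
    have h3 := h _ _ _ .B3
    have h4 := h _ _ _ .B4
    have h5 := h _ _ _ .B5
    have h6 := h _ _ _ .B6
    have h7 := h _ _ _ .B7
    have h8 := h _ _ _ .B8
    have h9 := h _ _ _ .B9
    have h10 := h _ _ _ .B10
    have h11 := h _ _ _ .B11
    have h12 := h _ _ _ .L1
    have h13 := h _ _ _ .L2
    simp only [Formula.holds_not, Formula.holds_eq, Formula.holds_imp, Formula.holds_le,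
        Formula.holds_and, Formula.holds_or, Formula.holds_iff, Formula.holds_lt,
        Formula.holds_mem, Term.val_zero, Term.val_one, Term.val_add, Term.val_mul, Term.val_len]
      at h1 h2 h3 h4 h5 h6 h7 h8 h9 h10 h11 h12 h13
    exact ⟨fun a => h1 ![a] ![], fun a b => h2 ![a, b] ![], fun a => h3 ![a] ![],
      fun a b => h4 ![a, b] ![], fun a => h5 ![a] ![], fun a b => h6 ![a, b] ![],
      fun a b => h7 ![a, b] ![], fun a => h8 ![a] ![], fun a b c => h9 ![a, b, c] ![],
      fun a b => h10 ![a, b] ![], fun a b => h11 ![a, b] ![], fun a A => h12 ![a] ![A],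
      fun a A => h13 ![a] ![A]⟩

theorem isBasic_iff_L2A (M : Struct.{u} L2A) :
    IsBasic M ↔ ∀ (n m : ℕ) (α : OpenFormula L2A n m), BasicOpen L2A n m α →
      ∀ x X, α.Holds M x X := isBasic_iff M

theorem models_V0_iff (M : Struct.{u} L2A) : M.Models V0 ↔ IsV0 M := by
  constructor
  · intro h
    have H : ∀ {n m : ℕ} {φ : Formula L2A true n m}, V0Axiom n m φ → ∀ x X, φ.Holds M x X :=
      fun hφ => holds_closure_of_models h ⟨_, _, _, hφ, rfl⟩
    have hb : IsBasic M := (isBasic_iff_L2A M).2 fun n m α hα x X => by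
      simpa using H (.basic hα) x X
    have h12 := H .B12
    have hse := H .SE
    refine { hb with b12 := fun a ha => ?_, se := fun A B => ?_, comp := ?_ }
    · have := h12 ![a] ![]
      simp at this
      exact this ha
    · have := hse ![] ![A, B]
      simp at this
      exact this
    · intro n m φ hφ x X a
      have := H (.comp (0 : Fin (n + 1))
        (φ.rename (Fin.cons 0 (fun i => i.succ.succ)) id) (hφ.rename _ _)) (Fin.cons a x) X
      simp only [Formula.exSLe, Formula.holds_exS, Formula.holds_and, Formula.holds_le',
        Term.val_len', Term.val_shiftS, Formula.holds_allNLt', Formula.holds_iff,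
        Formula.holds_mem', Formula.holds_rename, Term.val_nvar, Term.val_svar, Fin.cons_zero, id,
        Fin.cons_succ]
        at this
      obtain ⟨A, hA, hA'⟩ := this
      refine ⟨A, hA, fun z hz => (hA' z hz).trans ?_⟩
      have e : (fun i : Fin (n + 1) => (Fin.cons z (Fin.cons a x) : Fin (n + 2) → M.U .num)
        ((Fin.cons 0 (fun i => i.succ.succ) : Fin (n + 1) → Fin (n + 2)) i)) = Fin.cons z x := by
        funext i; refine Fin.cases ?_ (fun i => ?_) i <;> simp
      rw [e]
  · rintro h _ ⟨n, m, φ, hφ, rfl⟩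
    rw [Formula.holds_closure]
    intro x X
    cases hφ with
    | basic hα => simpa using (isBasic_iff_L2A M).1 h.toIsBasic _ _ _ hα x X
    | B12 => simpa using h.b12 (x 0)
    | SE => simpa using h.se (X 0) (X 1)
    | comp a φ hφ => simpa [Formula.exSLe] using h.comp φ hφ x X (x a)

/-! ### Definability by `Σ₀ᴮ` formulas -/

section Definability

variable {K : Type w} {S : K → Struct.{u} L2A}

/-- For a family `S` of structures, a choice of the families of elements that may be used as
parameters in definitions that are uniform in the index. -/
structure Params (S : K → Struct.{u} L2A) where
  nums : Set (∀ k, (S k).U .num)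
  strs : Set (∀ k, (S k).U .str)

/-- All families of elements as parameters. -/
def Params.all : Params S := ⟨Set.univ, Set.univ⟩

/-- `s` is one of the parameters in `A`. -/
class Allowed {α : Type*} (s : α) (A : Set α) : Prop where
  out : s ∈ A

instance (s : ∀ k, (S k).U .num) : Allowed s (Params.all (S := S)).nums := ⟨trivial⟩
instance (s : ∀ k, (S k).U .str) : Allowed s (Params.all (S := S)).strs := ⟨trivial⟩

/-- The number functions given, uniformly in the index, by a number term of `L²_A` with
parameters. The class mechanism serves to find such terms automatically. -/
class inductive Poly (Pa : Params S) :
    {n : ℕ} → (∀ k, (Fin n → (S k).U .num) → (S k).U .num) → Prop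
  | var {n : ℕ} (i : Fin n) : Poly Pa (fun _ x => x i)
  | const {n : ℕ} (c : ∀ k, (S k).U .num) : c ∈ Pa.nums → Poly Pa (n := n) (fun k _ => c k)
  | zero {n : ℕ} : Poly Pa (n := n) (fun _ _ => 0)
  | one {n : ℕ} : Poly Pa (n := n) (fun _ _ => 1)
  | add {n : ℕ} {f g : ∀ k, (Fin n → (S k).U .num) → (S k).U .num} :
      Poly Pa f → Poly Pa g → Poly Pa (fun k x => f k x + g k x)
  | mul {n : ℕ} {f g : ∀ k, (Fin n → (S k).U .num) → (S k).U .num} :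
      Poly Pa f → Poly Pa g → Poly Pa (fun k x => f k x * g k x)
  | len {n : ℕ} (s : ∀ k, (S k).U .str) : s ∈ Pa.strs →
      Poly Pa (n := n) (fun k _ => Struct.len (s k))

/-- The relations between numbers that are defined, uniformly in the index, by a `Σ₀ᴮ` formula
with parameters. The class mechanism serves to find such definitions automatically. -/
class inductive Sig0 (Pa : Params S) : {n : ℕ} → (∀ k, (Fin n → (S k).U .num) → Prop) → Prop
  | eq {n : ℕ} {f g : ∀ k, (Fin n → (S k).U .num) → (S k).U .num} :
      Poly Pa f → Poly Pa g → Sig0 Pa (fun k x => f k x = g k x)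
  | le {n : ℕ} {f g : ∀ k, (Fin n → (S k).U .num) → (S k).U .num} :
      Poly Pa f → Poly Pa g → Sig0 Pa (fun k x => f k x ≤ g k x)
  | mem {n : ℕ} {f : ∀ k, (Fin n → (S k).U .num) → (S k).U .num} {s : ∀ k, (S k).U .str} :
      Poly Pa f → s ∈ Pa.strs → Sig0 Pa (fun k x => f k x ∈ s k)
  | not {n : ℕ} {P : ∀ k, (Fin n → (S k).U .num) → Prop} :
      Sig0 Pa P → Sig0 Pa (fun k x => ¬ P k x)
  | and {n : ℕ} {P Q : ∀ k, (Fin n → (S k).U .num) → Prop} :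
      Sig0 Pa P → Sig0 Pa Q → Sig0 Pa (fun k x => P k x ∧ Q k x)
  | ex {n : ℕ} {f : ∀ k, (Fin n → (S k).U .num) → (S k).U .num}
      {Q : ∀ k, (Fin n → (S k).U .num) → (S k).U .num → Prop} :
      Poly Pa f →
      Sig0 Pa (fun k (v : Fin (n + 1) → (S k).U .num) => Q k (fun i => v i.succ) (v 0)) →
      Sig0 Pa (fun k x => ∃ y, y ≤ f k x ∧ Q k x y)

variable {Pa : Params S} {n : ℕ}

namespace Poly

instance (i : Fin n) : Poly Pa (fun _ x => x i) := .var i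
instance (c : ∀ k, (S k).U .num) [h : Allowed c Pa.nums] : Poly Pa (n := n) (fun k _ => c k) :=
  .const c h.out
instance : Poly Pa (n := n) (fun _ _ => 0) := .zero
instance : Poly Pa (n := n) (fun _ _ => 1) := .one
instance {f g : ∀ k, (Fin n → (S k).U .num) → (S k).U .num} [hf : Poly Pa f] [hg : Poly Pa g] :
    Poly Pa (fun k x => f k x + g k x) := .add hf hg
instance {f g : ∀ k, (Fin n → (S k).U .num) → (S k).U .num} [hf : Poly Pa f] [hg : Poly Pa g] :
    Poly Pa (fun k x => f k x * g k x) := .mul hf hg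
instance (s : ∀ k, (S k).U .str) [h : Allowed s Pa.strs] :
    Poly Pa (n := n) (fun k _ => Struct.len (s k)) := .len s h.out
instance {f g : ∀ k, (Fin n → (S k).U .num) → (S k).U .num} [hf : Poly Pa f] [hg : Poly Pa g] :
    Poly Pa (fun k x => pr (f k x) (g k x)) :=
  .add (.mul (.add hf hg) (.add (.add hf hg) .one)) (.mul (.add .one .one) hg)

theorem reindex {f : ∀ k, (Fin n → (S k).U .num) → (S k).U .num} (h : Poly Pa f) {n' : ℕ}
    (ρ : Fin n → Fin n') : Poly Pa (fun k x => f k (fun i => x (ρ i))) := by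
  induction h with
  | var i => exact .var _
  | const c h => exact .const c h
  | zero => exact .zero
  | one => exact .one
  | add _ _ h1 h2 => exact .add h1 h2
  | mul _ _ h1 h2 => exact .mul h1 h2
  | len s h => exact .len s h

end Poly

namespace Sig0

theorem congr {P Q : ∀ k, (Fin n → (S k).U .num) → Prop} (h : Sig0 Pa P)
    (e : ∀ k x, Q k x ↔ P k x) : Sig0 Pa Q := by
  have : Q = P := by funext k x; exact propext (e k x)
  exact this ▸ h

theorem reindex {P : ∀ k, (Fin n → (S k).U .num) → Prop} (h : Sig0 Pa P) {n' : ℕ}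
    (ρ : Fin n → Fin n') : Sig0 Pa (fun k x => P k (fun i => x (ρ i))) := by
  induction h generalizing n' with
  | eq hf hg => exact .eq (hf.reindex ρ) (hg.reindex ρ)
  | le hf hg => exact .le (hf.reindex ρ) (hg.reindex ρ)
  | mem hf hs => exact .mem (hf.reindex ρ) hs
  | not _ h => exact .not (h ρ)
  | and _ _ h1 h2 => exact .and (h1 ρ) (h2 ρ)
  | ex hf _ h => exact .ex (hf.reindex ρ) (h (Fin.cons 0 (fun i => (ρ i).succ)))

variable {P Q : ∀ k, (Fin n → (S k).U .num) → Prop}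

instance [hP : Sig0 Pa P] : Sig0 Pa (fun k x => ¬ P k x) := .not hP
instance [hP : Sig0 Pa P] [hQ : Sig0 Pa Q] : Sig0 Pa (fun k x => P k x ∧ Q k x) := .and hP hQ
instance [hP : Sig0 Pa P] [hQ : Sig0 Pa Q] : Sig0 Pa (fun k x => P k x ∨ Q k x) :=
  (hP.not.and hQ.not).not.congr fun _ _ => by tauto
instance [hP : Sig0 Pa P] [hQ : Sig0 Pa Q] : Sig0 Pa (fun k x => P k x → Q k x) :=
  (hP.and hQ.not).not.congr fun _ _ => by tauto
instance [hP : Sig0 Pa P] [hQ : Sig0 Pa Q] : Sig0 Pa (fun k x => P k x ↔ Q k x) :=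
  ((hP.and hQ.not).not.and (hQ.and hP.not).not).congr fun _ _ => by tauto

section OfPoly

variable {f g : ∀ k, (Fin n → (S k).U .num) → (S k).U .num}
  {R : ∀ k, (Fin n → (S k).U .num) → (S k).U .num → Prop}

theorem lt (hf : Poly Pa f) (hg : Poly Pa g) : Sig0 Pa (fun k x => f k x < g k x) :=
  (Sig0.le hf hg).and (Sig0.eq hf hg).not

theorem all (hf : Poly Pa f)
    (hR : Sig0 Pa (fun k (v : Fin (n + 1) → (S k).U .num) => R k (fun i => v i.succ) (v 0))) :
    Sig0 Pa (fun k x => ∀ y, y ≤ f k x → R k x y) :=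
  (Sig0.not (.ex (Q := fun k x y => ¬ R k x y) hf hR.not)).congr fun k x => by push Not; rfl

instance [hf : Poly Pa f] [hg : Poly Pa g] : Sig0 Pa (fun k x => f k x = g k x) := .eq hf hg
instance [hf : Poly Pa f] [hg : Poly Pa g] : Sig0 Pa (fun k x => f k x ≠ g k x) :=
  (Sig0.eq hf hg).not
instance [hf : Poly Pa f] [hg : Poly Pa g] : Sig0 Pa (fun k x => f k x ≤ g k x) := .le hf hg
instance [hf : Poly Pa f] [hg : Poly Pa g] : Sig0 Pa (fun k x => f k x < g k x) := .lt hf hg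
instance {s : ∀ k, (S k).U .str} [hf : Poly Pa f] [hs : Allowed s Pa.strs] :
    Sig0 Pa (fun k x => f k x ∈ s k) := .mem hf hs.out
instance [hf : Poly Pa f]
    [hR : Sig0 Pa (fun k (v : Fin (n + 1) → (S k).U .num) => R k (fun i => v i.succ) (v 0))] :
    Sig0 Pa (fun k x => ∃ y, y ≤ f k x ∧ R k x y) := .ex hf hR
instance [hf : Poly Pa f]
    [hR : Sig0 Pa (fun k (v : Fin (n + 1) → (S k).U .num) => R k (fun i => v i.succ) (v 0))] :
    Sig0 Pa (fun k x => ∀ y, y ≤ f k x → R k x y) := .all hf hR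
instance [hf : Poly Pa f]
    [hR : Sig0 Pa (fun k (v : Fin (n + 1) → (S k).U .num) => R k (fun i => v i.succ) (v 0))] :
    Sig0 Pa (fun k x => ∃ y, y < f k x ∧ R k x y) :=
  (Sig0.ex (Q := fun k x y => y ≠ f k x ∧ R k x y) hf
    (((Sig0.eq (.var 0) (hf.reindex Fin.succ)).not).and hR)).congr
      fun k x => by simp only [lt_def, and_assoc]
instance [hf : Poly Pa f]
    [hR : Sig0 Pa (fun k (v : Fin (n + 1) → (S k).U .num) => R k (fun i => v i.succ) (v 0))] :
    Sig0 Pa (fun k x => ∀ y, y < f k x → R k x y) :=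
  (Sig0.all (R := fun k x y => y ≠ f k x → R k x y) hf
    ((((Sig0.eq (.var 0) (hf.reindex Fin.succ)).not).and hR.not).not.congr
      fun k x => by tauto)).congr fun k x => by simp only [lt_def, and_imp]

end OfPoly

end Sig0

/-- The environment that consists of `x` followed by `c`. -/
def extend {α : Type*} {q : ℕ} (c : Fin q → α) : {n : ℕ} → (Fin n → α) → Fin (q + n) → α
  | 0, _ => c
  | _ + 1, x => Fin.cons (x 0) (extend c (Fin.tail x))

/-- The index in the environment `extend c x` of the entry of `c` of index `i`. -/
def castAddIndex {q : ℕ} : (n : ℕ) → Fin q → Fin (q + n)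
  | 0, i => i
  | n + 1, i => (castAddIndex n i).succ

/-- The index in the environment `extend c x` of the entry of `x` of index `i`. -/
def natAddIndex (q : ℕ) : {n : ℕ} → Fin n → Fin (q + n)
  | _ + 1, i => Fin.cases 0 (fun i => (natAddIndex q i).succ) i

theorem extend_castAddIndex {α : Type*} {q : ℕ} (c : Fin q → α) (i : Fin q) :
    ∀ {n : ℕ} (x : Fin n → α), extend c x (castAddIndex n i) = c i
  | 0, _ => rfl
  | n + 1, x => by simp [extend, castAddIndex, extend_castAddIndex c i]

theorem extend_natAddIndex {α : Type*} {q : ℕ} (c : Fin q → α) :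
    ∀ {n : ℕ} (x : Fin n → α) (i : Fin n), extend c x (natAddIndex q i) = x i
  | n + 1, x, i => by
      refine Fin.cases (by simp [extend, natAddIndex]) (fun i => ?_) i
      simp [extend, natAddIndex, extend_natAddIndex c, Fin.tail]

theorem Poly.exists_term {f : ∀ k, (Fin n → (S k).U .num) → (S k).U .num} (h : Poly Pa f) :
    ∃ (c : List (∀ k, (S k).U .num)) (s : List (∀ k, (S k).U .str)),
      (∀ a ∈ c, a ∈ Pa.nums) ∧ (∀ a ∈ s, a ∈ Pa.strs) ∧
      ∀ (q p : ℕ) (ν : Fin q → ∀ k, (S k).U .num) (σ : Fin p → ∀ k, (S k).U .str),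
        (∀ a ∈ c, ∃ i, ν i = a) → (∀ a ∈ s, ∃ i, σ i = a) →
        ∃ t : Term L2A .num (q + n) p, ∀ k x,
          t.val (S k) (extend (fun i => ν i k) x) (fun i => σ i k) = f k x := by
  induction h with
  | var i =>
    refine ⟨[], [], by simp, by simp, fun q p ν σ _ _ => ?_⟩
    exact ⟨.nvar (natAddIndex q i), fun k x => extend_natAddIndex _ _ _⟩
  | const c h =>
    refine ⟨[c], [], by simpa using h, by simp, fun q p ν σ hc _ => ?_⟩
    obtain ⟨i, rfl⟩ := hc c (by simp)
    exact ⟨.nvar (castAddIndex _ i), fun k x => extend_castAddIndex _ _ _⟩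
  | zero => exact ⟨[], [], by simp, by simp, fun q p ν σ _ _ => ⟨0, by simp⟩⟩
  | one => exact ⟨[], [], by simp, by simp, fun q p ν σ _ _ => ⟨1, by simp⟩⟩
  | add _ _ h1 h2 =>
    obtain ⟨c1, s1, hc1, hs1, h1⟩ := h1
    obtain ⟨c2, s2, hc2, hs2, h2⟩ := h2
    refine ⟨c1 ++ c2, s1 ++ s2, List.forall_mem_append.2 ⟨hc1, hc2⟩,
      List.forall_mem_append.2 ⟨hs1, hs2⟩, fun q p ν σ hc hs => ?_⟩
    rw [List.forall_mem_append] at hc hs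
    obtain ⟨t1, h1⟩ := h1 q p ν σ hc.1 hs.1
    obtain ⟨t2, h2⟩ := h2 q p ν σ hc.2 hs.2
    exact ⟨t1 + t2, fun k x => by simp [h1, h2]⟩
  | mul _ _ h1 h2 =>
    obtain ⟨c1, s1, hc1, hs1, h1⟩ := h1
    obtain ⟨c2, s2, hc2, hs2, h2⟩ := h2
    refine ⟨c1 ++ c2, s1 ++ s2, List.forall_mem_append.2 ⟨hc1, hc2⟩,
      List.forall_mem_append.2 ⟨hs1, hs2⟩, fun q p ν σ hc hs => ?_⟩
    rw [List.forall_mem_append] at hc hs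
    obtain ⟨t1, h1⟩ := h1 q p ν σ hc.1 hs.1
    obtain ⟨t2, h2⟩ := h2 q p ν σ hc.2 hs.2
    exact ⟨t1 * t2, fun k x => by simp [h1, h2]⟩
  | len s h =>
    refine ⟨[], [s], by simp, by simpa using h, fun q p ν σ _ hs => ?_⟩
    obtain ⟨i, rfl⟩ := hs s (by simp)
    exact ⟨.len (.svar i), by simp⟩

/-- The finitely many parameters that occur in a `Σ₀ᴮ` definition are collected in two lists, and
the defining formula exists in every context that contains them. -/
theorem Sig0.exists_formula {P : ∀ k, (Fin n → (S k).U .num) → Prop} (h : Sig0 Pa P) :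
    ∃ (c : List (∀ k, (S k).U .num)) (s : List (∀ k, (S k).U .str)),
      (∀ a ∈ c, a ∈ Pa.nums) ∧ (∀ a ∈ s, a ∈ Pa.strs) ∧
      ∀ (q p : ℕ) (ν : Fin q → ∀ k, (S k).U .num) (σ : Fin p → ∀ k, (S k).U .str),
        (∀ a ∈ c, ∃ i, ν i = a) → (∀ a ∈ s, ∃ i, σ i = a) →
        ∃ φ : Formula L2A true (q + n) p, φ.IsSigma0B ∧ ∀ k x,
          φ.Holds (S k) (extend (fun i => ν i k) x) (fun i => σ i k) ↔ P k x := by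
  induction h with
  | eq h1 h2 =>
    obtain ⟨c1, s1, hc1, hs1, h1⟩ := h1.exists_term
    obtain ⟨c2, s2, hc2, hs2, h2⟩ := h2.exists_term
    refine ⟨c1 ++ c2, s1 ++ s2, List.forall_mem_append.2 ⟨hc1, hc2⟩,
      List.forall_mem_append.2 ⟨hs1, hs2⟩, fun q p ν σ hc hs => ?_⟩
    rw [List.forall_mem_append] at hc hs
    obtain ⟨t1, h1⟩ := h1 q p ν σ hc.1 hs.1
    obtain ⟨t2, h2⟩ := h2 q p ν σ hc.2 hs.2
    exact ⟨.eq t1 t2, .eq _ _, fun k x => by simp [h1, h2]⟩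
  | le h1 h2 =>
    obtain ⟨c1, s1, hc1, hs1, h1⟩ := h1.exists_term
    obtain ⟨c2, s2, hc2, hs2, h2⟩ := h2.exists_term
    refine ⟨c1 ++ c2, s1 ++ s2, List.forall_mem_append.2 ⟨hc1, hc2⟩,
      List.forall_mem_append.2 ⟨hs1, hs2⟩, fun q p ν σ hc hs => ?_⟩
    rw [List.forall_mem_append] at hc hs
    obtain ⟨t1, h1⟩ := h1 q p ν σ hc.1 hs.1
    obtain ⟨t2, h2⟩ := h2 q p ν σ hc.2 hs.2
    exact ⟨.le t1 t2, .le _ _, fun k x => by simp [h1, h2]⟩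
  | @mem _ _ s h1 h =>
    obtain ⟨c1, s1, hc1, hs1, h1⟩ := h1.exists_term
    refine ⟨c1, s :: s1, hc1, List.forall_mem_cons.2 ⟨h, hs1⟩, fun q p ν σ hc hs => ?_⟩
    rw [List.forall_mem_cons] at hs
    obtain ⟨t1, h1⟩ := h1 q p ν σ hc hs.2
    obtain ⟨i, rfl⟩ := hs.1
    exact ⟨.mem t1 (.svar i), .mem _ _, fun k x => by simp [h1]⟩
  | not _ h =>
    obtain ⟨c, s, hc, hs, h⟩ := h
    refine ⟨c, s, hc, hs, fun q p ν σ hc hs => ?_⟩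
    obtain ⟨φ, hφ, h⟩ := h q p ν σ hc hs
    exact ⟨_, hφ.not, fun k x => by simp [h]⟩
  | and _ _ h1 h2 =>
    obtain ⟨c1, s1, hc1, hs1, h1⟩ := h1
    obtain ⟨c2, s2, hc2, hs2, h2⟩ := h2
    refine ⟨c1 ++ c2, s1 ++ s2, List.forall_mem_append.2 ⟨hc1, hc2⟩,
      List.forall_mem_append.2 ⟨hs1, hs2⟩, fun q p ν σ hc hs => ?_⟩
    rw [List.forall_mem_append] at hc hs
    obtain ⟨φ1, hφ1, h1⟩ := h1 q p ν σ hc.1 hs.1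
    obtain ⟨φ2, hφ2, h2⟩ := h2 q p ν σ hc.2 hs.2
    exact ⟨_, hφ1.and hφ2, fun k x => by simp [h1, h2]⟩
  | ex h1 _ h2 =>
    obtain ⟨c1, s1, hc1, hs1, h1⟩ := h1.exists_term
    obtain ⟨c2, s2, hc2, hs2, h2⟩ := h2
    refine ⟨c1 ++ c2, s1 ++ s2, List.forall_mem_append.2 ⟨hc1, hc2⟩,
      List.forall_mem_append.2 ⟨hs1, hs2⟩, fun q p ν σ hc hs => ?_⟩
    rw [List.forall_mem_append] at hc hs
    obtain ⟨t1, h1⟩ := h1 q p ν σ hc.1 hs.1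
    obtain ⟨φ2, hφ2, h2⟩ := h2 q p ν σ hc.2 hs.2
    refine ⟨_, .exNLe t1 hφ2, fun k x => ?_⟩
    rw [Formula.holds_exNLe', h1]
    exact exists_congr fun y => and_congr Iff.rfl (h2 k (Fin.cons y x))

end Definability

/-! ### Comprehension, induction and arithmetic in models of `V⁰` -/

/-- The relations on a single structure that are definable by `Σ₀ᴮ` formulas with arbitrary
parameters. -/
abbrev Sig0.Local (M : Struct.{u} L2A) {n : ℕ} (P : (Fin n → M.U .num) → Prop) : Prop :=
  Sig0 (Params.all (S := fun _ : Unit => M)) (fun _ => P)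

theorem IsBasic.le_refl {M : Struct.{u} L2A} [IsBasic M] (a : M.U .num) : a ≤ a :=
  (IsBasic.b10 a a).elim id id

section Comprehension

variable {M : Struct.{u} L2A} [IsV0 M]

theorem exists_comp (P : M.U .num → Prop) (a : M.U .num)
    [h : Sig0.Local M (fun v : Fin 1 → _ => P (v 0))] :
    ∃ A : M.U .str, len A ≤ a ∧ ∀ z, z < a → (z ∈ A ↔ P z) := by
  obtain ⟨c, s, -, -, h⟩ := h.exists_formula
  obtain ⟨φ, hφ, h⟩ := h _ _ c.get s.get (fun a ha => List.get_of_mem ha)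
    (fun a ha => List.get_of_mem ha)
  obtain ⟨A, hA, hA'⟩ := IsV0.comp φ hφ (fun i => c.get i ()) (fun i => s.get i ()) a
  refine ⟨A, hA, fun z hz => (hA' z hz).trans ?_⟩
  exact h () (fun _ => z)

theorem string_induction (A : M.U .str) (a : M.U .num) (h0 : 0 ∈ A)
    (hs : ∀ z, z < a → z ∈ A → z + 1 ∈ A) : a ∈ A := by
  obtain ⟨B, hB, hB'⟩ := exists_comp (fun z => ∀ y, y ≤ z → y ∈ A) (a + 1)
  have h01 : (0 : M.U .num) < a + 1 := (IsBasic.b11 0 a).1 (IsBasic.b8 a)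
  have h0B : (0 : M.U .num) ∈ B := (hB' 0 h01).2 fun y hy => by
    rwa [IsBasic.b7 y 0 ⟨hy, IsBasic.b8 y⟩]
  have hlen : len B ≠ 0 := fun h => by
    have := IsBasic.l1 _ _ h0B
    rw [h] at this
    exact this.2 rfl
  obtain ⟨y, hy, hyB⟩ := IsV0.b12 _ hlen
  have hyB' := IsBasic.l2 y B hyB
  have hya : y < a + 1 :=
    ⟨IsBasic.b9 _ _ _ ⟨hy.1, hB⟩, fun h => hy.2 (IsBasic.b7 _ _ ⟨hy.1, h ▸ hB⟩)⟩
  have hyA := (hB' y hya).1 hyB'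
  by_cases hne : y = a
  · exact hne ▸ hyA y (IsBasic.le_refl y)
  have hlt : y < a := ⟨(IsBasic.b11 y a).2 hya, hne⟩
  have hlt' : y + 1 < a + 1 := by
    refine ⟨?_, fun h => hne (IsBasic.b2 _ _ h)⟩
    rcases IsBasic.b10 (y + 1) (a + 1) with h | h
    · exact h
    · by_cases h' : a + 1 = y + 1
      · rw [h']; exact IsBasic.le_refl _
      · have := (IsBasic.b11 (a + 1) y).2 ⟨h, h'⟩
        exact absurd (IsBasic.b7 _ _ ⟨hya.1, this⟩) hya.2
  have : y + 1 ∈ B := (hB' _ hlt').2 fun z hz => by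
    by_cases h : z = y + 1
    · exact h ▸ hs y hlt (hyA y (IsBasic.le_refl y))
    · exact hyA z ((IsBasic.b11 _ _).2 ⟨hz, h⟩)
  have := IsBasic.l1 _ _ this
  exact absurd hyB this.2

/-- Induction for a predicate whose restrictions to initial segments are coded by strings. -/
theorem induction_of_comp {P : M.U .num → Prop}
    (hP : ∀ a, ∃ A : M.U .str, ∀ z, z < a → (z ∈ A ↔ P z)) (h0 : P 0)
    (hs : ∀ z, P z → P (z + 1)) (a : M.U .num) : P a := by
  obtain ⟨A, hA⟩ := hP (a + 1 + 1)
  have h1 : ∀ z, z ≤ a → z < a + 1 + 1 := fun z hz =>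
    (IsBasic.b11 _ _).1 (((IsBasic.b11 _ _).1 hz).1)
  have h2 : ∀ z, z < a → z + 1 < a + 1 + 1 := fun z hz => by
    rcases IsBasic.b10 (z + 1) (a + 1) with h | h
    · exact (IsBasic.b11 _ _).1 h
    · by_cases h' : a + 1 = z + 1
      · rw [h']; exact (IsBasic.b11 _ _).1 (IsBasic.le_refl _)
      · have := (IsBasic.b11 (a + 1) z).2 ⟨h, h'⟩
        have h3 := (IsBasic.b11 z a).1 hz.1
        exact absurd (IsBasic.b7 _ _ ⟨h3.1, this⟩) h3.2
  refine (hA a (h1 a (IsBasic.le_refl a))).1 (string_induction A a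
    ((hA 0 (h1 0 (IsBasic.b8 a))).2 h0) fun z hz hzA => ?_)
  exact (hA _ (h2 z hz)).2 (hs z ((hA z (h1 z hz.1)).1 hzA))

/-- Induction for `Σ₀ᴮ` definable predicates. -/
theorem sig0_induction (P : M.U .num → Prop) [Sig0.Local M (fun v : Fin 1 → _ => P (v 0))]
    (h0 : P 0) (hs : ∀ z, P z → P (z + 1)) (a : M.U .num) : P a :=
  induction_of_comp (fun a => (exists_comp P a).imp fun _ h => h.2) h0 hs a

end Comprehension

section Order

variable {M : Struct.{u} L2A} [IsBasic M]

noncomputable instance : LinearOrder (M.U .num) where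
  le_refl := IsBasic.le_refl
  le_trans a b c h1 h2 := IsBasic.b9 a b c ⟨h1, h2⟩
  le_antisymm a b h1 h2 := IsBasic.b7 a b ⟨h1, h2⟩
  le_total := IsBasic.b10
  lt_iff_le_not_ge a b := ⟨fun h => ⟨h.1, fun h' => h.2 (IsBasic.b7 a b ⟨h.1, h'⟩)⟩,
    fun h => ⟨h.1, fun h' => h.2 (h' ▸ IsBasic.le_refl a)⟩⟩
  toDecidableLE := Classical.decRel _

theorem lt_add_one_iff' {a b : M.U .num} : a < b + 1 ↔ a ≤ b := (IsBasic.b11 a b).symm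

theorem add_one_le_iff' {a b : M.U .num} : a + 1 ≤ b ↔ a < b := by
  rw [← not_lt, lt_add_one_iff', not_le]

end Order

section Arithmetic

variable {M : Struct.{u} L2A} [IsV0 M]

namespace Arith

theorem zero_add (a : M.U .num) : 0 + a = a := by
  refine sig0_induction (fun a => 0 + a = a) (IsBasic.b3 0) (fun z h => ?_) a
  rw [IsBasic.b4, h]

theorem add_right_comm_one (a b : M.U .num) : a + 1 + b = a + b + 1 := by
  refine sig0_induction (fun b => a + 1 + b = a + b + 1) ?_ (fun z h => ?_) b
  · rw [IsBasic.b3, IsBasic.b3]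
  · rw [IsBasic.b4, IsBasic.b4, h]

theorem add_comm (a b : M.U .num) : a + b = b + a := by
  refine sig0_induction (fun b => a + b = b + a) ?_ (fun z h => ?_) b
  · rw [IsBasic.b3, zero_add]
  · rw [IsBasic.b4, add_right_comm_one, h]

theorem add_assoc (a b c : M.U .num) : a + b + c = a + (b + c) := by
  refine sig0_induction (fun c => a + b + c = a + (b + c)) ?_ (fun z h => ?_) c
  · rw [IsBasic.b3, IsBasic.b3]
  · rw [IsBasic.b4, IsBasic.b4, IsBasic.b4, h]

theorem zero_mul (a : M.U .num) : 0 * a = 0 := by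
  refine sig0_induction (fun a => 0 * a = 0) (IsBasic.b5 0) (fun z h => ?_) a
  rw [IsBasic.b6, h, IsBasic.b3]

theorem succ_mul (a b : M.U .num) : (a + 1) * b = a * b + b := by
  refine sig0_induction (fun b => (a + 1) * b = a * b + b) ?_ (fun z h => ?_) b
  · rw [IsBasic.b5, IsBasic.b5, IsBasic.b3]
  · rw [IsBasic.b6, IsBasic.b6, h, IsBasic.b4 (a * z + z), IsBasic.b4 (a * z + a),
      add_assoc (a * z) z a, add_assoc (a * z) a z, add_comm z a]

theorem mul_comm (a b : M.U .num) : a * b = b * a := by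
  refine sig0_induction (fun b => a * b = b * a) ?_ (fun z h => ?_) b
  · rw [IsBasic.b5, zero_mul]
  · rw [IsBasic.b6, succ_mul, h]

theorem mul_add (a b c : M.U .num) : a * (b + c) = a * b + a * c := by
  refine sig0_induction (fun c => a * (b + c) = a * b + a * c) ?_ (fun z h => ?_) c
  · rw [IsBasic.b3, IsBasic.b5, IsBasic.b3]
  · rw [IsBasic.b4, IsBasic.b6, IsBasic.b6, h, add_assoc]

theorem mul_assoc (a b c : M.U .num) : a * b * c = a * (b * c) := by
  refine sig0_induction (fun c => a * b * c = a * (b * c)) ?_ (fun z h => ?_) c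
  · rw [IsBasic.b5, IsBasic.b5, IsBasic.b5]
  · rw [IsBasic.b6, IsBasic.b6, mul_add, h]

theorem one_mul (a : M.U .num) : 1 * a = a := by
  rw [← zero_add 1, succ_mul, zero_mul, zero_add]

end Arith

noncomputable instance : CommSemiring (M.U .num) where
  add_assoc := Arith.add_assoc
  zero_add := Arith.zero_add
  add_zero := IsBasic.b3
  add_comm := Arith.add_comm
  mul_assoc := Arith.mul_assoc
  one_mul := Arith.one_mul
  mul_one a := by rw [Arith.mul_comm, Arith.one_mul]
  zero_mul := Arith.zero_mul
  mul_zero := IsBasic.b5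
  mul_comm := Arith.mul_comm
  left_distrib := Arith.mul_add
  right_distrib a b c := by
    rw [Arith.mul_comm, Arith.mul_add, Arith.mul_comm c a, Arith.mul_comm c b]
  nsmul := nsmulRec

namespace Arith

theorem le_self_add (a b : M.U .num) : a ≤ a + b := by
  refine sig0_induction (fun b => a ≤ a + b) ?_ (fun z h => ?_) b
  · rw [IsBasic.b3]
  · rw [IsBasic.b4]; exact h.trans (lt_add_one_iff'.2 le_rfl).le

theorem exists_add_of_le {a b : M.U .num} (h : a ≤ b) : ∃ c, b = a + c := by
  suffices this : ∀ b : M.U .num, a ≤ b → ∃ c, c ≤ b ∧ b = a + c from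
    (this b h).imp fun _ => And.right
  refine sig0_induction (fun b => a ≤ b → ∃ c, c ≤ b ∧ b = a + c) ?_ (fun b ih h => ?_)
  · intro h; exact ⟨0, le_rfl, by rw [le_antisymm h (IsBasic.b8 a), IsBasic.b3]⟩
  · by_cases h' : a = b + 1
    · exact ⟨0, IsBasic.b8 _, by rw [h', IsBasic.b3]⟩
    · obtain ⟨c, hc, rfl⟩ := ih (lt_add_one_iff'.1 (lt_of_le_of_ne h h'))
      refine ⟨c + 1, ?_, by rw [IsBasic.b4]⟩
      rw [Arith.add_assoc, Arith.add_comm a]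
      exact Arith.le_self_add _ _

theorem add_left_cancel {a b c : M.U .num} : a + b = a + c → b = c := by
  rw [add_comm a, add_comm a]
  refine sig0_induction (fun a => b + a = c + a → b = c) ?_ (fun a ih h => ?_) a
  · rw [IsBasic.b3, IsBasic.b3]; exact id
  · rw [IsBasic.b4, IsBasic.b4] at h; exact ih (IsBasic.b2 _ _ h)

end Arith

instance : IsOrderedCancelAddMonoid (M.U .num) where
  add_le_add_left a b h c := by
    obtain ⟨d, rfl⟩ := Arith.exists_add_of_le h
    rw [add_right_comm]; exact Arith.le_self_add _ _
  le_of_add_le_add_left a b c h := by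
    obtain ⟨d, h⟩ := Arith.exists_add_of_le h
    rw [add_assoc] at h
    rw [Arith.add_left_cancel h]
    exact Arith.le_self_add _ _

instance : CanonicallyOrderedAdd (M.U .num) where
  exists_add_of_le := Arith.exists_add_of_le
  le_add_self a b := by rw [add_comm]; exact Arith.le_self_add _ _
  le_self_add := Arith.le_self_add

instance : Nontrivial (M.U .num) := ⟨0, 1, fun h => IsBasic.b1 (0 : M.U .num) (by
  rw [zero_add, ← h])⟩

theorem exists_eq_add_add_one {a b : M.U .num} (h : a < b) : ∃ d, b = a + d + 1 := by
  obtain ⟨c, rfl⟩ := Arith.exists_add_of_le h.le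
  obtain ⟨d, -, rfl⟩ := IsV0.b12 c (by rintro rfl; simp at h)
  exact ⟨d, (add_assoc _ _ _).symm⟩

theorem mul_lt_mul_of_pos_left' {a b c : M.U .num} (h : a < b) (hc : 0 < c) : c * a < c * b := by
  obtain ⟨d, rfl⟩ := exists_eq_add_add_one h
  rw [mul_add, mul_add, mul_one]
  exact lt_of_le_of_lt (Arith.le_self_add _ (c * d)) (lt_add_of_pos_right _ hc)

instance : IsStrictOrderedRing (M.U .num) where
  zero_le_one := IsBasic.b8 1
  mul_lt_mul_of_pos_left c hc a b h := mul_lt_mul_of_pos_left' h hc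
  mul_lt_mul_of_pos_right c hc a b h := by
    change a * c < b * c
    rw [mul_comm a, mul_comm b]; exact mul_lt_mul_of_pos_left' h hc

/-! ### The pairing function, strings and their rows -/

theorem pr_lt_pr {a b a' b' : M.U .num} (h : a + b < a' + b') : pr a b < pr a' b' := by
  obtain ⟨d, hd⟩ := exists_eq_add_add_one h
  have h1 : (a + b + 1) * (a + b + 1 + 1) ≤ (a' + b') * (a' + b' + 1) := by
    rw [← add_one_le_iff'] at h
    gcongr
  have h2 : pr a b + (1 + 1) * (a + 1) = (a + b + 1) * (a + b + 1 + 1) := by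
    simp only [pr]; ring
  have h3 : pr a b < pr a b + (1 + 1) * (a + 1) :=
    lt_add_of_pos_right _ (mul_pos (by positivity) (by positivity))
  exact (h3.trans_le (h2.le.trans h1)).trans_le le_self_add

theorem pr_inj {a b a' b' : M.U .num} : pr a b = pr a' b' ↔ a = a' ∧ b = b' := by
  refine ⟨fun h => ?_, fun h => by rw [h.1, h.2]⟩
  have hs : a + b = a' + b' := by
    rcases lt_trichotomy (a + b) (a' + b') with h' | h' | h'
    · exact absurd h (pr_lt_pr h').ne
    · exact h'
    · exact absurd h (pr_lt_pr h').ne'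
  have hb : b = b' := by
    simp only [pr, hs] at h
    exact mul_left_cancel₀ (by positivity) (add_left_cancel h)
  exact ⟨by rw [hb] at hs; exact add_right_cancel hs, hb⟩

theorem left_le_pr (a b : M.U .num) : a ≤ pr a b := by
  have : pr a b = a + (b + (a + b) * (a + b) + (1 + 1) * b) := by simp only [pr]; ring
  rw [this]; exact le_self_add

theorem right_le_pr (a b : M.U .num) : b ≤ pr a b := by
  have : pr a b = b + (a + (a + b) * (a + b) + (1 + 1) * b) := by simp only [pr]; ring
  rw [this]; exact le_self_add

theorem pr_le_pr {a b a' b' : M.U .num} (h : a ≤ a') (h' : b ≤ b') : pr a b ≤ pr a' b' := by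
  simp only [pr]; gcongr

theorem len_le_iff {A : M.U .str} {a : M.U .num} : len A ≤ a ↔ ∀ z, z ∈ A → z < a := by
  refine ⟨fun h z hz => (IsBasic.l1 z A hz).trans_le h, fun h => ?_⟩
  by_cases h0 : len A = 0
  · rw [h0]; exact IsBasic.b8 _
  obtain ⟨y, -, hy⟩ := IsV0.b12 _ h0
  rw [← hy, add_one_le_iff']
  exact h y (IsBasic.l2 y A hy)

theorem lt_len_of_mem {A : M.U .str} {a : M.U .num} (h : a ∈ A) : a < len A := IsBasic.l1 a A h

theorem str_ext {A B : M.U .str} (h : ∀ z, z ∈ A ↔ z ∈ B) : A = B :=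
  (IsV0.se A B).2 ⟨le_antisymm (len_le_iff.2 fun z hz => lt_len_of_mem ((h z).1 hz))
    (len_le_iff.2 fun z hz => lt_len_of_mem ((h z).2 hz)), fun z _ => h z⟩

theorem eq_len_iff {A : M.U .str} {a : M.U .num} :
    a = len A ↔ (∀ z, z ∈ A → z < a) ∧ ∀ z, z < a → z + 1 = a → z ∈ A := by
  constructor
  · rintro rfl
    exact ⟨fun z => lt_len_of_mem, fun z _ => IsBasic.l2 z A⟩
  · rintro ⟨h1, h2⟩
    refine le_antisymm ?_ (len_le_iff.2 h1)
    by_cases h0 : a = 0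
    · rw [h0]; exact IsBasic.b8 _
    obtain ⟨y, hy, rfl⟩ := IsV0.b12 _ h0
    exact add_one_le_iff'.2 (lt_len_of_mem (h2 y hy rfl))

/-- The length of an initial segment. -/
theorem len_eq_of_mem_iff_lt {A : M.U .str} {a : M.U .num} (h : ∀ z, z ∈ A ↔ z < a) :
    len A = a :=
  (eq_len_iff.2 ⟨fun z => (h z).1, fun z hz _ => (h z).2 hz⟩).symm

theorem exists_str (P : M.U .num → Prop) (a : M.U .num)
    [h : Sig0.Local M (fun v : Fin 1 → _ => P (v 0))] :
    ∃ A : M.U .str, ∀ z, z ∈ A ↔ z < a ∧ P z := by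
  obtain ⟨A, hA, hA'⟩ := exists_comp P a
  exact ⟨A, fun z => ⟨fun h => have hz := (lt_len_of_mem h).trans_le hA; ⟨hz, (hA' z hz).1 h⟩,
    fun h => (hA' z h.1).2 h.2⟩⟩

theorem exists_rowS (D : M.U .str) (u : M.U .num) : ∃ A : M.U .str, ∀ z, z ∈ A ↔ pr u z ∈ D := by
  obtain ⟨A, hA⟩ := exists_str (fun z => pr u z ∈ D) (len D)
  exact ⟨A, fun z => (hA z).trans
    ⟨And.right, fun h => ⟨(right_le_pr u z).trans_lt (lt_len_of_mem h), h⟩⟩⟩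

/-- The row `{z | ⟨u, z⟩ ∈ D}` of index `u` of the string `D`, read as an array of strings. -/
noncomputable def rowS (D : M.U .str) (u : M.U .num) : M.U .str := (exists_rowS D u).choose

@[simp] theorem mem_rowS {D : M.U .str} {u z : M.U .num} : z ∈ rowS D u ↔ pr u z ∈ D :=
  (exists_rowS D u).choose_spec z

/-- The number that is the length of the row of index `u` of `D`: in this way a string is read
as an array of numbers. -/
noncomputable def rowN (D : M.U .str) (u : M.U .num) : M.U .num := len (rowS D u)

theorem rowN_le (D : M.U .str) (u : M.U .num) : rowN D u ≤ len D :=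
  len_le_iff.2 fun z hz => (right_le_pr u z).trans_lt (lt_len_of_mem (mem_rowS.1 hz))

theorem eq_rowN_iff {D : M.U .str} {a u : M.U .num} :
    a = rowN D u ↔ (∀ z, z ≤ len D → pr u z ∈ D → z < a) ∧
      ∀ z, z < a → z + 1 = a → pr u z ∈ D := by
  rw [rowN, eq_len_iff]
  simp only [mem_rowS]
  refine and_congr_left fun _ => forall_congr' fun z => ⟨fun h _ => h, fun h h' => h ?_ h'⟩
  exact (right_le_pr u z).trans (lt_len_of_mem h').le

end Arithmetic

/-! ### Functions with a `Σ₀ᴮ` graph -/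

section SigF

variable {K : Type w} {S : K → Struct.{u} L2A} {Pa : Params S} {n : ℕ}

/-- The number functions that have a `Σ₀ᴮ` definable graph and are bounded by a term. Such
functions may be used like terms in `Σ₀ᴮ` definitions. -/
class SigF (Pa : Params S) {n : ℕ} (f : ∀ k, (Fin n → (S k).U .num) → (S k).U .num) : Prop where
  graph : Sig0 Pa (fun k (v : Fin (n + 1) → (S k).U .num) => v 0 = f k (fun i => v i.succ))
  bound : ∃ g : ∀ k, (Fin n → (S k).U .num) → (S k).U .num, Poly Pa g ∧ ∀ k x, f k x ≤ g k x

variable {f g : ∀ k, (Fin n → (S k).U .num) → (S k).U .num}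
  {R : ∀ k, (Fin n → (S k).U .num) → (S k).U .num → Prop}

theorem SigF.reindex (hf : SigF Pa f) {n' : ℕ} (ρ : Fin n → Fin n') :
    SigF Pa (fun k x => f k (fun i => x (ρ i))) := by
  obtain ⟨h, b, hb, hb'⟩ := hf
  refine ⟨?_, _, hb.reindex ρ, fun k x => hb' k _⟩
  exact (h.reindex (Fin.cons 0 (fun i => (ρ i).succ))).congr fun k x => by simp

theorem Sig0.subst (hf : SigF Pa f)
    (hR : Sig0 Pa (fun k (v : Fin (n + 1) → (S k).U .num) => R k (fun i => v i.succ) (v 0))) :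
    Sig0 Pa (fun k x => R k x (f k x)) := by
  obtain ⟨h, b, hb, hb'⟩ := hf
  refine (Sig0.ex (Q := fun k x y => y = f k x ∧ R k x y) hb (h.and hR)).congr fun k x => ?_
  exact ⟨fun h => ⟨_, hb' k x, rfl, h⟩, fun ⟨y, _, h, h'⟩ => h ▸ h'⟩

theorem Sig0.subst₂ (hf : SigF Pa f) (hg : SigF Pa g)
    {R : ∀ k, (S k).U .num → (S k).U .num → (Fin n → (S k).U .num) → Prop}
    (hR : Sig0 Pa (fun k (v : Fin (n + 1 + 1) → (S k).U .num) =>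
      R k (v 1) (v 0) (fun i => v i.succ.succ))) :
    Sig0 Pa (fun k x => R k (f k x) (g k x) x) :=
  Sig0.subst (R := fun k x y => R k y (g k x) x) hf
    (Sig0.subst (f := fun k (x : Fin (n + 1) → _) => g k (fun i => x i.succ))
      (R := fun k (x : Fin (n + 1) → _) y => R k (x 0) y (fun i => x i.succ))
      (hg.reindex Fin.succ) hR)

theorem SigF.comp₂ (hf : SigF Pa f) (hg : SigF Pa g)
    (F : ∀ k, (S k).U .num → (S k).U .num → (S k).U .num)
    (hF : SigF Pa (fun k (v : Fin 2 → (S k).U .num) => F k (v 0) (v 1)))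
    (hb : ∃ b : ∀ k, (Fin n → (S k).U .num) → (S k).U .num, Poly Pa b ∧
      ∀ k x, F k (f k x) (g k x) ≤ b k x) :
    SigF Pa (fun k x => F k (f k x) (g k x)) := by
  refine ⟨?_, hb⟩
  refine Sig0.subst₂ (R := fun k a b (v : Fin (n + 1) → (S k).U .num) => v 0 = F k a b)
    (hf.reindex Fin.succ) (hg.reindex Fin.succ) ?_
  exact (hF.graph.reindex ![2, 1, 0])

variable [∀ k, IsV0 (S k)]

instance (priority := high) [hf : Poly Pa f] : SigF Pa f :=
  ⟨.eq (.var 0) (hf.reindex Fin.succ), f, hf, fun _ _ => le_rfl⟩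

namespace Sig0

instance (priority := 900) [hf : SigF Pa f] [hg : SigF Pa g] :
    Sig0 Pa (fun k x => f k x = g k x) :=
  subst₂ (R := fun _ a b _ => a = b) hf hg (.eq (.var 1) (.var 0))
instance (priority := 900) [hf : SigF Pa f] [hg : SigF Pa g] :
    Sig0 Pa (fun k x => f k x ≤ g k x) :=
  subst₂ (R := fun _ a b _ => a ≤ b) hf hg (.le (.var 1) (.var 0))
instance (priority := 900) {s : ∀ k, (S k).U .str} [hf : SigF Pa f] [hs : Allowed s Pa.strs] :
    Sig0 Pa (fun k x => f k x ∈ s k) :=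
  subst (R := fun k _ a => a ∈ s k) hf (.mem (.var 0) hs.out)
instance (priority := 900) [hf : SigF Pa f]
    [hR : Sig0 Pa (fun k (v : Fin (n + 1) → (S k).U .num) => R k (fun i => v i.succ) (v 0))] :
    Sig0 Pa (fun k x => ∃ y, y < f k x ∧ R k x y) := by
  obtain ⟨b, hb, hb'⟩ := hf.bound
  have := hf.reindex Fin.succ
  refine (Sig0.ex (Q := fun k x y => y < f k x ∧ R k x y) hb (.and inferInstance hR)).congr
    fun k x => exists_congr fun y => ?_
  exact ⟨fun h => ⟨h.1.le.trans (hb' k x), h⟩, And.right⟩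
instance (priority := 900) [hf : SigF Pa f]
    [hR : Sig0 Pa (fun k (v : Fin (n + 1) → (S k).U .num) => R k (fun i => v i.succ) (v 0))] :
    Sig0 Pa (fun k x => ∀ y, y < f k x → R k x y) := by
  have := hR.not
  have : Sig0 Pa (fun k x => ¬ ∃ y, y < f k x ∧ ¬ R k x y) := inferInstance
  exact this.congr fun k x => by push Not; rfl

end Sig0

namespace SigF

instance [hf : SigF Pa f] [hg : SigF Pa g] : SigF Pa (fun k x => f k x + g k x) := by
  obtain ⟨b, hb, hb'⟩ := hf.bound
  obtain ⟨c, hc, hc'⟩ := hg.bound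
  exact comp₂ hf hg (fun _ a b => a + b) inferInstance
    ⟨_, .add hb hc, fun k x => add_le_add (hb' k x) (hc' k x)⟩

instance [hf : SigF Pa f] [hg : SigF Pa g] : SigF Pa (fun k x => f k x * g k x) := by
  obtain ⟨b, hb, hb'⟩ := hf.bound
  obtain ⟨c, hc, hc'⟩ := hg.bound
  exact comp₂ hf hg (fun _ a b => a * b) inferInstance
    ⟨_, .mul hb hc, fun k x => mul_le_mul' (hb' k x) (hc' k x)⟩

instance [hf : SigF Pa f] [hg : SigF Pa g] : SigF Pa (fun k x => pr (f k x) (g k x)) := by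
  unfold pr; infer_instance

instance {s : ∀ k, (S k).U .str} [hf : SigF Pa f] [hs : Allowed s Pa.strs] :
    SigF Pa (fun k x => rowN (s k) (f k x)) := by
  refine ⟨?_, _, .len s hs.out, fun k x => rowN_le _ _⟩
  have := hf.reindex Fin.succ
  simp only [eq_rowN_iff]
  refine Sig0.subst (f := fun k (v : Fin (n + 1) → _) => f k (fun i => v i.succ))
    (R := fun k v u => (∀ z, z ≤ len (s k) → pr u z ∈ s k → z < v 0) ∧
      ∀ z, z < v 0 → z + 1 = v 0 → pr u z ∈ s k) this inferInstance

end SigF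

instance {s : ∀ k, (S k).U .str} [hf : SigF Pa f] [hg : SigF Pa g] [hs : Allowed s Pa.strs] :
    Sig0 Pa (fun k x => f k x ∈ rowS (s k) (g k x)) := by
  simp only [mem_rowS]; infer_instance

end SigF

/-- The functions on a single structure that have a `Σ₀ᴮ` definable graph and are bounded by a
term, with arbitrary parameters. -/
abbrev SigF.Local (M : Struct.{u} L2A) [IsV0 M] {n : ℕ} (f : (Fin n → M.U .num) → M.U .num) :
    Prop :=
  SigF (Params.all (S := fun _ : Unit => M)) (fun _ => f)

section Arrays

variable {M : Struct.{u} L2A} [IsV0 M]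

theorem Poly.mono {K : Type w} {S : K → Struct.{u} L2A} [∀ k, IsV0 (S k)] {Pa : Params S} {n : ℕ}
    {f : ∀ k, (Fin n → (S k).U .num) → (S k).U .num} (h : Poly Pa f) {k : K}
    {x y : Fin n → (S k).U .num} (hxy : ∀ i, x i ≤ y i) : f k x ≤ f k y := by
  induction h with
  | var i => exact hxy i
  | const | zero | one | len => exact le_rfl
  | add _ _ h1 h2 => exact add_le_add h1 h2
  | mul _ _ h1 h2 => exact mul_le_mul' h1 h2

theorem exists_array (P : M.U .num → M.U .num → Prop) (b c : M.U .num)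
    [h : Sig0.Local M (fun v : Fin 2 → _ => P (v 0) (v 1))] :
    ∃ W : M.U .str, ∀ u, u < b → ∀ z, z ∈ rowS W u ↔ z < c ∧ P u z := by
  have : Sig0.Local M (fun v : Fin 1 → _ =>
      ∃ u, u ≤ v 0 ∧ ∃ z, z ≤ v 0 ∧ (v 0 = pr u z ∧ z < c) ∧ P u z) :=
    .ex (.var 0) (.ex (.var 1) (.and inferInstance (h.reindex ![1, 0])))
  obtain ⟨W, hW⟩ := exists_str
    (fun w => ∃ u, u ≤ w ∧ ∃ z, z ≤ w ∧ (w = pr u z ∧ z < c) ∧ P u z) (pr b c)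
  refine ⟨W, fun u hu z => ?_⟩
  rw [mem_rowS, hW]
  constructor
  · rintro ⟨-, u', -, z', -, ⟨h, hz⟩, hP⟩
    obtain ⟨rfl, rfl⟩ := pr_inj.1 h
    exact ⟨hz, hP⟩
  · rintro ⟨hz, hP⟩
    exact ⟨pr_lt_pr (add_lt_add hu hz), u, left_le_pr _ _, z, right_le_pr _ _, ⟨rfl, hz⟩, hP⟩

/-- A function with a `Σ₀ᴮ` graph is bounded on initial segments, since terms are monotone. -/
theorem SigF.Local.exists_bound {f : M.U .num → M.U .num}
    (h : SigF.Local M (fun v : Fin 1 → _ => f (v 0))) (b : M.U .num) :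
    ∃ c, ∀ u, u ≤ b → f u ≤ c := by
  obtain ⟨g, hg, hg'⟩ := h.bound
  exact ⟨g () fun _ => b, fun u hu => (hg' () fun _ => u).trans (hg.mono fun _ => hu)⟩

theorem exists_array_num (f : M.U .num → M.U .num) (b : M.U .num)
    [h : SigF.Local M (fun v : Fin 1 → _ => f (v 0))] :
    ∃ W : M.U .str, ∀ u, u < b → rowN W u = f u := by
  have : SigF.Local M (fun v : Fin 2 → _ => f (v 0)) := h.reindex ![0]
  obtain ⟨c, hc⟩ := h.exists_bound b
  obtain ⟨W, hW⟩ := exists_array (fun u z => z < f u) b c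
  refine ⟨W, fun u hu => len_eq_of_mem_iff_lt fun z => ?_⟩
  rw [hW u hu]
  exact ⟨And.right, fun h => ⟨h.trans_le (hc u hu.le), h⟩⟩

end Arrays

/-! ### Families of values coded by strings -/

section Coded

variable {M : Struct.{u} L2A} [IsV0 M]

/-- The entry of index `u` of an array of numbers or strings. -/
noncomputable def row : (s : Srt) → M.U .str → M.U .num → M.U s
  | .num => rowN
  | .str => rowS

variable {k l : ℕ} {s : Srt}

/-- The function `g` carries coded families of arguments to coded families of values: for all
arrays `D` and `E` of arguments there is an array of the values of `g` at all indices below a given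
bound. -/
def Coded (g : (Fin k → M.U .num) → (Fin l → M.U .str) → M.U s) : Prop :=
  ∀ (b : M.U .num) (D : Fin k → M.U .str) (E : Fin l → M.U .str), ∃ W : M.U .str,
    ∀ u, u < b → row s W u = g (fun i => rowN (D i) u) (fun j => rowS (E j) u)

/-- For all coded families of arguments, the set of the indices below a given bound at which the
arguments satisfy `P` is a string. -/
def CodedRel (P : (Fin k → M.U .num) → (Fin l → M.U .str) → Prop) : Prop :=
  ∀ (b : M.U .num) (D : Fin k → M.U .str) (E : Fin l → M.U .str), ∃ A : M.U .str,
    ∀ u, u < b → (u ∈ A ↔ P (fun i => rowN (D i) u) (fun j => rowS (E j) u))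

theorem Coded.comp {k' l' : ℕ} {g : (Fin k' → M.U .num) → (Fin l' → M.U .str) → M.U s}
    {f : Fin k' → (Fin k → M.U .num) → (Fin l → M.U .str) → M.U .num}
    {h : Fin l' → (Fin k → M.U .num) → (Fin l → M.U .str) → M.U .str}
    (hg : Coded g) (hf : ∀ i, Coded (f i)) (hh : ∀ j, Coded (h j)) :
    Coded (fun x X => g (fun i => f i x X) (fun j => h j x X)) := by
  intro b D E
  choose D' hD' using fun i => hf i b D E
  choose E' hE' using fun j => hh j b D E
  obtain ⟨W, hW⟩ := hg b D' E'
  refine ⟨W, fun u hu => (hW u hu).trans ?_⟩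
  congr 1
  · exact funext fun i => hD' i u hu
  · exact funext fun j => hE' j u hu

theorem rowS_eq_rowS_iff {A B : M.U .str} {u : M.U .num} :
    rowS A u = rowS B u ↔ ∀ z, z < len A + len B → (pr u z ∈ A ↔ pr u z ∈ B) := by
  constructor
  · intro h z _
    rw [← mem_rowS, h, mem_rowS]
  · refine fun h => str_ext fun z => ?_
    rw [mem_rowS, mem_rowS]
    have key : ∀ C : M.U .str, pr u z ∈ C → z < len C :=
      fun C hC => (right_le_pr u z).trans_lt (lt_len_of_mem hC)
    exact ⟨fun hz => (h z ((key _ hz).trans_le le_self_add)).1 hz,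
      fun hz => (h z ((key _ hz).trans_le le_add_self)).2 hz⟩

instance {K : Type w} {S : K → Struct.{u} L2A} [∀ k, IsV0 (S k)] {Pa : Params S} {n : ℕ}
    {f : ∀ k, (Fin n → (S k).U .num) → (S k).U .num} {A B : ∀ k, (S k).U .str} [hf : SigF Pa f]
    [hA : Allowed A Pa.strs] [hB : Allowed B Pa.strs] :
    Sig0 Pa (fun k x => rowS (A k) (f k x) = rowS (B k) (f k x)) := by
  simp only [rowS_eq_rowS_iff]
  exact Sig0.subst (R := fun k _ u => ∀ z, z < len (A k) + len (B k) →
    (pr u z ∈ A k ↔ pr u z ∈ B k)) hf inferInstance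

theorem CodedRel.eq {f g : (Fin k → M.U .num) → (Fin l → M.U .str) → M.U s} (hf : Coded f)
    (hg : Coded g) : CodedRel (fun x X => f x X = g x X) := by
  intro b D E
  obtain ⟨V, hV⟩ := hf b D E
  obtain ⟨W, hW⟩ := hg b D E
  have : ∃ A : M.U .str, ∀ u, u < b → (u ∈ A ↔ row s V u = row s W u) := by
    cases s with
    | num => exact (exists_comp (fun u => rowN V u = rowN W u) b).imp fun _ => And.right
    | str => exact (exists_comp (fun u => rowS V u = rowS W u) b).imp fun _ => And.right
  exact this.imp fun A hA u hu => by rw [hA u hu, hV u hu, hW u hu]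

theorem CodedRel.le {f g : (Fin k → M.U .num) → (Fin l → M.U .str) → M.U .num} (hf : Coded f)
    (hg : Coded g) : CodedRel (fun x X => f x X ≤ g x X) := by
  intro b D E
  obtain ⟨V, hV⟩ := hf b D E
  obtain ⟨W, hW⟩ := hg b D E
  obtain ⟨A, -, hA⟩ := exists_comp (fun u => rowN V u ≤ rowN W u) b
  exact ⟨A, fun u hu => by beta_reduce; rw [hA u hu, ← hV u hu, ← hW u hu]; rfl⟩

theorem CodedRel.mem {f : (Fin k → M.U .num) → (Fin l → M.U .str) → M.U .num}
    {g : (Fin k → M.U .num) → (Fin l → M.U .str) → M.U .str} (hf : Coded f)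
    (hg : Coded g) : CodedRel (fun x X => f x X ∈ g x X) := by
  intro b D E
  obtain ⟨V, hV⟩ := hf b D E
  obtain ⟨W, hW⟩ := hg b D E
  obtain ⟨A, -, hA⟩ := exists_comp (fun u => rowN V u ∈ rowS W u) b
  exact ⟨A, fun u hu => by beta_reduce; rw [hA u hu, ← hV u hu, ← hW u hu]; rfl⟩

theorem CodedRel.const (p : Prop) :
    CodedRel (M := M) (k := k) (l := l) (fun _ _ => p) := by
  intro b D E
  by_cases hp : p
  · obtain ⟨A, -, hA⟩ := exists_comp (fun u : M.U .num => u = u) b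
    exact ⟨A, fun u hu => by simp [hA u hu, hp]⟩
  · obtain ⟨A, -, hA⟩ := exists_comp (fun u : M.U .num => u ≠ u) b
    exact ⟨A, fun u hu => by simp [hA u hu, hp]⟩

theorem CodedRel.not {P : (Fin k → M.U .num) → (Fin l → M.U .str) → Prop} (hP : CodedRel P) :
    CodedRel (fun x X => ¬ P x X) := by
  intro b D E
  obtain ⟨A, hA⟩ := hP b D E
  obtain ⟨B, -, hB⟩ := exists_comp (fun u => ¬ u ∈ A) b
  exact ⟨B, fun u hu => by rw [hB u hu, hA u hu]⟩

theorem CodedRel.and {P Q : (Fin k → M.U .num) → (Fin l → M.U .str) → Prop} (hP : CodedRel P)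
    (hQ : CodedRel Q) : CodedRel (fun x X => P x X ∧ Q x X) := by
  intro b D E
  obtain ⟨A, hA⟩ := hP b D E
  obtain ⟨B, hB⟩ := hQ b D E
  obtain ⟨C, -, hC⟩ := exists_comp (fun u => u ∈ A ∧ u ∈ B) b
  exact ⟨C, fun u hu => by rw [hC u hu, hA u hu, hB u hu]⟩

theorem CodedRel.or {P Q : (Fin k → M.U .num) → (Fin l → M.U .str) → Prop} (hP : CodedRel P)
    (hQ : CodedRel Q) : CodedRel (fun x X => P x X ∨ Q x X) := by
  intro b D E
  obtain ⟨A, hA⟩ := hP b D E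
  obtain ⟨B, hB⟩ := hQ b D E
  obtain ⟨C, -, hC⟩ := exists_comp (fun u => u ∈ A ∨ u ∈ B) b
  exact ⟨C, fun u hu => by rw [hC u hu, hA u hu, hB u hu]⟩

/-! ### Arrays indexed by pairs -/

/-- `D'` is the array whose entry at `⟨u, z⟩ < b` is the entry of `D` at `u`. -/
def PullFst (b : M.U .num) (D D' : M.U .str) : Prop :=
  ∀ v, v < b → ∀ u, u ≤ v → ∀ z, z ≤ v → v = pr u z →
    ∀ y, y < len D + len D' → (pr v y ∈ D' ↔ pr u y ∈ D)

/-- `D'` is the array whose entry at `⟨u, z⟩ < b` is the number `z`. -/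
def PullSnd (b : M.U .num) (D' : M.U .str) : Prop :=
  ∀ v, v < b → ∀ u, u ≤ v → ∀ z, z ≤ v → v = pr u z → rowN D' v = z

theorem PullFst.rowS {b : M.U .num} {D D' : M.U .str} (h : PullFst b D D') {u z : M.U .num}
    (hb : pr u z < b) : rowS D' (pr u z) = rowS D u := by
  refine str_ext fun y => ?_
  have h' := h _ hb u (left_le_pr _ _) z (right_le_pr _ _) rfl y
  rw [mem_rowS, mem_rowS]
  have key : ∀ (a : M.U .num) (C : M.U .str), pr a y ∈ C → y < len C :=
    fun a C hC => (right_le_pr a y).trans_lt (lt_len_of_mem hC)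
  exact ⟨fun hy => (h' ((key _ _ hy).trans_le le_add_self)).1 hy,
    fun hy => (h' ((key _ _ hy).trans_le le_self_add)).2 hy⟩

theorem PullFst.rowN {b : M.U .num} {D D' : M.U .str} (h : PullFst b D D') {u z : M.U .num}
    (hb : pr u z < b) : rowN D' (pr u z) = rowN D u := by
  rw [TwoSorted.rowN, h.rowS hb]; rfl

theorem PullSnd.rowN {b : M.U .num} {D' : M.U .str} (h : PullSnd b D') {u z : M.U .num}
    (hb : pr u z < b) : rowN D' (pr u z) = z :=
  h _ hb u (left_le_pr _ _) z (right_le_pr _ _) rfl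

theorem exists_pullFst (b : M.U .num) (D : M.U .str) : ∃ D', PullFst b D D' := by
  obtain ⟨D', hD'⟩ := exists_array
    (fun v y => ∃ u, u ≤ v ∧ ∃ z, z ≤ v ∧ v = pr u z ∧ pr u y ∈ D) b (len D)
  refine ⟨D', fun v hv u hu z hz h y _ => ?_⟩
  rw [← mem_rowS, hD' v hv]
  constructor
  · rintro ⟨-, u', -, z', -, h', hy⟩
    rwa [(pr_inj.1 (h.symm.trans h')).1]
  · exact fun hy => ⟨(right_le_pr _ _).trans_lt (lt_len_of_mem hy), u, hu, z, hz, h, hy⟩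

theorem exists_pullSnd (b : M.U .num) : ∃ D', PullSnd b D' := by
  obtain ⟨D', hD'⟩ := exists_array
    (fun v y => ∃ u, u ≤ v ∧ ∃ z, z ≤ v ∧ v = pr u z ∧ y < z) b b
  refine ⟨D', fun v hv u hu z hz h => len_eq_of_mem_iff_lt fun y => ?_⟩
  rw [hD' v hv]
  constructor
  · rintro ⟨-, u', -, z', -, h', hy⟩
    rwa [(pr_inj.1 (h.symm.trans h')).2]
  · exact fun hy => ⟨hy.trans (hz.trans_lt hv), u, hu, z, hz, h, hy⟩

theorem fun_cons_eq {n : ℕ} {α β : Type*} {f : α → β} {a : α} {x : Fin n → α} {b : β}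
    {y : Fin n → β} (h : f a = b) (h' : ∀ i, f (x i) = y i) :
    (fun i => f ((Fin.cons a x : Fin (n + 1) → α) i)) = Fin.cons b y := by
  funext i
  refine Fin.cases ?_ (fun i => ?_) i <;> simp [h, h']

/-- If the indices are pairs, then one of the arguments may run through all numbers below a
bound. -/
theorem CodedRel.exists_pairs {P : (Fin (k + 1) → M.U .num) → (Fin l → M.U .str) → Prop}
    (hP : CodedRel P) (b c : M.U .num) (D : Fin k → M.U .str) (E : Fin l → M.U .str) :
    ∃ A : M.U .str, ∀ u, u < b → ∀ z, z < c →
      (pr u z ∈ A ↔ P (Fin.cons z fun i => rowN (D i) u) (fun j => rowS (E j) u)) := by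
  choose D' hD' using fun i => exists_pullFst (pr b c) (D i)
  choose E' hE' using fun j => exists_pullFst (pr b c) (E j)
  obtain ⟨Z, hZ⟩ := exists_pullSnd (pr b c)
  obtain ⟨A, hA⟩ := hP (pr b c) (Fin.cons Z D') E'
  refine ⟨A, fun u hu z hz => ?_⟩
  have hp : pr u z < pr b c := pr_lt_pr (add_lt_add hu hz)
  rw [hA _ hp, fun_cons_eq (f := fun D => rowN D (pr u z)) (hZ.rowN hp) fun i => (hD' i).rowN hp]
  simp only [(hE' _).rowS hp]

theorem L2A_num_induction {P : Term L2A .num k l → Prop} (nvar : ∀ i, P (.nvar i))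
    (zero : ∀ xs Xs, P (.app .zero xs Xs)) (one : ∀ xs Xs, P (.app .one xs Xs))
    (add : ∀ xs Xs, P (xs 0) → P (xs 1) → P (.app .add xs Xs))
    (mul : ∀ xs Xs, P (xs 0) → P (xs 1) → P (.app .mul xs Xs))
    (len : ∀ xs Xs j, Xs 0 = .svar j → P (.app .len xs Xs)) (t : Term L2A .num k l) : P t := by
  suffices H : ∀ {s : Srt} {k' l' : ℕ} (t' : Term L2A s k' l') (t : Term L2A .num k l),
      k' = k → l' = l → s = .num → t' ≍ t → P t from H t t rfl rfl rfl .rfl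
  clear t
  intro s k' l' t'
  induction t' with
  | nvar i => rintro t rfl rfl - h; exact eq_of_heq h ▸ nvar i
  | svar i => rintro t rfl rfl h; cases h
  | app f xs Xs ih1 ih2 =>
    rintro t rfl rfl rfl h
    obtain rfl := eq_of_heq h
    cases f with
    | zero => exact zero xs Xs
    | one => exact one xs Xs
    | add => exact add xs Xs (ih1 0 _ rfl rfl rfl .rfl) (ih1 1 _ rfl rfl rfl .rfl)
    | mul => exact mul xs Xs (ih1 0 _ rfl rfl rfl .rfl) (ih1 1 _ rfl rfl rfl .rfl)
    | len =>
      match h : Xs 0 with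
      | .svar j => exact len xs Xs j h

/-- The values of a term of `L²_A` at the entries of arrays. -/
instance sigF_term_val {K : Type w} {S : K → Struct.{u} L2A} [∀ k, IsV0 (S k)] {Pa : Params S}
    {n : ℕ} {D : Fin k → ∀ k, (S k).U .str} {E : Fin l → ∀ k, (S k).U .str}
    {f : ∀ k, (Fin n → (S k).U .num) → (S k).U .num} [hf : SigF Pa f]
    [hD : ∀ i, Allowed (D i) Pa.strs] [hE : ∀ j, Allowed (E j) Pa.strs] (t : Term L2A .num k l) :
    SigF Pa (fun k x =>
      t.val (S k) (fun i => rowN (D i k) (f k x)) (fun j => rowS (E j k) (f k x))) := by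
  induction t using L2A_num_induction with
  | nvar i => exact inferInstanceAs (SigF Pa (fun k x => rowN (D i k) (f k x)))
  | zero => simp only [Term.val_app_zero]; infer_instance
  | one => simp only [Term.val_app_one]; infer_instance
  | add => simp only [Term.val_app_add]; infer_instance
  | mul => simp only [Term.val_app_mul]; infer_instance
  | len xs Xs j h =>
    simp only [Term.val_app_len, h]
    exact inferInstanceAs (SigF Pa (fun k x => rowN (E j k) (f k x)))

/-! ### Closure of the coded functions -/

theorem coded_const_zero : Coded (M := M) (k := k) (l := l) (s := .num) (fun _ _ => 0) :=
  fun b _ _ => exists_array_num (fun _ => 0) b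

theorem coded_const_one : Coded (M := M) (k := k) (l := l) (s := .num) (fun _ _ => 1) :=
  fun b _ _ => exists_array_num (fun _ => 1) b

theorem coded_add : Coded (M := M) (k := 2) (l := l) (s := .num) (fun x _ => x 0 + x 1) :=
  fun b D _ => exists_array_num (fun u => rowN (D 0) u + rowN (D 1) u) b

theorem coded_mul : Coded (M := M) (k := 2) (l := l) (s := .num) (fun x _ => x 0 * x 1) :=
  fun b D _ => exists_array_num (fun u => rowN (D 0) u * rowN (D 1) u) b

theorem coded_len : Coded (M := M) (k := k) (l := 1) (s := .num) (fun _ X => len (X 0)) :=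
  fun _ _ E => ⟨E 0, fun _ _ => rfl⟩

/-- A number family is coded by its strict initial segments. -/
theorem coded_of_lt_iff {g : (Fin k → M.U .num) → (Fin l → M.U .str) → M.U .num}
    (h : ∀ (b : M.U .num) (D : Fin k → M.U .str) (E : Fin l → M.U .str), ∃ W : M.U .str,
      ∀ u, u < b → ∀ y, pr u y ∈ W ↔
      y < g (fun i => rowN (D i) u) (fun j => rowS (E j) u)) : Coded g := fun b D E =>
  (h b D E).imp fun _ hW u hu => len_eq_of_mem_iff_lt fun y => by rw [mem_rowS, hW u hu]

/-- `g` is the predecessor function. -/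
def IsPd (g : M.U .num → M.U .num) : Prop := g 0 = 0 ∧ ∀ a, a ≠ 0 → g a + 1 = a

theorem IsPd.lt_iff {g : M.U .num → M.U .num} (hg : IsPd g) (a y : M.U .num) :
    y < g a ↔ y + 1 < a := by
  by_cases h : a = 0
  · rw [h, hg.1]; exact ⟨fun h => absurd h (not_lt_of_ge (IsBasic.b8 y)),
      fun h => absurd h (not_lt_of_ge (IsBasic.b8 _))⟩
  · rw [← hg.2 a h, add_lt_add_iff_right, hg.2 a h]

theorem IsPd.coded {g : M.U .num → M.U .num} (hg : IsPd g) :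
    Coded (k := 1) (l := l) (s := .num) (fun x _ => g (x 0)) := by
  refine coded_of_lt_iff fun b D E => ?_
  obtain ⟨W, hW⟩ := exists_array (fun u y => y + 1 < rowN (D 0) u) b (len (D 0))
  refine ⟨W, fun u hu y => ?_⟩
  rw [← mem_rowS, hW u hu, hg.lt_iff]
  exact ⟨And.right, fun h => ⟨(le_self_add.trans_lt h).trans_le (rowN_le _ _), h⟩⟩

/-- `g(X, Y)` is the least index below `|X|` at which `X` and `Y` differ, and `|X|` if there is
none. -/
def IsFSE (g : M.U .str → M.U .str → M.U .num) : Prop :=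
  ∀ X Y, g X Y ≤ len X ∧ (g X Y < len X → ¬ (g X Y ∈ X ↔ g X Y ∈ Y)) ∧
    ∀ z, z < g X Y → (z ∈ X ↔ z ∈ Y)

theorem IsFSE.lt_iff {g : M.U .str → M.U .str → M.U .num} (hg : IsFSE g) (X Y : M.U .str)
    (y : M.U .num) : y < g X Y ↔ y < len X ∧ ∀ z, z ≤ y → (z ∈ X ↔ z ∈ Y) := by
  obtain ⟨h1, h2, h3⟩ := hg X Y
  refine ⟨fun h => ⟨h.trans_le h1, fun z hz => h3 z (hz.trans_lt h)⟩, fun ⟨h, h'⟩ => ?_⟩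
  by_contra hc
  rw [not_lt] at hc
  exact h2 (hc.trans_lt h) (h' _ hc)

theorem IsFSE.coded {g : M.U .str → M.U .str → M.U .num} (hg : IsFSE g) :
    Coded (k := k) (l := 2) (s := .num) (fun _ X => g (X 0) (X 1)) := by
  refine coded_of_lt_iff fun b D E => ?_
  obtain ⟨W, hW⟩ := exists_array (fun u y => y < rowN (E 0) u ∧
    ∀ z, z ≤ y → (z ∈ rowS (E 0) u ↔ z ∈ rowS (E 1) u)) b (len (E 0))
  refine ⟨W, fun u hu y => ?_⟩
  rw [← mem_rowS, hW u hu, hg.lt_iff]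
  exact ⟨And.right, fun h => ⟨h.1.trans_le (rowN_le _ _), h⟩⟩

/-- `g` is the function defined from the relation `P` and the term `t` by bounded
comprehension. -/
def IsStrFn (P : (Fin (k + 1) → M.U .num) → (Fin l → M.U .str) → Prop) (t : Term L2A .num k l)
    (g : (Fin k → M.U .num) → (Fin l → M.U .str) → M.U .str) : Prop :=
  ∀ x X z, z ∈ g x X ↔ z < t.val M x X ∧ P (Fin.cons z x) X

theorem IsStrFn.coded {P : (Fin (k + 1) → M.U .num) → (Fin l → M.U .str) → Prop}
    {t : Term L2A .num k l} {g : (Fin k → M.U .num) → (Fin l → M.U .str) → M.U .str}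
    (hg : IsStrFn P t g) (hP : CodedRel P) : Coded (s := .str) g := by
  intro b D E
  have ht : SigF.Local M (fun v : Fin 1 → _ =>
    t.val M (fun i => rowN (D i) (v 0)) (fun j => rowS (E j) (v 0))) :=
    sigF_term_val (D := fun i _ => D i) (E := fun j _ => E j) t
  have ht' : SigF.Local M (fun v : Fin 2 → _ =>
    t.val M (fun i => rowN (D i) (v 0)) (fun j => rowS (E j) (v 0))) := ht.reindex ![0]
  obtain ⟨c, hc⟩ := ht.exists_bound (f := fun u =>
    t.val M (fun i => rowN (D i) u) (fun j => rowS (E j) u)) b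
  obtain ⟨A, hA⟩ := hP.exists_pairs b c D E
  obtain ⟨W, hW⟩ := exists_array (fun u z =>
    z < t.val M (fun i => rowN (D i) u) (fun j => rowS (E j) u) ∧ pr u z ∈ A) b c
  refine ⟨W, fun u hu => str_ext fun z => ?_⟩
  refine (hW u hu z).trans ?_
  rw [hg]
  constructor
  · rintro ⟨h1, h2, h3⟩
    exact ⟨h2, (hA u hu z h1).1 h3⟩
  · rintro ⟨h1, h2⟩
    have h3 := h1.trans_le (hc u hu.le)
    exact ⟨h3, h1, (hA u hu z h3).2 h2⟩

/-- `g` is the function defined from the relation `P` and the term `t` by bounded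
minimization. -/
def IsNumFn (P : (Fin (k + 1) → M.U .num) → (Fin l → M.U .str) → Prop) (t : Term L2A .num k l)
    (g : (Fin k → M.U .num) → (Fin l → M.U .str) → M.U .num) : Prop :=
  ∀ x X, g x X ≤ t.val M x X ∧ (g x X < t.val M x X → P (Fin.cons (g x X) x) X) ∧
    ∀ z, z < g x X → ¬ P (Fin.cons z x) X

theorem IsNumFn.lt_iff {P : (Fin (k + 1) → M.U .num) → (Fin l → M.U .str) → Prop}
    {t : Term L2A .num k l} {g : (Fin k → M.U .num) → (Fin l → M.U .str) → M.U .num}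
    (hg : IsNumFn P t g) (x : Fin k → M.U .num) (X : Fin l → M.U .str) (y : M.U .num) :
    y < g x X ↔ y < t.val M x X ∧ ∀ z, z ≤ y → ¬ P (Fin.cons z x) X := by
  obtain ⟨h1, h2, h3⟩ := hg x X
  refine ⟨fun h => ⟨h.trans_le h1, fun z hz => h3 z (hz.trans_lt h)⟩, fun ⟨h, h'⟩ => ?_⟩
  by_contra hc
  rw [not_lt] at hc
  exact h' _ hc (h2 (hc.trans_lt h))

theorem IsNumFn.coded {P : (Fin (k + 1) → M.U .num) → (Fin l → M.U .str) → Prop}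
    {t : Term L2A .num k l} {g : (Fin k → M.U .num) → (Fin l → M.U .str) → M.U .num}
    (hg : IsNumFn P t g) (hP : CodedRel P) : Coded (s := .num) g := by
  refine coded_of_lt_iff fun b D E => ?_
  have ht : SigF.Local M (fun v : Fin 1 → _ =>
    t.val M (fun i => rowN (D i) (v 0)) (fun j => rowS (E j) (v 0))) :=
    sigF_term_val (D := fun i _ => D i) (E := fun j _ => E j) t
  have ht' : SigF.Local M (fun v : Fin 2 → _ =>
    t.val M (fun i => rowN (D i) (v 0)) (fun j => rowS (E j) (v 0))) := ht.reindex ![0]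
  obtain ⟨c, hc⟩ := ht.exists_bound (f := fun u =>
    t.val M (fun i => rowN (D i) u) (fun j => rowS (E j) u)) b
  obtain ⟨A, hA⟩ := hP.exists_pairs b c D E
  obtain ⟨W, hW⟩ := exists_array (fun u y =>
    y < t.val M (fun i => rowN (D i) u) (fun j => rowS (E j) u) ∧
      ∀ z, z ≤ y → ¬ pr u z ∈ A) b c
  refine ⟨W, fun u hu y => ?_⟩
  rw [← mem_rowS, hW u hu, hg.lt_iff]
  constructor
  · rintro ⟨h1, h2, h3⟩
    exact ⟨h2, fun z hz => (hA u hu z (hz.trans_lt h1)).not.1 (h3 z hz)⟩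
  · rintro ⟨h1, h2⟩
    have h3 := h1.trans_le (hc u hu.le)
    exact ⟨h3, h1, fun z hz => (hA u hu z (hz.trans_lt h3)).not.2 (h2 z hz)⟩

end Coded

/-! ### Counting -/

section Counting

variable {M : Struct.{u} L2A} [IsV0 M]

/-- `Y` is the sequence of the numbers of elements of `X` below `0, 1, …, c`. For `c = |X|` this
is the condition in the axiom NUMONES. -/
def CountSeq (c : M.U .num) (X Y : M.U .str) : Prop :=
  ((∀ z, z ≤ c → ∃ y, y ≤ c ∧ pr z y ∈ Y ∧ ∀ y', y' ≤ c → pr z y' ∈ Y → y' = y) ∧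
    pr 0 0 ∈ Y) ∧
  ∀ z, z < c → ∀ y, y ≤ c → pr z y ∈ Y →
    (z ∈ X → pr (z + 1) (y + 1) ∈ Y) ∧ (¬ z ∈ X → pr (z + 1) y ∈ Y)

theorem CountSeq.unique {c : M.U .num} {X Y : M.U .str} (h : CountSeq c X Y) {z y y' : M.U .num}
    (hz : z ≤ c) (hy : y ≤ c) (hy' : y' ≤ c) (h1 : pr z y ∈ Y) (h2 : pr z y' ∈ Y) : y = y' := by
  obtain ⟨w, -, -, hw⟩ := h.1.1 z hz
  rw [hw y hy h1, hw y' hy' h2]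

theorem CountSeq.exists_le {c : M.U .num} {X Y : M.U .str} (h : CountSeq c X Y) :
    ∀ z, z ≤ c → ∃ y, y ≤ z ∧ pr z y ∈ Y := by
  refine sig0_induction (fun z => z ≤ c → ∃ y, y ≤ z ∧ pr z y ∈ Y)
    (fun _ => ⟨0, le_rfl, h.1.2⟩) (fun z ih hz => ?_)
  have hz' : z < c := add_one_le_iff'.1 hz
  obtain ⟨y, hy, hyY⟩ := ih hz'.le
  obtain ⟨h1, h2⟩ := h.2 z hz' y (hy.trans hz'.le) hyY
  by_cases hX : z ∈ X
  · exact ⟨y + 1, by gcongr, h1 hX⟩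
  · exact ⟨y, hy.trans le_self_add, h2 hX⟩

/-- `g(z, X)` is the number of elements of `X` below `z`, and its graph is coded on initial
segments. -/
structure IsNumones (g : M.U .num → M.U .str → M.U .num) : Prop where
  zero : ∀ X, g 0 X = 0
  succ_of_mem : ∀ z X, z ∈ X → g (z + 1) X = g z X + 1
  succ_of_notMem : ∀ z X, ¬ z ∈ X → g (z + 1) X = g z X
  graph : ∀ (X : M.U .str) (b : M.U .num), ∃ Y : M.U .str,
    ∀ z, z < b → ∀ y, pr z y ∈ Y ↔ y = g z X

namespace IsNumones

variable {g : M.U .num → M.U .str → M.U .num}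

theorem le (hg : IsNumones g) (X : M.U .str) (z : M.U .num) : g z X ≤ z := by
  obtain ⟨Y, hY⟩ := hg.graph X (z + 1)
  have key : ∀ a : M.U .num, a < z + 1 → ∃ y, y ≤ a ∧ pr a y ∈ Y := by
    refine sig0_induction (fun a => a < z + 1 → ∃ y, y ≤ a ∧ pr a y ∈ Y)
      (fun h => ⟨0, le_rfl, (hY _ h _).2 (hg.zero X).symm⟩) (fun a ih ha => ?_)
    have ha' : a < z + 1 := lt_of_le_of_lt le_self_add ha
    obtain ⟨y, hy, hyY⟩ := ih ha'
    have e := (hY a ha' y).1 hyY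
    by_cases hX : a ∈ X
    · exact ⟨y + 1, by gcongr, (hY _ ha _).2 (by rw [hg.succ_of_mem a X hX, e])⟩
    · exact ⟨y, hy.trans le_self_add, (hY _ ha _).2 (by rw [hg.succ_of_notMem a X hX, e])⟩
  have hz : z < z + 1 := lt_add_one_iff'.2 le_rfl
  obtain ⟨y, hy, hyY⟩ := key z hz
  rwa [← (hY z hz y).1 hyY]

theorem exists_countSeq (hg : IsNumones g) (c : M.U .num) (X : M.U .str) :
    ∃ Y, CountSeq c X Y := by
  obtain ⟨Y, hY⟩ := hg.graph X (c + 1)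
  have hlt : ∀ z, z ≤ c → z < c + 1 := fun z hz => lt_add_one_iff'.2 hz
  refine ⟨Y, ⟨fun z hz => ⟨g z X, (hg.le X z).trans hz, (hY z (hlt z hz) _).2 rfl,
    fun y' _ h => (hY z (hlt z hz) _).1 h⟩, ?_⟩, fun z hz y _ h => ⟨fun hX => ?_, fun hX => ?_⟩⟩
  · exact (hY 0 (hlt 0 (IsBasic.b8 c)) _).2 (hg.zero X).symm
  · rw [hY _ (hlt _ (add_one_le_iff'.2 hz)), hg.succ_of_mem z X hX, (hY z (hlt z hz.le) y).1 h]
  · rw [hY _ (hlt _ (add_one_le_iff'.2 hz)), hg.succ_of_notMem z X hX, (hY z (hlt z hz.le) y).1 h]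

theorem mem_countSeq_iff (hg : IsNumones g) {c : M.U .num} {X Y : M.U .str} (h : CountSeq c X Y)
    {z y : M.U .num} (hz : z ≤ c) (hy : y ≤ c) : pr z y ∈ Y ↔ y = g z X := by
  obtain ⟨Y', hY'⟩ := hg.graph X (c + 1)
  have hlt : ∀ z, z ≤ c → z < c + 1 := fun z hz => lt_add_one_iff'.2 hz
  have key : ∀ z, z ≤ c → ∀ y, y ≤ c → pr z y ∈ Y' → pr z y ∈ Y := by
    refine sig0_induction (fun z => z ≤ c → ∀ y, y ≤ c → pr z y ∈ Y' → pr z y ∈ Y)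
      (fun hz y hy h0 => ?_) (fun z ih hz y hy h1 => ?_)
    · rw [(hY' 0 (hlt 0 hz) y).1 h0, hg.zero]; exact h.1.2
    · have hz' : z < c := add_one_le_iff'.1 hz
      rw [(hY' _ (hlt _ hz) y).1 h1]
      have hgz : g z X ≤ c := (hg.le X z).trans hz'.le
      have := h.2 z hz' _ hgz (ih hz'.le _ hgz ((hY' z (hlt z hz'.le) _).2 rfl))
      by_cases hX : z ∈ X
      · rw [hg.succ_of_mem z X hX]; exact this.1 hX
      · rw [hg.succ_of_notMem z X hX]; exact this.2 hX
  have hgz : g z X ≤ c := (hg.le X z).trans hz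
  have hmem : pr z (g z X) ∈ Y := key z hz _ hgz ((hY' z (hlt z hz) _).2 rfl)
  exact ⟨fun h' => h.unique hz hy hgz h' hmem, fun e => e ▸ hmem⟩

end IsNumones

/-- `Z` is the concatenation of the initial segments of length `m` of the rows of `E` of index
below `b`. -/
def IsConcat (b m : M.U .num) (E Z : M.U .str) : Prop :=
  ∀ u, u < b → ∀ z, z < m → (u * m + z ∈ Z ↔ pr u z ∈ E)

theorem mul_add_inj {m u u' z z' : M.U .num} (hz : z < m) (hz' : z' < m)
    (h : u * m + z = u' * m + z') : u = u' ∧ z = z' := by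
  have key : ∀ {u u' z z' : M.U .num}, z < m → u < u' → u * m + z < u' * m + z' := by
    intro u u' z z' hz hu
    calc u * m + z < u * m + m := by gcongr
      _ = (u + 1) * m := by ring
      _ ≤ u' * m := by gcongr; exact add_one_le_iff'.2 hu
      _ ≤ u' * m + z' := le_self_add
  rcases lt_trichotomy u u' with hu | rfl | hu
  · exact absurd h (key hz hu).ne
  · exact ⟨rfl, add_left_cancel h⟩
  · exact absurd h (key hz' hu).ne'

theorem mul_add_lt {b m u z : M.U .num} (hu : u < b) (hz : z < m) : u * m + z < b * m :=
  calc u * m + z < u * m + m := by gcongr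
    _ = (u + 1) * m := by ring
    _ ≤ b * m := by gcongr; exact add_one_le_iff'.2 hu

theorem exists_isConcat (b m : M.U .num) (E : M.U .str) : ∃ Z, IsConcat b m E Z := by
  obtain ⟨Z, hZ⟩ := exists_str
    (fun v => ∃ u, u < b ∧ ∃ z, z < m ∧ v = u * m + z ∧ pr u z ∈ E) (b * m)
  refine ⟨Z, fun u hu z hz => ?_⟩
  rw [hZ]
  constructor
  · rintro ⟨-, u', -, z', hz', h, hE⟩
    obtain ⟨rfl, rfl⟩ := mul_add_inj hz hz' h
    exact hE
  · exact fun hE => ⟨mul_add_lt hu hz, u, hu, z, hz, rfl, hE⟩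

/-- The elements of a row below `z` are counted by a difference of two counts in the
concatenation of all rows. -/
theorem IsNumones.add_eq {g : M.U .num → M.U .str → M.U .num} (hg : IsNumones g)
    {b m u z : M.U .num} {E Z : M.U .str} (hZ : IsConcat b m E Z) (hu : u < b) (hz : z ≤ m) :
    g z (rowS E u) + g (u * m) Z = g (u * m + z) Z := by
  obtain ⟨Y, hY⟩ := hg.graph (rowS E u) (m + 1)
  obtain ⟨Y', hY'⟩ := hg.graph Z (b * m + 1)
  have hlt : ∀ z, z ≤ m → u * m + z < b * m + 1 := fun z hz => lt_add_one_iff'.2 <|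
    calc u * m + z ≤ u * m + m := by gcongr
      _ = (u + 1) * m := by ring
      _ ≤ b * m := by gcongr; exact add_one_le_iff'.2 hu
  have key : ∀ z, z ≤ m → ∃ y, y ≤ z ∧ pr z y ∈ Y ∧ pr (u * m + z) (y + g (u * m) Z) ∈ Y' := by
    refine sig0_induction (fun z => z ≤ m → ∃ y, y ≤ z ∧ pr z y ∈ Y ∧
      pr (u * m + z) (y + g (u * m) Z) ∈ Y') (fun h => ⟨0, le_rfl, ?_, ?_⟩) (fun z ih hz => ?_)
    · exact (hY 0 (lt_add_one_iff'.2 h) _).2 (hg.zero _).symm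
    · exact (hY' _ (hlt 0 h) _).2 (by rw [zero_add, add_zero])
    · have hz' : z < m := add_one_le_iff'.1 hz
      obtain ⟨y, hy, h1, h2⟩ := ih hz'.le
      have e1 := (hY z (lt_add_one_iff'.2 hz'.le) _).1 h1
      have e2 := (hY' _ (hlt z hz'.le) _).1 h2
      have hiff := hZ u hu z hz'
      rw [← mem_rowS] at hiff
      have hYz := hY (z + 1) (lt_add_one_iff'.2 hz)
      have hYz' := hY' (u * m + (z + 1)) (hlt _ hz)
      rw [← add_assoc] at hYz' ⊢
      by_cases hX : z ∈ rowS E u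
      · refine ⟨y + 1, by gcongr, (hYz _).2 ?_, (hYz' _).2 ?_⟩
        · rw [hg.succ_of_mem _ _ hX, e1]
        · rw [hg.succ_of_mem _ _ (hiff.2 hX), ← e2]; ring
      · refine ⟨y, hy.trans le_self_add, (hYz _).2 ?_, (hYz' _).2 ?_⟩
        · rw [hg.succ_of_notMem _ _ hX, e1]
        · rw [hg.succ_of_notMem _ _ (hiff.not.2 hX), ← e2]
  obtain ⟨y, -, h1, h2⟩ := key z hz
  rw [← (hY z (lt_add_one_iff'.2 hz) _).1 h1, (hY' _ (hlt z hz) _).1 h2]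

theorem IsNumones.coded {g : M.U .num → M.U .str → M.U .num} (hg : IsNumones g) :
    Coded (k := 1) (l := 1) (s := .num) (fun x X => g (x 0) (X 0)) := by
  refine coded_of_lt_iff fun b D E => ?_
  obtain ⟨Z, hZ⟩ := exists_isConcat b (len (D 0) + 1) (E 0)
  obtain ⟨Y, hY⟩ := hg.graph Z (b * (len (D 0) + 1) + 1)
  obtain ⟨W, hW⟩ := exists_array (fun u y => ∃ p, p ≤ b * (len (D 0) + 1) ∧
    ∃ q, q ≤ b * (len (D 0) + 1) ∧ pr (u * (len (D 0) + 1)) p ∈ Y ∧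
      pr (u * (len (D 0) + 1) + rowN (D 0) u) q ∈ Y ∧ y + p < q) b (b * (len (D 0) + 1))
  refine ⟨W, fun u hu y => ?_⟩
  have hz : rowN (D 0) u < len (D 0) + 1 := lt_add_one_iff'.2 (rowN_le _ _)
  have h2 := mul_add_lt hu hz
  have h1 := (lt_of_le_of_lt le_self_add h2 : u * (len (D 0) + 1) < b * (len (D 0) + 1))
  have e := hg.add_eq hZ hu hz.le
  have hlt : ∀ a : M.U .num, a < b * (len (D 0) + 1) → a < b * (len (D 0) + 1) + 1 :=
    fun a ha => lt_add_one_iff'.2 ha.le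
  rw [← mem_rowS, hW u hu]
  have key : y < g (rowN (D 0) u) (rowS (E 0) u) ↔ y + g (u * (len (D 0) + 1)) Z <
      g (u * (len (D 0) + 1) + rowN (D 0) u) Z := by rw [← e, add_lt_add_iff_right]
  rw [key]
  constructor
  · rintro ⟨-, p, -, q, -, hp, hq, h⟩
    rwa [(hY _ (hlt _ h1) _).1 hp, (hY _ (hlt _ h2) _).1 hq] at h
  · intro h
    refine ⟨?_, _, (hg.le Z _).trans h1.le, _, (hg.le Z _).trans h2.le,
      (hY _ (hlt _ h1) _).2 rfl, (hY _ (hlt _ h2) _).2 rfl, h⟩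
    exact (lt_of_le_of_lt le_self_add h).trans_le ((hg.le Z _).trans h2.le)

/-- If every string has a counting sequence, then there is a counting function. -/
theorem exists_isNumones (h : ∀ X : M.U .str, ∃ Y, CountSeq (len X) X Y) :
    ∃ g : M.U .num → M.U .str → M.U .num, IsNumones g := by
  choose Y hY using h
  have hex : ∀ z X, ∃ y, y ≤ min z (len X) ∧ pr (min z (len X)) y ∈ Y X :=
    fun z X => (hY X).exists_le _ (min_le_right _ _)
  choose g hg hgY using hex
  have hle : ∀ z X, g z X ≤ len X := fun z X => (hg z X).trans (min_le_right _ _)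
  have huniq : ∀ z X y, y ≤ len X → pr (min z (len X)) y ∈ Y X → g z X = y :=
    fun z X y hy h => (hY X).unique (min_le_right _ _) (hle z X) hy (hgY z X) h
  refine ⟨g, ⟨fun X => huniq _ _ _ (IsBasic.b8 _) ?_, fun z X hz => huniq _ _ _ ?_ ?_,
    fun z X hz => ?_, fun X b => ?_⟩⟩
  · rw [min_eq_left (IsBasic.b8 _)]; exact (hY X).1.2
  · have hz' := lt_len_of_mem hz
    have := hg z X
    rw [min_eq_left hz'.le] at this
    exact (add_le_add_left this 1).trans (add_one_le_iff'.2 hz')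
  · have hz' := lt_len_of_mem hz
    have := hgY z X
    rw [min_eq_left hz'.le] at this
    rw [min_eq_left (add_one_le_iff'.2 hz')]
    exact ((hY X).2 z hz' _ (hle z X) this).1 hz
  · refine huniq _ _ _ (hle _ _) ?_
    rcases lt_or_ge z (len X) with hz' | hz'
    · have := hgY z X
      rw [min_eq_left hz'.le] at this
      rw [min_eq_left (add_one_le_iff'.2 hz')]
      exact ((hY X).2 z hz' _ (hle z X) this).2 hz
    · have := hgY z X
      rw [min_eq_right hz'] at this
      rwa [min_eq_right (hz'.trans le_self_add)]
  · obtain ⟨W, hW⟩ := exists_array (fun z y => (z ≤ len X ∧ pr z y ∈ Y X) ∨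
      (len X < z ∧ pr (len X) y ∈ Y X)) b (len X + 1)
    refine ⟨W, fun z hz y => ?_⟩
    rw [← mem_rowS, hW z hz, lt_add_one_iff']
    have key : ((z ≤ len X ∧ pr z y ∈ Y X) ∨ (len X < z ∧ pr (len X) y ∈ Y X)) ↔
        pr (min z (len X)) y ∈ Y X := by
      rcases le_or_gt z (len X) with hz' | hz'
      · simp [hz', hz'.not_gt]
      · simp [min_eq_right hz'.le, hz', hz'.not_ge]
    rw [key]
    exact ⟨fun h => (huniq _ _ _ h.1 h.2).symm, fun h => h ▸ ⟨hle _ _, hgY _ _⟩⟩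

end Counting

/-! ### Interpretations of the vocabulary of `FTC⁰` -/

section All

variable {V : Vocabulary} (P : ∀ {s : Srt} {k l : ℕ}, V s k l → Prop)

/-- All function symbols in a term satisfy `P`. -/
def Term.All : {s : Srt} → {n m : ℕ} → Term V s n m → Prop
  | _, _, _, .nvar _ => True
  | _, _, _, .svar _ => True
  | _, _, _, .app f xs Xs => P f ∧ (∀ i, (xs i).All) ∧ ∀ i, (Xs i).All

/-- All function symbols in a formula satisfy `P`. -/
def Formula.All : {q : Bool} → {n m : ℕ} → Formula V q n m → Prop
  | _, _, _, .tru => True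
  | _, _, _, .fls => True
  | _, _, _, .eq t u => t.All P ∧ u.All P
  | _, _, _, .le t u => t.All P ∧ u.All P
  | _, _, _, .mem t T => t.All P ∧ T.All P
  | _, _, _, .not φ => φ.All
  | _, _, _, .and φ ψ => φ.All ∧ ψ.All
  | _, _, _, .or φ ψ => φ.All ∧ ψ.All
  | _, _, _, .exN φ => φ.All
  | _, _, _, .allN φ => φ.All
  | _, _, _, .exS φ => φ.All
  | _, _, _, .allS φ => φ.All

variable {P} {Q : ∀ {s : Srt} {k l : ℕ}, V s k l → Prop}

theorem Term.All.imp (h : ∀ {s : Srt} {k l : ℕ} {f : V s k l}, P f → Q f) {s : Srt} {n m : ℕ}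
    {t : Term V s n m} (ht : t.All P) : t.All Q := by
  induction t with
  | nvar | svar => trivial
  | app f xs Xs ih1 ih2 => exact ⟨h ht.1, fun i => ih1 i (ht.2.1 i), fun i => ih2 i (ht.2.2 i)⟩

theorem Formula.All.imp (h : ∀ {s : Srt} {k l : ℕ} {f : V s k l}, P f → Q f) {q : Bool}
    {n m : ℕ} {φ : Formula V q n m} (hφ : φ.All P) : φ.All Q := by
  induction φ with
  | tru | fls => trivial
  | eq | le | mem => exact ⟨hφ.1.imp h, hφ.2.imp h⟩
  | not _ ih | exN _ ih | allN _ ih | exS _ ih | allS _ ih => exact ih hφ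
  | and _ _ ih1 ih2 | or _ _ ih1 ih2 => exact ⟨ih1 hφ.1, ih2 hφ.2⟩

end All

section Induction

variable {P : ∀ {s : Srt} {k l : ℕ}, LFTC0 s k l → Prop}
  (base : ∀ {s : Srt} {k l : ℕ} (f : L2A s k l), P (.base f)) (pd : P .pd) (fSE : P .fSE)
  (numones : P .numones)
  (strFn : ∀ {n m : ℕ} (α : OpenFormula LFTC0 (n + 1) m) (t : Term L2A .num n m),
    α.All P → P (.strFn α t))
  (numFn : ∀ {n m : ℕ} (α : OpenFormula LFTC0 (n + 1) m) (t : Term L2A .num n m),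
    α.All P → P (.numFn α t))

include base pd fSE numones strFn numFn

mutual

/-- Induction on the construction of the function symbols: the defining axiom of a symbol
`F_{α,t}` or `f_{α,t}` refers to the symbols in `α`, which come earlier. -/
theorem LFTC0.induction : {s : Srt} → {k l : ℕ} → (f : LFTC0 s k l) → P f
  | _, _, _, .base f => base f
  | _, _, _, .pd => pd
  | _, _, _, .fSE => fSE
  | _, _, _, .numones => numones
  | _, _, _, .strFn α t => strFn α t (Formula.all_of_induction α)
  | _, _, _, .numFn α t => numFn α t (Formula.all_of_induction α)

theorem Term.all_of_induction : {s : Srt} → {n m : ℕ} → (t : Term LFTC0 s n m) → t.All P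
  | _, _, _, .nvar _ => trivial
  | _, _, _, .svar _ => trivial
  | _, _, _, .app f xs Xs => ⟨LFTC0.induction f, fun i => Term.all_of_induction (xs i),
      fun i => Term.all_of_induction (Xs i)⟩

theorem Formula.all_of_induction :
    {q : Bool} → {n m : ℕ} → (φ : Formula LFTC0 q n m) → φ.All P
  | _, _, _, .tru => trivial
  | _, _, _, .fls => trivial
  | _, _, _, .eq t u => ⟨Term.all_of_induction t, Term.all_of_induction u⟩
  | _, _, _, .le t u => ⟨Term.all_of_induction t, Term.all_of_induction u⟩
  | _, _, _, .mem t T => ⟨Term.all_of_induction t, Term.all_of_induction T⟩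
  | _, _, _, .not φ => Formula.all_of_induction φ
  | _, _, _, .and φ ψ => ⟨Formula.all_of_induction φ, Formula.all_of_induction ψ⟩
  | _, _, _, .or φ ψ => ⟨Formula.all_of_induction φ, Formula.all_of_induction ψ⟩
  | _, _, _, .exN φ => Formula.all_of_induction φ
  | _, _, _, .allN φ => Formula.all_of_induction φ
  | _, _, _, .exS φ => Formula.all_of_induction φ
  | _, _, _, .allS φ => Formula.all_of_induction φ

end

end Induction

/-- Interpretations of the function symbols of `L_FTC⁰` in the domains of an `L²_A`-structure. -/
abbrev Interp (M : Struct.{u} L2A) : Type u :=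
  ∀ {s : Srt} {k l : ℕ}, LFTC0 s k l → (Fin k → M.U .num) → (Fin l → M.U .str) → M.U s

/-- The structure for `L_FTC⁰` given by an interpretation of the function symbols. -/
def expand (M : Struct.{u} L2A) (I : Interp M) : Struct.{u} LFTC0 where
  U := M.U
  nonempty := M.nonempty
  fn := I
  le := M.le
  mem := M.mem

section Interp

variable {M : Struct.{u} L2A}

/-- The value of a term of `L_FTC⁰` under an interpretation of the function symbols. -/
def tval (I : Interp M) {s : Srt} {n m : ℕ} (t : Term LFTC0 s n m) (x : Fin n → M.U .num)
    (X : Fin m → M.U .str) : M.U s := t.val (expand M I) x X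

/-- The truth of a formula of `L_FTC⁰` under an interpretation of the function symbols. -/
def holds (I : Interp M) {q : Bool} {n m : ℕ} (φ : Formula LFTC0 q n m) (x : Fin n → M.U .num)
    (X : Fin m → M.U .str) : Prop := φ.Holds (expand M I) x X

variable [IsV0 M] {I : Interp M}

/-- The interpretation of a function symbol satisfies the defining axioms of the symbol. -/
def SymSpec (I : Interp M) : {s : Srt} → {k l : ℕ} → LFTC0 s k l → Prop
  | _, _, _, .base f => ∀ x X, I (.base f) x X = M.fn f x X
  | _, _, _, .pd => IsPd (fun a => I .pd ![a] ![])
  | _, _, _, .fSE => IsFSE (fun A B => I .fSE ![] ![A, B])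
  | _, _, _, .numones => IsNumones (fun a A => I .numones ![a] ![A])
  | _, _, _, .strFn α t => IsStrFn (holds I α) t (I (.strFn α t))
  | _, _, _, .numFn α t => IsNumFn (holds I α) t (I (.numFn α t))

theorem coded_tval {s : Srt} {n m : ℕ} (t : Term LFTC0 s n m)
    (h : t.All (fun f => Coded (I f))) : Coded (tval I t) := by
  induction t with
  | nvar i => exact fun b D E => ⟨D i, fun _ _ => rfl⟩
  | svar i => exact fun b D E => ⟨E i, fun _ _ => rfl⟩
  | app f xs Xs ih1 ih2 =>
    exact h.1.comp (fun i => ih1 i (h.2.1 i)) (fun i => ih2 i (h.2.2 i))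

theorem codedRel_holds {n m : ℕ} :
    ∀ α : OpenFormula LFTC0 n m, α.All (fun f => Coded (I f)) → CodedRel (holds I α)
  | .tru, _ => .const True
  | .fls, _ => .const False
  | .eq t u, h => .eq (coded_tval t h.1) (coded_tval u h.2)
  | .le t u, h => .le (coded_tval t h.1) (coded_tval u h.2)
  | .mem t T, h => .mem (coded_tval t h.1) (coded_tval T h.2)
  | .not φ, h => .not (codedRel_holds φ h)
  | .and φ ψ, h => .and (codedRel_holds φ h.1) (codedRel_holds ψ h.2)
  | .or φ ψ, h => .or (codedRel_holds φ h.1) (codedRel_holds ψ h.2)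

theorem eq_vec_zero {α : Type*} (x : Fin 0 → α) : x = ![] := Subsingleton.elim _ _

theorem eq_vec_one {α : Type*} (x : Fin 1 → α) : x = ![x 0] := by
  funext i; fin_cases i; rfl

theorem eq_vec_two {α : Type*} (x : Fin 2 → α) : x = ![x 0, x 1] := by
  funext i; fin_cases i <;> rfl

theorem coded_base {s : Srt} {k l : ℕ} (f : L2A s k l) : Coded (M := M) (M.fn f) := by
  cases f with
  | zero =>
    convert coded_const_zero (M := M) using 1
    funext x X; rw [eq_vec_zero x, eq_vec_zero X]; rfl
  | one =>
    convert coded_const_one (M := M) using 1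
    funext x X; rw [eq_vec_zero x, eq_vec_zero X]; rfl
  | add =>
    convert coded_add (M := M) using 1
    funext x X; rw [eq_vec_two x, eq_vec_zero X]; rfl
  | mul =>
    convert coded_mul (M := M) using 1
    funext x X; rw [eq_vec_two x, eq_vec_zero X]; rfl
  | len =>
    convert coded_len (M := M) using 1
    funext x X; rw [eq_vec_zero x, eq_vec_one X]; rfl

theorem SymSpec.coded_pd (h : SymSpec I .pd) : Coded (I .pd) := by
  convert IsPd.coded (l := 0) (show IsPd (fun a => I .pd ![a] ![]) from h) using 1
  funext x X; rw [eq_vec_one x, eq_vec_zero X]; rfl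

theorem SymSpec.coded_fSE (h : SymSpec I .fSE) : Coded (I .fSE) := by
  convert IsFSE.coded (k := 0) h using 1
  funext x X; rw [eq_vec_zero x, eq_vec_two X]; rfl

theorem SymSpec.coded_numones (h : SymSpec I .numones) : Coded (I .numones) := by
  convert IsNumones.coded h using 1
  funext x X; rw [eq_vec_one x, eq_vec_one X]; rfl

theorem SymSpec.coded_base {s : Srt} {k l : ℕ} {f : L2A s k l} (h : SymSpec I (.base f)) :
    Coded (I (.base f)) := by
  have e : I (.base f) = M.fn f := funext fun x => funext fun X => h x X
  rw [e]; exact TwoSorted.coded_base f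

/-- An interpretation that satisfies the defining axioms carries coded families to coded
families. -/
theorem coded_of_symSpec (h : ∀ {s : Srt} {k l : ℕ} (f : LFTC0 s k l), SymSpec I f) {s : Srt}
    {k l : ℕ} (f : LFTC0 s k l) : Coded (I f) :=
  LFTC0.induction (P := fun f => Coded (I f)) (fun f => (h (.base f)).coded_base)
    (h .pd).coded_pd (h .fSE).coded_fSE (h .numones).coded_numones
    (fun α t hα => IsStrFn.coded (h (.strFn α t)) (codedRel_holds α hα))
    (fun α t hα => IsNumFn.coded (h (.numFn α t)) (codedRel_holds α hα)) f

/-! ### The expansion of a model of `VTC⁰` -/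

theorem sig0_exists_min {P : M.U .num → Prop} {a : M.U .num}
    (hP : ∃ A : M.U .str, ∀ z, z < a → (z ∈ A ↔ P z)) :
    ∃ y, y ≤ a ∧ (y < a → P y) ∧ ∀ z, z < y → ¬ P z := by
  obtain ⟨A, hA⟩ := hP
  by_contra! hcon
  have key : ∀ y, y ≤ a → ∀ z, z < y → ¬ z ∈ A := by
    refine sig0_induction (fun y => y ≤ a → ∀ z, z < y → ¬ z ∈ A)
      (fun _ z hz => absurd hz (not_lt_of_ge (IsBasic.b8 z))) (fun y ih hy z hz => ?_)
    have hy' : y < a := add_one_le_iff'.1 hy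
    rcases (lt_add_one_iff'.1 hz).lt_or_eq with h | rfl
    · exact ih hy'.le z h
    · intro hz'
      obtain ⟨w, hw, hPw⟩ := hcon z hy'.le fun _ => (hA z hy').1 hz'
      exact ih hy'.le w hw ((hA w (hw.trans hy')).2 hPw)
  obtain ⟨w, hw, hPw⟩ := hcon a le_rfl fun h => absurd h (lt_irrefl a)
  exact key a le_rfl w hw ((hA w hw).2 hPw)

/-- For single arguments, a coded relation satisfies comprehension. -/
theorem CodedRel.exists_str {k l : ℕ}
    {P : (Fin (k + 1) → M.U .num) → (Fin l → M.U .str) → Prop} (hP : CodedRel P)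
    (x : Fin k → M.U .num) (X : Fin l → M.U .str) (a : M.U .num) :
    ∃ A : M.U .str, ∀ z, z < a → (z ∈ A ↔ P (Fin.cons z x) X) := by
  choose D hD using fun i => exists_array_num (fun _ => x i) 1
  choose E hE using fun j => exists_array (fun _ z => z ∈ X j) 1 (len (X j))
  obtain ⟨A, hA⟩ := hP.exists_pairs 1 a D E
  refine ⟨rowS A 0, fun z hz => ?_⟩
  have h1 : (0 : M.U .num) < 1 := zero_lt_one
  rw [mem_rowS, hA 0 h1 z hz]
  have e1 : (fun i => rowN (D i) 0) = x := funext fun i => hD i 0 h1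
  have e2 : (fun j => rowS (E j) 0) = X := funext fun j => str_ext fun z => by
    rw [hE j 0 h1 z]; exact ⟨And.right, fun h => ⟨lt_len_of_mem h, h⟩⟩
  rw [e1, e2]

theorem CodedRel.exists_isStrFn {k l : ℕ}
    {P : (Fin (k + 1) → M.U .num) → (Fin l → M.U .str) → Prop} (hP : CodedRel P)
    (t : Term L2A .num k l) : ∃ g, IsStrFn P t g := by
  have h : ∀ x X, ∃ A : M.U .str, ∀ z, z ∈ A ↔ z < t.val M x X ∧ P (Fin.cons z x) X := by
    intro x X
    obtain ⟨A, hA⟩ := hP.exists_str x X (t.val M x X)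
    obtain ⟨B, hB⟩ := TwoSorted.exists_str (fun z => z ∈ A) (t.val M x X)
    exact ⟨B, fun z => (hB z).trans (and_congr_right fun hz => hA z hz)⟩
  choose g hg using h
  exact ⟨g, hg⟩

theorem CodedRel.exists_isNumFn {k l : ℕ}
    {P : (Fin (k + 1) → M.U .num) → (Fin l → M.U .str) → Prop} (hP : CodedRel P)
    (t : Term L2A .num k l) : ∃ g, IsNumFn P t g := by
  choose g hg using fun x X => sig0_exists_min (hP.exists_str x X (t.val M x X))
  exact ⟨g, hg⟩

theorem exists_isPd : ∃ g : M.U .num → M.U .num, IsPd g := by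
  have h : ∀ a : M.U .num, ∃ b, (a = 0 → b = 0) ∧ (a ≠ 0 → b + 1 = a) := by
    intro a
    by_cases h : a = 0
    · exact ⟨0, fun _ => rfl, fun h' => absurd h h'⟩
    · obtain ⟨b, -, hb⟩ := IsV0.b12 a h
      exact ⟨b, fun h' => absurd h' h, fun _ => hb⟩
  choose g hg using h
  exact ⟨g, (hg 0).1 rfl, fun a => (hg a).2⟩

theorem exists_isFSE : ∃ g : M.U .str → M.U .str → M.U .num, IsFSE g := by
  have h : ∀ X Y : M.U .str, ∃ y, y ≤ len X ∧ (y < len X → ¬ (y ∈ X ↔ y ∈ Y)) ∧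
      ∀ z, z < y → ¬ ¬ (z ∈ X ↔ z ∈ Y) := fun X Y =>
    sig0_exists_min ((exists_comp (fun z => ¬ (z ∈ X ↔ z ∈ Y)) (len X)).imp fun _ => And.right)
  choose g hg using h
  exact ⟨g, fun X Y => ⟨(hg X Y).1, (hg X Y).2.1, fun z hz => not_not.1 ((hg X Y).2.2 z hz)⟩⟩

end Interp

section Construction

variable (M : Struct.{u} L2A) [IsV0 M]

instance (s : Srt) : Nonempty (M.U s) := M.nonempty s

mutual

/-- The interpretation of a function symbol in a model of `VTC⁰`: a function that satisfies the
defining axioms. -/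
noncomputable def interp : {s : Srt} → {k l : ℕ} → LFTC0 s k l →
    (Fin k → M.U .num) → (Fin l → M.U .str) → M.U s
  | _, _, _, .base f => M.fn f
  | _, _, _, .pd => fun x _ => Classical.epsilon (IsPd (M := M)) (x 0)
  | _, _, _, .fSE => fun _ X => Classical.epsilon (IsFSE (M := M)) (X 0) (X 1)
  | _, _, _, .numones => fun x X => Classical.epsilon (IsNumones (M := M)) (x 0) (X 0)
  | _, _, _, .strFn α t => Classical.epsilon (IsStrFn (M := M) (interpHolds α) t)
  | _, _, _, .numFn α t => Classical.epsilon (IsNumFn (M := M) (interpHolds α) t)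

/-- The value of a term for the interpretation `interp`. -/
noncomputable def interpVal : {s : Srt} → {n m : ℕ} → Term LFTC0 s n m →
    (Fin n → M.U .num) → (Fin m → M.U .str) → M.U s
  | _, _, _, .nvar i => fun x _ => x i
  | _, _, _, .svar i => fun _ X => X i
  | _, _, _, .app f xs Xs => fun x X =>
      interp f (fun i => interpVal (xs i) x X) (fun i => interpVal (Xs i) x X)

/-- The truth of a formula for the interpretation `interp`. -/
noncomputable def interpHolds : {q : Bool} → {n m : ℕ} → Formula LFTC0 q n m →
    (Fin n → M.U .num) → (Fin m → M.U .str) → Prop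
  | _, _, _, .tru => fun _ _ => True
  | _, _, _, .fls => fun _ _ => False
  | _, _, _, .eq t u => fun x X => interpVal t x X = interpVal u x X
  | _, _, _, .le t u => fun x X => interpVal t x X ≤ interpVal u x X
  | _, _, _, .mem t T => fun x X => interpVal t x X ∈ interpVal T x X
  | _, _, _, .not φ => fun x X => ¬ interpHolds φ x X
  | _, _, _, .and φ ψ => fun x X => interpHolds φ x X ∧ interpHolds ψ x X
  | _, _, _, .or φ ψ => fun x X => interpHolds φ x X ∨ interpHolds ψ x X
  | _, _, _, .exN φ => fun x X => ∃ a, interpHolds φ (Fin.cons a x) X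
  | _, _, _, .allN φ => fun x X => ∀ a, interpHolds φ (Fin.cons a x) X
  | _, _, _, .exS φ => fun x X => ∃ A, interpHolds φ x (Fin.cons A X)
  | _, _, _, .allS φ => fun x X => ∀ A, interpHolds φ x (Fin.cons A X)

end

variable {M}

theorem interpVal_eq {s : Srt} {n m : ℕ} (t : Term LFTC0 s n m) :
    interpVal M t = tval (M := M) (interp M) t := by
  funext x X
  induction t with
  | nvar i => simp only [interpVal]; rfl
  | svar i => simp only [interpVal]; rfl
  | app f xs Xs ih1 ih2 => simp only [interpVal, ih1, ih2]; rfl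

theorem interpHolds_eq {n m : ℕ} : ∀ α : OpenFormula LFTC0 n m,
    interpHolds M α = holds (M := M) (interp M) α
  | .tru => by simp only [interpHolds]; rfl
  | .fls => by simp only [interpHolds]; rfl
  | .eq t u => by simp only [interpHolds, interpVal_eq]; rfl
  | .le t u => by simp only [interpHolds, interpVal_eq]; rfl
  | .mem t T => by simp only [interpHolds, interpVal_eq]; rfl
  | .not φ => by simp only [interpHolds, interpHolds_eq φ]; rfl
  | .and φ ψ => by simp only [interpHolds, interpHolds_eq φ, interpHolds_eq ψ]; rfl
  | .or φ ψ => by simp only [interpHolds, interpHolds_eq φ, interpHolds_eq ψ]; rfl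

/-- In a model of `VTC⁰`, every function symbol has an interpretation that satisfies its defining
axioms. By induction on the symbol, it carries moreover coded families to coded families, and
this is what gives the comprehension that the next symbols need. -/
theorem symSpec_interp (h : ∀ X : M.U .str, ∃ Y, CountSeq (len X) X Y) {s : Srt} {k l : ℕ}
    (f : LFTC0 s k l) : SymSpec (M := M) (interp M) f := by
  have hpd : SymSpec (M := M) (interp M) .pd := by
    have := Classical.epsilon_spec (exists_isPd (M := M))
    simp only [SymSpec, interp]; exact this
  have hSE : SymSpec (M := M) (interp M) .fSE := by
    have := Classical.epsilon_spec (exists_isFSE (M := M))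
    simp only [SymSpec, interp]; exact this
  have hnum : SymSpec (M := M) (interp M) .numones := by
    have := Classical.epsilon_spec (exists_isNumones h)
    simp only [SymSpec, interp]; exact this
  have hbase : ∀ {s : Srt} {k l : ℕ} (f : L2A s k l), SymSpec (M := M) (interp M) (.base f) :=
    fun f x X => by simp only [interp]
  have key := LFTC0.induction
    (P := fun f => SymSpec (M := M) (interp M) f ∧ Coded (M := M) (interp M f))
    (fun f => ⟨hbase f, (hbase f).coded_base⟩) ⟨hpd, hpd.coded_pd⟩ ⟨hSE, hSE.coded_fSE⟩
    ⟨hnum, hnum.coded_numones⟩ (fun α t hα => ?_) (fun α t hα => ?_) f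
  · exact key.1
  · have hα' := codedRel_holds (M := M) (I := interp M) α (hα.imp fun h => h.2)
    have hspec : IsStrFn (holds (interp M) α) t (interp M (.strFn α t)) := by
      have := Classical.epsilon_spec (hα'.exists_isStrFn t)
      simpa only [interp, interpHolds_eq] using this
    exact ⟨hspec, hspec.coded hα'⟩
  · have hα' := codedRel_holds (M := M) (I := interp M) α (hα.imp fun h => h.2)
    have hspec : IsNumFn (holds (interp M) α) t (interp M (.numFn α t)) := by
      have := Classical.epsilon_spec (hα'.exists_isNumFn t)
      simpa only [interp, interpHolds_eq] using this
    exact ⟨hspec, hspec.coded hα'⟩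

end Construction

/-! ### Models of the two theories -/

section Models

/-- The interpretation of the symbols of `L_FTC⁰` in a structure, over its `L²_A`-reduct. -/
abbrev Struct.interpOf (N : Struct.{u} LFTC0) : Interp N.reduct := fun f => N.fn f

section Values

variable (N : Struct.{u} LFTC0) {n m : ℕ} (x : Fin n → N.U .num) (X : Fin m → N.U .str)

theorem val_pd (t : Term LFTC0 .num n m) :
    (Term.app .pd ![t] ![]).val N x X = N.interpOf .pd ![t.val N x X] ![] := by
  change N.fn _ _ _ = N.fn _ _ _
  congr 1
  · funext i; fin_cases i; rfl
  · exact Subsingleton.elim _ _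

theorem val_fSE (S T : Term LFTC0 .str n m) :
    (Term.app .fSE ![] ![S, T]).val N x X =
      N.interpOf .fSE ![] ![S.val N x X, T.val N x X] := by
  change N.fn _ _ _ = N.fn _ _ _
  congr 1
  · exact Subsingleton.elim _ _
  · funext i; fin_cases i <;> rfl

theorem val_numones (t : Term LFTC0 .num n m) (T : Term LFTC0 .str n m) :
    (Term.app .numones ![t] ![T]).val N x X =
      N.interpOf .numones ![t.val N x X] ![T.val N x X] := by
  change N.fn _ _ _ = N.fn _ _ _
  congr 1
  · funext i; fin_cases i; rfl
  · funext i; fin_cases i; rfl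

theorem val_ofSymbol {s : Srt} (f : LFTC0 s n m) :
    (Term.ofSymbol f).val N x X = N.interpOf f x X := rfl

end Values

/-- The axioms of `VTC⁰`-bar except for those on counting, read in a structure. -/
theorem models_VTC0bar_of {N : Struct.{u} LFTC0} [h0 : IsV0 N.reduct]
    (h : ∀ {s : Srt} {k l : ℕ} (f : LFTC0 s k l), SymSpec N.interpOf f) :
    N.Models VTC0bar := by
  rintro _ ⟨n, m, α, hα, rfl⟩
  rw [Formula.holds_closure]
  intro x X
  rw [Formula.holds_toFull]
  cases hα with
  | basic hα => exact (isBasic_iff N).1 inferInstance _ _ _ hα x X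
  | B12' =>
    simp only [Formula.holds_eq, val_pd, Term.val_zero]
    exact (h .pd).1
  | B12'' =>
    simp only [Formula.holds_imp, Formula.holds_not, Formula.holds_eq, val_pd, Term.val_zero,
      Term.val_one, Term.val_add]
    exact (h .pd).2 _
  | SE' =>
    simp only [Formula.holds_imp, Formula.holds_and, Formula.holds_eq, Term.val_len,
      Formula.holds_lt, Formula.holds_iff, Formula.holds_mem, Term.val_svar, Term.val_nvar]
    intro e
    rw [e]
    exact ⟨rfl, fun _ => Iff.rfl⟩
  | SE'' =>
    simp only [Formula.holds_imp, Formula.holds_and, Formula.holds_eq, Term.val_len, val_fSE,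
      Term.val_svar]
    rintro ⟨h1, h2⟩
    have h3 := (h .fSE (X 0) (X 1)).2.2
    exact (h0.se _ _).2 ⟨h1, fun z hz => h3 z (hz.trans_eq h2.symm)⟩
  | fSE1 =>
    simp only [Formula.holds_le, Term.val_len, val_fSE, Term.val_svar]
    exact (h .fSE (X 0) (X 1)).1
  | fSE2 =>
    simp only [Formula.holds_imp, Formula.holds_lt, Formula.holds_not, Formula.holds_iff,
      Formula.holds_mem, Term.val_len, val_fSE, Term.val_svar]
    exact (h .fSE (X 0) (X 1)).2.1
  | fSE3 =>
    simp only [Formula.holds_imp, Formula.holds_lt, Formula.holds_iff,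
      Formula.holds_mem, val_fSE, Term.val_svar, Term.val_nvar]
    exact (h .fSE (X 0) (X 1)).2.2 _
  | numones1 =>
    simp only [Formula.holds_eq, val_numones, Term.val_zero, Term.val_svar]
    exact (h .numones).zero _
  | numones2 =>
    simp only [Formula.holds_imp, Formula.holds_mem, Formula.holds_eq, val_numones, Term.val_add,
      Term.val_one, Term.val_svar, Term.val_nvar]
    exact (h .numones).succ_of_mem _ _
  | numones3 =>
    simp only [Formula.holds_imp, Formula.holds_not, Formula.holds_mem, Formula.holds_eq,
      val_numones, Term.val_add, Term.val_one, Term.val_svar, Term.val_nvar]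
    exact (h .numones).succ_of_notMem _ _
  | @strFn n m α t =>
    obtain ⟨z, x, rfl⟩ : ∃ z y, x = Fin.cons z y := ⟨x 0, Fin.tail x, by simp⟩
    simp only [Formula.holds_iff, Formula.holds_mem, Formula.holds_and, Formula.holds_lt,
      Term.val_shiftN, Term.val_lift, val_ofSymbol, Term.val_nvar]
    exact h (.strFn α t) x X z
  | numFn1 α t =>
    simp only [Formula.holds_le, Term.val_lift, val_ofSymbol]
    exact (h (.numFn α t) x X).1
  | numFn2 α t =>
    simp only [Formula.holds_imp, Formula.holds_lt, Term.val_lift, val_ofSymbol,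
      Formula.holds_subst]
    rw [fun_cons_eq (f := fun t => Term.val N x X t) rfl fun i => rfl]
    exact (h (.numFn α t) x X).2.1
  | @numFn3 n m α t =>
    obtain ⟨z, x, rfl⟩ : ∃ z y, x = Fin.cons z y := ⟨x 0, Fin.tail x, by simp⟩
    simp only [Formula.holds_imp, Formula.holds_not, Formula.holds_lt,
      Term.val_shiftN, val_ofSymbol, Term.val_nvar]
    exact (h (.numFn α t) x X).2.2 z

section OfModel

variable {N : Struct.{u} LFTC0} (h : N.Models VTC0bar)

include h

theorem holds_of_barAxiom {n m : ℕ} {α : OpenFormula LFTC0 n m} (hα : VTC0barAxiom n m α)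
    (x : Fin n → N.U .num) (X : Fin m → N.U .str) : α.Holds N x X :=
  (Formula.holds_toFull N α x X).1 (holds_closure_of_models h ⟨_, _, _, hα, rfl⟩ x X)

theorem isBasic_of_models : IsBasic N.reduct :=
  (isBasic_iff N).2 fun _ _ _ hα x X => holds_of_barAxiom h (.basic hα) x X

theorem isPd_of_models : SymSpec N.interpOf .pd := by
  have h1 := holds_of_barAxiom h .B12' ![] ![]
  have h2 := fun a => holds_of_barAxiom h .B12'' ![a] ![]
  simp only [Formula.holds_imp, Formula.holds_not, Formula.holds_eq, val_pd, Term.val_zero,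
    Term.val_one, Term.val_add] at h1 h2
  exact ⟨h1, h2⟩

theorem isFSE_of_models : SymSpec N.interpOf .fSE := by
  intro X Y
  have h1 := holds_of_barAxiom h .fSE1 ![] ![X, Y]
  have h2 := holds_of_barAxiom h .fSE2 ![] ![X, Y]
  have h3 := fun a => holds_of_barAxiom h .fSE3 ![a] ![X, Y]
  simp only [Formula.holds_imp, Formula.holds_lt, Formula.holds_not, Formula.holds_iff,
      Formula.holds_mem, Term.val_len, val_fSE, Term.val_svar, Formula.holds_le,
      Term.val_nvar] at h1 h2 h3
  exact ⟨h1, h2, h3⟩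

theorem isStrFn_of_models {n m : ℕ} (α : OpenFormula LFTC0 (n + 1) m) (t : Term L2A .num n m) :
    SymSpec N.interpOf (.strFn α t) := by
  have h1 : ∀ (x : Fin n → N.U .num) (X : Fin m → N.U .str) (z : N.U .num), _ :=
    fun x X z => holds_of_barAxiom h (.strFn α t) (Fin.cons z x) X
  simp only [Formula.holds_iff, Formula.holds_mem, Formula.holds_and, Formula.holds_lt,
      Term.val_shiftN, Term.val_lift, val_ofSymbol, Term.val_nvar] at h1
  exact h1

theorem isNumFn_of_models {n m : ℕ} (α : OpenFormula LFTC0 (n + 1) m) (t : Term L2A .num n m) :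
    SymSpec N.interpOf (.numFn α t) := by
  have h1 : ∀ (x : Fin n → N.U .num) (X : Fin m → N.U .str), _ :=
    fun x X => holds_of_barAxiom h (.numFn1 α t) x X
  have h2 : ∀ (x : Fin n → N.U .num) (X : Fin m → N.U .str), _ :=
    fun x X => holds_of_barAxiom h (.numFn2 α t) x X
  have h3 : ∀ (x : Fin n → N.U .num) (X : Fin m → N.U .str) (z : N.U .num), _ :=
    fun x X z => holds_of_barAxiom h (.numFn3 α t) (Fin.cons z x) X
  simp only [Formula.holds_imp, Formula.holds_le, Formula.holds_lt, Term.val_lift, val_ofSymbol,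
      Formula.holds_subst, Term.val_shiftN, Term.val_nvar, Formula.holds_not] at h1 h2 h3
  refine fun x X => ⟨h1 x X, ?_, h3 x X⟩
  have h4 := h2 x X
  rw [fun_cons_eq (f := fun t => Term.val N x X t) rfl fun i => rfl] at h4
  exact h4

/-- Bounded number quantifiers in front of open formulas can be eliminated with the help of the
functions that search for witnesses. -/
theorem exists_open_exLe {n m : ℕ} (α : OpenFormula LFTC0 (n + 1) m) (t : Term L2A .num n m) :
    ∃ β : OpenFormula LFTC0 n m, ∀ (x : Fin n → N.U .num) (X : Fin m → N.U .str),
      β.Holds N x X ↔ ∃ a, N.le a (t.val N.reduct x X) ∧ α.Holds N (Fin.cons a x) X := by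
  have := isBasic_of_models h
  refine ⟨α.subst (Fin.cons (.ofSymbol (.numFn α t)) fun i => .nvar i) fun i => .svar i,
    fun x X => ?_⟩
  obtain ⟨h1, h2, h3⟩ := isNumFn_of_models h α t x X
  rw [Formula.holds_subst, fun_cons_eq (f := fun t => Term.val N x X t) rfl fun i => rfl]
  refine ⟨fun hα => ⟨_, h1, hα⟩, fun ⟨a, ha, hα⟩ => ?_⟩
  rcases lt_or_eq_of_le (α := N.reduct.U .num) h1 with h4 | h4
  · exact h2 h4
  · rcases lt_or_ge (α := N.reduct.U .num) a (N.interpOf (.numFn α t) x X) with h5 | h5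
    · exact absurd hα (h3 a h5)
    · have e : a = N.interpOf (.numFn α t) x X :=
        le_antisymm (α := N.reduct.U .num) (le_of_le_of_eq ha h4.symm) h5
      rwa [e] at hα

theorem exists_open_exLt {n m : ℕ} (α : OpenFormula LFTC0 (n + 1) m) (t : Term L2A .num n m) :
    ∃ β : OpenFormula LFTC0 n m, ∀ (x : Fin n → N.U .num) (X : Fin m → N.U .str),
      β.Holds N x X ↔ ∃ a, (N.le a (t.val N.reduct x X) ∧ a ≠ t.val N.reduct x X) ∧
        α.Holds N (Fin.cons a x) X := by
  obtain ⟨β, hβ⟩ := exists_open_exLe h (.and α (.not (.eq (.nvar 0) t.lift.shiftN))) t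
  refine ⟨β, fun x X => (hβ x X).trans (exists_congr fun a => ?_)⟩
  simp only [Formula.holds_and, Formula.holds_not, Formula.holds_eq, Term.val_shiftN,
    Term.val_lift, Term.val_nvar, Fin.cons_zero]
  tauto

theorem exists_open_of_isSigma0B {n m : ℕ} {φ : Formula L2A true n m} (hφ : φ.IsSigma0B) :
    ∃ β : OpenFormula LFTC0 n m, ∀ (x : Fin n → N.U .num) (X : Fin m → N.U .str),
      β.Holds N x X ↔ φ.Holds N.reduct x X := by
  induction hφ with
  | tru => exact ⟨.tru, fun _ _ => Iff.rfl⟩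
  | fls => exact ⟨.fls, fun _ _ => Iff.rfl⟩
  | eq t u => exact ⟨.eq t.lift u.lift, fun x X => by
      simp only [Formula.holds_eq, Term.val_lift]; rfl⟩
  | le t u => exact ⟨.le t.lift u.lift, fun x X => by
      simp only [Formula.holds_le, Term.val_lift]; rfl⟩
  | mem t u =>
    exact ⟨.mem t.lift u.lift, fun x X => by simp only [Formula.holds_mem, Term.val_lift]; rfl⟩
  | not _ ih =>
    obtain ⟨β, hβ⟩ := ih
    exact ⟨.not β, fun x X => not_congr (hβ x X)⟩
  | and _ _ ih1 ih2 =>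
    obtain ⟨β, hβ⟩ := ih1
    obtain ⟨γ, hγ⟩ := ih2
    exact ⟨.and β γ, fun x X => and_congr (hβ x X) (hγ x X)⟩
  | or _ _ ih1 ih2 =>
    obtain ⟨β, hβ⟩ := ih1
    obtain ⟨γ, hγ⟩ := ih2
    exact ⟨.or β γ, fun x X => or_congr (hβ x X) (hγ x X)⟩
  | exNLe t _ ih =>
    obtain ⟨β, hβ⟩ := ih
    obtain ⟨γ, hγ⟩ := exists_open_exLe h β t
    refine ⟨γ, fun x X => (hγ x X).trans ?_⟩
    refine Iff.trans ?_ (Formula.holds_exNLe (M := N.reduct) t _).symm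
    simp only [hβ]; rfl
  | allNLe t _ ih =>
    obtain ⟨β, hβ⟩ := ih
    obtain ⟨γ, hγ⟩ := exists_open_exLe h (.not β) t
    refine ⟨.not γ, fun x X => (not_congr (hγ x X)).trans ?_⟩
    refine Iff.trans ?_ (Formula.holds_allNLe (M := N.reduct) t _).symm
    simp only [hβ, Formula.holds_not, not_exists, not_and, not_not]; rfl
  | exNLt t _ ih =>
    obtain ⟨β, hβ⟩ := ih
    obtain ⟨γ, hγ⟩ := exists_open_exLt h β t
    refine ⟨γ, fun x X => (hγ x X).trans ?_⟩
    refine Iff.trans ?_ (Formula.holds_exNLt (M := N.reduct) t _).symm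
    simp only [hβ]; rfl
  | allNLt t _ ih =>
    obtain ⟨β, hβ⟩ := ih
    obtain ⟨γ, hγ⟩ := exists_open_exLt h (.not β) t
    refine ⟨.not γ, fun x X => (not_congr (hγ x X)).trans ?_⟩
    refine Iff.trans ?_ (Formula.holds_allNLt (M := N.reduct) t _).symm
    simp only [hβ, Formula.holds_not, not_exists, not_and, not_not]; rfl

/-- Comprehension for open formulas, with an arbitrary bound. -/
theorem exists_comp_open {n m : ℕ} (α : OpenFormula LFTC0 (n + 1) m) (x : Fin n → N.reduct.U .num)
    (X : Fin m → N.reduct.U .str) (a : N.reduct.U .num) :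
    ∃ A : N.reduct.U .str, ∀ z, z ∈ A ↔ z < a ∧ α.Holds N (Fin.cons z x) X := by
  let α' : OpenFormula LFTC0 (n + 1 + 1) m :=
    α.subst (Fin.cons (.nvar 0) fun i => .nvar i.succ.succ) fun i => .svar i
  refine ⟨N.interpOf (.strFn α' (.nvar 0)) (Fin.cons a x) X, fun z => ?_⟩
  refine (isStrFn_of_models h α' (.nvar 0) (Fin.cons a x) X z).trans (and_congr Iff.rfl ?_)
  refine (Formula.holds_subst N _ _ _ _ α).trans ?_
  refine iff_of_eq ?_
  congr 1
  funext i
  refine Fin.cases rfl (fun i => rfl) i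

theorem isV0_of_models : IsV0 N.reduct := by
  have hb := isBasic_of_models h
  have hpd := isPd_of_models h
  have b12 : ∀ a : N.reduct.U .num, a ≠ 0 → ∃ b, b < a ∧ b + 1 = a := fun a ha => by
    refine ⟨_, ?_, hpd.2 a ha⟩
    rw [← add_one_le_iff', hpd.2 a ha]
  refine { hb with b12 := b12, se := fun A B => ?_, comp := fun φ hφ x X a => ?_ }
  · constructor
    · rintro rfl; exact ⟨rfl, fun _ _ => Iff.rfl⟩
    · rintro ⟨h1, h2⟩
      obtain ⟨h3, h4, -⟩ := isFSE_of_models h A B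
      have h5 := holds_of_barAxiom h .SE'' ![] ![A, B]
      simp only [Formula.holds_imp, Formula.holds_and, Formula.holds_eq, Term.val_len, val_fSE,
        Term.val_svar] at h5
      refine h5 ⟨h1, ?_⟩
      by_contra hne
      have hlt := lt_of_le_of_ne h3 hne
      exact h4 hlt (h2 _ hlt)
  · obtain ⟨β, hβ⟩ := exists_open_of_isSigma0B h hφ
    obtain ⟨A, hA⟩ := exists_comp_open h β x X a
    refine ⟨A, ?_, fun z hz => (hA z).trans ?_⟩
    · by_contra hlen
      rw [not_le] at hlen
      obtain ⟨y, -, hy⟩ := b12 (len A) (fun h0 => by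
        rw [h0] at hlen; exact absurd (IsBasic.b8 a) (not_le_of_gt hlen))
      have h1 := ((hA y).1 (IsBasic.l2 y A hy)).1
      rw [← add_one_le_iff', hy] at h1
      exact absurd h1 (not_le_of_gt hlen)
    · exact (and_iff_right hz).trans (hβ _ _)

theorem isNumones_of_models : SymSpec N.interpOf .numones := by
  have := isV0_of_models h
  have h1 := fun A => holds_of_barAxiom h .numones1 ![] ![A]
  have h2 := fun a A => holds_of_barAxiom h .numones2 ![a] ![A]
  have h3 := fun a A => holds_of_barAxiom h .numones3 ![a] ![A]
  simp only [Formula.holds_imp, Formula.holds_not, Formula.holds_mem, Formula.holds_eq,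
      val_numones, Term.val_add, Term.val_one, Term.val_zero, Term.val_svar, Term.val_nvar]
      at h1 h2 h3
  set g : N.reduct.U .num → N.reduct.U .str → N.reduct.U .num :=
    fun a A => N.interpOf .numones ![a] ![A] with hg
  have h1' : ∀ A, g 0 A = 0 := h1
  have h2' : ∀ a A, a ∈ A → g (a + 1) A = g a A + 1 := h2
  have h3' : ∀ a A, ¬ a ∈ A → g (a + 1) A = g a A := h3
  have hγ0 : ∀ (A : N.U .str) (a : N.U .num),
      (Formula.le (.app .numones ![.nvar 0] ![.svar 0]) (.nvar 0) : OpenFormula LFTC0 1 1).Holds N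
        (Fin.cons a ![]) ![A] ↔ N.le (N.interpOf .numones ![a] ![A]) a := fun A a => by
    simp only [Formula.holds_le, val_numones, Term.val_nvar, Term.val_svar]
    rfl
  have hle : ∀ A a, g a A ≤ a := by
    intro A a
    refine induction_of_comp (P := fun a => g a A ≤ a) (fun b => ?_) ?_ (fun z hz => ?_) a
    · obtain ⟨B, hB⟩ := exists_comp_open h (n := 0) (m := 1)
        (.le (.app .numones ![.nvar 0] ![.svar 0]) (.nvar 0)) ![] ![A] b
      refine ⟨B, fun z hz => (hB z).trans ((and_iff_right hz).trans (hγ0 A z))⟩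
    · rw [h1']
    · by_cases hA : z ∈ A
      · rw [h2' z A hA]; gcongr
      · rw [h3' z A hA]; exact hz.trans le_self_add
  refine ⟨h1', h2', h3', fun A b => ?_⟩
  obtain ⟨γ, hγ⟩ := exists_open_exLe h (n := 1) (m := 1)
    (.eq (.nvar 1) (.pair (.nvar 0) (.app .numones ![.nvar 0] ![.svar 0]))) (.nvar 0)
  obtain ⟨Y, hY⟩ := exists_comp_open h (n := 0) (m := 1) γ ![] ![A] (pr b b)
  refine ⟨Y, fun z hz y => (hY _).trans ?_⟩
  have hγ' : ∀ v : N.reduct.U .num, γ.Holds N ![v] ![A] ↔ ∃ a, a ≤ v ∧ v = pr a (g a A) := by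
    intro v
    refine (hγ ![v] ![A]).trans (exists_congr fun a => and_congr Iff.rfl ?_)
    simp only [Formula.holds_eq, Term.val_pair, val_numones, Term.val_nvar, Term.val_svar]
    rfl
  refine (and_congr Iff.rfl (hγ' _)).trans ?_
  constructor
  · rintro ⟨-, a, -, ha⟩
    obtain ⟨rfl, rfl⟩ := pr_inj.1 ha
    rfl
  · rintro rfl
    exact ⟨pr_lt_pr (add_lt_add hz (lt_of_le_of_lt (hle A z) hz)), z, left_le_pr _ _, rfl⟩

theorem symSpec_of_models {s : Srt} {k l : ℕ} : ∀ f : LFTC0 s k l, SymSpec N.interpOf f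
  | .base _ => fun _ _ => rfl
  | .pd => isPd_of_models h
  | .fSE => isFSE_of_models h
  | .numones => isNumones_of_models h
  | .strFn α t => isStrFn_of_models h α t
  | .numFn α t => isNumFn_of_models h α t

end OfModel

theorem holds_phiNUMONES {M : Struct.{u} L2A} (X Y : M.U .str) :
    phiNUMONES.Holds M ![] ![X, Y] ↔ CountSeq (len X) X Y := by
  simp [phiNUMONES, CountSeq]

theorem models_VTC0_iff (M : Struct.{u} L2A) :
    M.Models VTC0 ↔ IsV0 M ∧ ∀ X : M.U .str, ∃ Y, CountSeq (len X) X Y := by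
  have h1 : M.Models VTC0 ↔
      M.Models V0 ∧ NUMONES.Holds M (fun i => i.elim0) (fun i => i.elim0) := by
    simp only [Struct.Models, VTC0, Set.mem_union, Set.mem_singleton_iff, or_imp, forall_and,
      forall_eq]
  rw [h1, models_V0_iff]
  refine and_congr_right fun _ => ?_
  simp only [NUMONES, Formula.holds_allS, Formula.holds_exS, Formula.holds_rename]
  refine forall_congr' fun X => exists_congr fun Y => ?_
  rw [← holds_phiNUMONES]
  refine iff_of_eq ?_
  congr 1
  funext i; fin_cases i <;> rfl

theorem models_VTC0_of_bar {N : Struct.{u} LFTC0} (h : N.Models VTC0bar) :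
    N.reduct.Models VTC0 := by
  have := isV0_of_models h
  exact (models_VTC0_iff _).2 ⟨this, fun X => (isNumones_of_models h).exists_countSeq _ X⟩

/-- Every model of `VTC⁰` is the reduct of a model of `VTC⁰`-bar. -/
theorem exists_expansion {M : Struct.{u} L2A} (h : M.Models VTC0) :
    ∃ N : Struct.{u} LFTC0, N.reduct = M ∧ N.Models VTC0bar := by
  obtain ⟨h0, h1⟩ := (models_VTC0_iff M).1 h
  refine ⟨expand M (interp M), rfl, ?_⟩
  have : IsV0 (expand M (interp M)).reduct := h0
  exact models_VTC0bar_of fun f => symSpec_interp h1 f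

end Models

theorem isConservativeExtension : VTC0bar.IsConservativeExtension.{u} VTC0 := by
  refine ⟨fun n m φ h N hN x X => ?_, fun n m φ h M hM x X => ?_⟩
  · exact (Formula.holds_lift N φ x X).2 (h _ (models_VTC0_of_bar hN) x X)
  · obtain ⟨N, rfl, hN⟩ := exists_expansion hM
    exact (Formula.holds_lift N φ x X).1 (h N hN x X)

/-! ### Uniform `Σ¹₁` definability -/

/-- A model of `VTC⁰` together with an interpretation of the function symbols of `L_FTC⁰` that
satisfies their defining axioms. -/
structure Expansion : Type (u + 1) where
  M : Struct.{u} L2A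
  isV0 : IsV0 M
  I : Interp M
  spec : ∀ {s : Srt} {k l : ℕ} (f : LFTC0 s k l), SymSpec I f

attribute [instance] Expansion.isV0

/-- An expansion with an assignment of values to `q` number variables and `p` string variables. -/
structure Env (q p : ℕ) : Type (u + 1) extends Expansion.{u} where
  x : Fin q → M.U .num
  X : Fin p → M.U .str

variable {q p : ℕ}

/-- The assignment with one more string, which gets index `0`. -/
abbrev Env.consS (e : Env.{u} q p) (A : e.M.U .str) : Env.{u} q (p + 1) :=
  ⟨e.toExpansion, e.x, Fin.cons A e.X⟩

/-- The assignment with `n` more strings. -/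
abbrev Env.extS (e : Env.{u} q p) {n : ℕ} (A : Fin n → e.M.U .str) : Env.{u} q (p + n) :=
  ⟨e.toExpansion, e.x, extend e.X A⟩

/-- The relations that are defined by one `Σ¹₁` formula in all models. -/
def Sig11 (R : Env.{u} q p → Prop) : Prop :=
  ∃ φ : Formula L2A true q p, φ.IsSigma11 ∧ ∀ e : Env.{u} q p, φ.Holds e.M e.x e.X ↔ R e

/-- The values of the variables as parameters. -/
abbrev Params.vars : Params (fun e : Env.{u} q p => e.M) :=
  ⟨Set.range fun i e => e.x i, Set.range fun j e => e.X j⟩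

instance (i : Fin q) : Allowed (fun e : Env.{u} q p => e.x i) Params.vars.nums := ⟨i, rfl⟩

instance (j : Fin p) : Allowed (fun e : Env.{u} q p => e.X j) Params.vars.strs := ⟨j, rfl⟩

namespace Sig11

variable {R R' : Env.{u} q p → Prop}

theorem congr (h : Sig11 R) (e : ∀ x, R' x ↔ R x) : Sig11 R' := by
  have : R' = R := funext fun x => propext (e x)
  exact this ▸ h

theorem of_sig0 (h : Sig0 (Params.vars (q := q) (p := p)) (fun e (_ : Fin 0 → _) => R e)) :
    Sig11 R := by
  obtain ⟨c, s, hc, hs, h⟩ := h.exists_formula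
  obtain ⟨φ, hφ, H⟩ := h q p (fun i e => e.x i) (fun j e => e.X j) hc hs
  exact ⟨φ, .sigma0B hφ, fun e => H e Fin.elim0⟩

theorem and (h : Sig11 R) (h' : Sig11 R') : Sig11 (fun e => R e ∧ R' e) := by
  obtain ⟨φ, hφ, H⟩ := h
  obtain ⟨ψ, hψ, H'⟩ := h'
  obtain ⟨χ, hχ, H''⟩ := hφ.exists_and hψ
  exact ⟨χ, hχ, fun e => (H'' e.M e.x e.X).trans (and_congr (H e) (H' e))⟩

theorem forall_fin : ∀ {n : ℕ} {R : Fin n → Env.{u} q p → Prop}, (∀ i, Sig11 (R i)) →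
    Sig11 (fun e => ∀ i, R i e)
  | 0, _, _ => ⟨.tru, .sigma0B .tru, fun _ => iff_of_true trivial fun i => i.elim0⟩
  | _ + 1, _, h => ((h 0).and (forall_fin fun i => h i.succ)).congr fun _ => Fin.forall_fin_succ

theorem exS {R : Env.{u} q (p + 1) → Prop} (h : Sig11 R) :
    Sig11 (fun e : Env.{u} q p => ∃ A, R (e.consS A)) := by
  obtain ⟨φ, hφ, H⟩ := h
  exact ⟨.exS φ, hφ.exS, fun e => exists_congr fun A => H (e.consS A)⟩

theorem exSs : ∀ {n : ℕ} {R : Env.{u} q (p + n) → Prop}, Sig11 R →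
    Sig11 (fun e : Env.{u} q p => ∃ A : Fin n → e.M.U .str, R (e.extS A))
  | 0, R, h => h.congr fun e => ⟨fun ⟨_, h⟩ => h, fun h => ⟨Fin.elim0, h⟩⟩
  | n + 1, R, h => (exSs (exS (p := p + n) h)).congr fun e => by
      constructor
      · rintro ⟨A, hA⟩
        exact ⟨Fin.tail A, A 0, hA⟩
      · rintro ⟨A, B, h⟩
        refine ⟨Fin.cons B A, ?_⟩
        exact h

end Sig11

section Uniform

variable {k l : ℕ} {s : Srt}

/-- The graph of the action of `g` on arrays is defined by a `Σ¹₁` formula, uniformly in all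
models: the formula says that `W` is an array of the values of `g` at the entries of index below
`|B|` of the arrays `D` and `E`. -/
def SigCoded (g : ∀ N : Expansion.{u}, (Fin k → N.M.U .num) → (Fin l → N.M.U .str) → N.M.U s) :
    Prop :=
  ∀ (q p : ℕ) (B W : Fin p) (D : Fin k → Fin p) (E : Fin l → Fin p),
    Sig11 (fun e : Env.{u} q p => ∀ u, u < len (e.X B) → row s (e.X W) u =
      g e.toExpansion (fun i => rowN (e.X (D i)) u) (fun j => rowS (e.X (E j)) u))

/-- The analogue of `SigCoded` for relations. -/
def SigCodedRel
    (P : ∀ N : Expansion.{u}, (Fin k → N.M.U .num) → (Fin l → N.M.U .str) → Prop) : Prop :=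
  ∀ (q p : ℕ) (B A : Fin p) (D : Fin k → Fin p) (E : Fin l → Fin p),
    Sig11 (fun e : Env.{u} q p => ∀ u, u < len (e.X B) → (u ∈ e.X A ↔
      P e.toExpansion (fun i => rowN (e.X (D i)) u) (fun j => rowS (e.X (E j)) u)))

theorem SigCoded.comp {k' l' : ℕ}
    {g : ∀ N : Expansion.{u}, (Fin k' → N.M.U .num) → (Fin l' → N.M.U .str) → N.M.U s}
    {f : Fin k' → ∀ N : Expansion.{u}, (Fin k → N.M.U .num) → (Fin l → N.M.U .str) → N.M.U .num}
    {h : Fin l' → ∀ N : Expansion.{u}, (Fin k → N.M.U .num) → (Fin l → N.M.U .str) → N.M.U .str}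
    (hg : SigCoded g) (hf : ∀ i, SigCoded (f i)) (hh : ∀ j, SigCoded (h j))
    (hf' : ∀ i N, Coded (f i N)) (hh' : ∀ j N, Coded (h j N)) :
    SigCoded (fun N x X => g N (fun i => f i N x X) (fun j => h j N x X)) := by
  intro q p B W D E
  have h1 := Sig11.forall_fin fun i => hf i q (p + k' + l') (castAddIndex _ (castAddIndex _ B))
    (castAddIndex _ (natAddIndex _ i)) (fun i => castAddIndex _ (castAddIndex _ (D i)))
    (fun i => castAddIndex _ (castAddIndex _ (E i)))
  have h2 := Sig11.forall_fin fun j => hh j q (p + k' + l') (castAddIndex _ (castAddIndex _ B))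
    (natAddIndex _ j) (fun i => castAddIndex _ (castAddIndex _ (D i)))
    (fun i => castAddIndex _ (castAddIndex _ (E i)))
  have h3 := hg q (p + k' + l') (castAddIndex _ (castAddIndex _ B))
    (castAddIndex _ (castAddIndex _ W)) (fun i => castAddIndex _ (natAddIndex _ i))
    (fun i => natAddIndex _ i)
  refine (((h1.and h2).and h3).exSs.exSs).congr fun e => ?_
  simp only [extend_castAddIndex, extend_natAddIndex]
  constructor
  · intro H
    choose D' hD' using fun i => hf' i e.toExpansion (len (e.X B)) (fun i => e.X (D i))
      (fun j => e.X (E j))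
    choose E' hE' using fun i => hh' i e.toExpansion (len (e.X B)) (fun i => e.X (D i))
      (fun j => e.X (E j))
    refine ⟨D', E', ⟨hD', hE'⟩, fun u hu => (H u hu).trans ?_⟩
    congr 1
    · exact funext fun i => (hD' i u hu).symm
    · exact funext fun i => (hE' i u hu).symm
  · rintro ⟨D', E', ⟨hD', hE'⟩, H⟩ u hu
    refine (H u hu).trans ?_
    congr 1
    · exact funext fun i => hD' i u hu
    · exact funext fun i => hE' i u hu

/-- Definability by a `Σ₀ᴮ` formula, uniformly in all models, with the values of the variables as
parameters. -/
abbrev Sig0.Uniform {q p n : ℕ} (P : ∀ e : Env.{u} q p, (Fin n → e.M.U .num) → Prop) : Prop :=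
  Sig0 (Params.vars (q := q) (p := p)) P

theorem SigCoded.of_sig0
    {g : ∀ N : Expansion.{u}, (Fin k → N.M.U .num) → (Fin l → N.M.U .str) → N.M.U s}
    (h : ∀ (q p : ℕ) (W : Fin p) (D : Fin k → Fin p) (E : Fin l → Fin p),
      Sig0.Uniform (fun (e : Env.{u} q p) (v : Fin 1 → _) => row s (e.X W) (v 0) =
        g e.toExpansion (fun i => rowN (e.X (D i)) (v 0)) (fun j => rowS (e.X (E j)) (v 0)))) :
    SigCoded g := by
  intro q p B W D E
  have := h q p W D E
  exact .of_sig0 inferInstance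

theorem sigCoded_term (t : Term L2A .num k l) :
    SigCoded.{u} (s := .num) (fun N x X => t.val N.M x X) := by
  refine .of_sig0 fun q p W D E => ?_
  have := sigF_term_val (S := fun e : Env.{u} q p => e.M) (Pa := Params.vars) (n := 1)
    (f := fun _ v => v 0) (D := fun i e => e.X (D i)) (E := fun j e => e.X (E j)) t
  exact inferInstanceAs (Sig0.Uniform (fun (e : Env.{u} q p) (v : Fin 1 → _) => rowN (e.X W) (v 0) =
    t.val e.M (fun i => rowN (e.X (D i)) (v 0)) (fun j => rowS (e.X (E j)) (v 0))))

theorem sigCoded_base (f : L2A s k l) : SigCoded.{u} (fun N x X => N.M.fn f x X) := by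
  cases f
  · exact sigCoded_term (.ofSymbol .zero)
  · exact sigCoded_term (.ofSymbol .one)
  · exact sigCoded_term (.ofSymbol .add)
  · exact sigCoded_term (.ofSymbol .mul)
  · exact sigCoded_term (.ofSymbol .len)

theorem eq_iff_of_isMin {M : Struct.{u} L2A} [IsV0 M] {P : M.U .num → Prop} {t a : M.U .num}
    (h1 : a ≤ t) (h2 : a < t → P a) (h3 : ∀ z, z < a → ¬ P z) (y : M.U .num) :
    y = a ↔ y ≤ t ∧ (y < t → P y) ∧ ∀ z, z < y → ¬ P z := by
  constructor
  · rintro rfl; exact ⟨h1, h2, h3⟩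
  · rintro ⟨h4, h5, h6⟩
    rcases lt_trichotomy y a with h | h | h
    · exact absurd (h5 (h.trans_le h1)) (h3 y h)
    · exact h
    · exact absurd (h2 (h.trans_le h4)) (h6 a h)

theorem IsPd.eq_iff {M : Struct.{u} L2A} [IsV0 M] {g : M.U .num → M.U .num} (hg : IsPd g)
    (a y : M.U .num) : y = g a ↔ (a = 0 → y = 0) ∧ (a ≠ 0 → y + 1 = a) := by
  by_cases h : a = 0
  · subst h; simp [hg.1]
  · simp only [h, false_implies, ne_eq, not_false_eq_true, true_implies, true_and]
    constructor
    · rintro rfl; exact hg.2 a h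
    · intro h'; exact add_right_cancel (h'.trans (hg.2 a h).symm)

theorem sigCoded_pd : SigCoded.{u} (fun N x X => N.I .pd x X) := by
  refine .of_sig0 fun q p W D E => ?_
  have : Sig0.Uniform (fun (e : Env.{u} q p) (v : Fin 1 → _) =>
    (rowN (e.X (D 0)) (v 0) = 0 → rowN (e.X W) (v 0) = 0) ∧
    (rowN (e.X (D 0)) (v 0) ≠ 0 → rowN (e.X W) (v 0) + 1 = rowN (e.X (D 0)) (v 0))) := inferInstance
  refine this.congr fun e v => ?_
  rw [eq_vec_one (fun i => rowN (e.X (D i)) (v 0)), eq_vec_zero (fun j => rowS (e.X (E j)) (v 0))]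
  exact IsPd.eq_iff (g := fun a => e.I .pd ![a] ![]) (e.spec .pd) _ _

theorem sigCoded_fSE : SigCoded.{u} (fun N x X => N.I .fSE x X) := by
  refine .of_sig0 fun q p W D E => ?_
  have : Sig0.Uniform (fun (e : Env.{u} q p) (v : Fin 1 → _) =>
    rowN (e.X W) (v 0) ≤ rowN (e.X (E 0)) (v 0) ∧
    (rowN (e.X W) (v 0) < rowN (e.X (E 0)) (v 0) → ¬ (rowN (e.X W) (v 0) ∈ rowS (e.X (E 0)) (v 0) ↔
      rowN (e.X W) (v 0) ∈ rowS (e.X (E 1)) (v 0))) ∧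
      ∀ z, z < rowN (e.X W) (v 0) → ¬ ¬ (z ∈ rowS (e.X (E 0)) (v 0) ↔ z ∈ rowS (e.X (E 1)) (v 0))) :=
    inferInstance
  refine this.congr fun e v => ?_
  rw [eq_vec_zero (fun i => rowN (e.X (D i)) (v 0)), eq_vec_two (fun j => rowS (e.X (E j)) (v 0))]
  obtain ⟨h1, h2, h3⟩ := e.spec .fSE (rowS (e.X (E 0)) (v 0)) (rowS (e.X (E 1)) (v 0))
  exact eq_iff_of_isMin h1 h2 (fun z hz => not_not.2 (h3 z hz)) _

theorem IsNumones.eq_iff {M : Struct.{u} L2A} [IsV0 M] {g : M.U .num → M.U .str → M.U .num}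
    (hg : IsNumones g) {b m u z y : M.U .num} {E Z Y : M.U .str} (hZ : IsConcat b m E Z)
    (hY : CountSeq (b * m) Z Y) (hu : u < b) (hz : z < m) :
    y = g z (rowS E u) ↔ ∃ p, p ≤ b * m ∧ ∃ q, q ≤ b * m ∧
      pr (u * m) p ∈ Y ∧ pr (u * m + z) q ∈ Y ∧ y + p = q := by
  have h2 := mul_add_lt hu hz
  have h1 : u * m < b * m := lt_of_le_of_lt le_self_add h2
  rw [← add_left_inj (g (u * m) Z), hg.add_eq hZ hu hz.le]
  constructor
  · intro h
    have h3 := (hg.le Z _).trans h1.le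
    have h4 := (hg.le Z _).trans h2.le
    exact ⟨_, h3, _, h4, (hg.mem_countSeq_iff hY h1.le h3).2 rfl,
      (hg.mem_countSeq_iff hY h2.le h4).2 rfl, h⟩
  · rintro ⟨p, hp, q, hq, h3, h4, h5⟩
    rwa [← (hg.mem_countSeq_iff hY h1.le hp).1 h3, ← (hg.mem_countSeq_iff hY h2.le hq).1 h4]

theorem sigCoded_numones : SigCoded.{u} (fun N x X => N.I .numones x X) := by
  intro q p B W D E
  have h1 : Sig0.Uniform (n := 0) (fun (e : Env.{u} q (p + 1 + 1)) _ =>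
      IsConcat (len (e.X B.succ.succ)) (len (e.X (D 0).succ.succ) + 1) (e.X (E 0).succ.succ)
        (e.X 1)) := by
    unfold IsConcat; infer_instance
  have h2 : Sig0.Uniform (n := 0) (fun (e : Env.{u} q (p + 1 + 1)) _ =>
      CountSeq (len (e.X B.succ.succ) * (len (e.X (D 0).succ.succ) + 1)) (e.X 1) (e.X 0)) := by
    unfold CountSeq; infer_instance
  have h3 : Sig0.Uniform (n := 0) (fun (e : Env.{u} q (p + 1 + 1)) _ =>
      ∀ u, u < len (e.X B.succ.succ) →
        ∃ p, p ≤ len (e.X B.succ.succ) * (len (e.X (D 0).succ.succ) + 1) ∧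
        ∃ q, q ≤ len (e.X B.succ.succ) * (len (e.X (D 0).succ.succ) + 1) ∧
          pr (u * (len (e.X (D 0).succ.succ) + 1)) p ∈ e.X 0 ∧
          pr (u * (len (e.X (D 0).succ.succ) + 1) + rowN (e.X (D 0).succ.succ) u) q ∈ e.X 0 ∧
          rowN (e.X W.succ.succ) u + p = q) := inferInstance
  refine (((Sig11.of_sig0 h1).and (.of_sig0 h2)).and (.of_sig0 h3)).exS.exS.congr fun e => ?_
  have hg : IsNumones (fun a A => e.I .numones ![a] ![A]) := e.spec .numones
  have key : ∀ {Z Y : e.M.U .str},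
      IsConcat (len (e.X B)) (len (e.X (D 0)) + 1) (e.X (E 0)) Z →
      CountSeq (len (e.X B) * (len (e.X (D 0)) + 1)) Z Y → ∀ u, u < len (e.X B) →
      (rowN (e.X W) u =
          e.I .numones (fun i => rowN (e.X (D i)) u) (fun j => rowS (e.X (E j)) u) ↔
        ∃ p, p ≤ len (e.X B) * (len (e.X (D 0)) + 1) ∧
        ∃ q, q ≤ len (e.X B) * (len (e.X (D 0)) + 1) ∧
          pr (u * (len (e.X (D 0)) + 1)) p ∈ Y ∧
          pr (u * (len (e.X (D 0)) + 1) + rowN (e.X (D 0)) u) q ∈ Y ∧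
          rowN (e.X W) u + p = q) := by
    intro Z Y hZ hY u hu
    rw [eq_vec_one (fun i => rowN (e.X (D i)) u), eq_vec_one (fun j => rowS (e.X (E j)) u)]
    exact hg.eq_iff hZ hY hu (lt_add_one_iff'.2 (rowN_le _ _))
  constructor
  · intro H
    obtain ⟨Z, hZ⟩ := exists_isConcat (len (e.X B)) (len (e.X (D 0)) + 1) (e.X (E 0))
    obtain ⟨Y, hY⟩ := hg.exists_countSeq (len (e.X B) * (len (e.X (D 0)) + 1)) Z
    exact ⟨Z, Y, ⟨hZ, hY⟩, fun u hu => (key hZ hY u hu).1 (H u hu)⟩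
  · rintro ⟨Z, Y, ⟨hZ, hY⟩, H⟩ u hu
    exact (key hZ hY u hu).2 (H u hu)

/-! ### Relations -/

section Relations

variable {P Q : ∀ N : Expansion.{u}, (Fin k → N.M.U .num) → (Fin l → N.M.U .str) → Prop}

theorem SigCodedRel.const (c : Prop) :
    SigCodedRel.{u} (k := k) (l := l) (fun _ _ _ => c) := by
  intro q p B A D E
  by_cases hc : c
  · have : Sig0.Uniform (n := 0) (fun (e : Env.{u} q p) _ =>
      ∀ u, u < len (e.X B) → u ∈ e.X A) := inferInstance
    exact (Sig11.of_sig0 this).congr fun e => by simp [hc]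
  · have : Sig0.Uniform (n := 0) (fun (e : Env.{u} q p) _ =>
      ∀ u, u < len (e.X B) → ¬ u ∈ e.X A) := inferInstance
    exact (Sig11.of_sig0 this).congr fun e => by simp [hc]

theorem SigCodedRel.not (hP : SigCodedRel P) (hP' : ∀ N, CodedRel (P N)) :
    SigCodedRel (fun N x X => ¬ P N x X) := by
  intro q p B A D E
  have h1 := hP q (p + 1) B.succ 0 (fun i => (D i).succ) (fun j => (E j).succ)
  have h2 : Sig0.Uniform (n := 0) (fun (e : Env.{u} q (p + 1)) _ =>
    ∀ u, u < len (e.X B.succ) → (u ∈ e.X A.succ ↔ ¬ u ∈ e.X 0)) := inferInstance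
  refine (h1.and (.of_sig0 h2)).exS.congr fun e => ?_
  obtain ⟨C, hC⟩ := hP' e.toExpansion (len (e.X B)) (fun i => e.X (D i)) (fun j => e.X (E j))
  constructor
  · exact fun H => ⟨C, hC, fun u hu => (H u hu).trans (not_congr (hC u hu).symm)⟩
  · rintro ⟨C, hC, H⟩ u hu
    exact (H u hu).trans (not_congr (hC u hu))

theorem SigCodedRel.and (hP : SigCodedRel P) (hQ : SigCodedRel Q) (hP' : ∀ N, CodedRel (P N))
    (hQ' : ∀ N, CodedRel (Q N)) : SigCodedRel (fun N x X => P N x X ∧ Q N x X) := by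
  intro q p B A D E
  have h1 := hP q (p + 1 + 1) B.succ.succ 1 (fun i => (D i).succ.succ) (fun j => (E j).succ.succ)
  have h2 := hQ q (p + 1 + 1) B.succ.succ 0 (fun i => (D i).succ.succ) (fun j => (E j).succ.succ)
  have h3 : Sig0.Uniform (n := 0) (fun (e : Env.{u} q (p + 1 + 1)) _ =>
    ∀ u, u < len (e.X B.succ.succ) → (u ∈ e.X A.succ.succ ↔ u ∈ e.X 1 ∧ u ∈ e.X 0)) :=
    inferInstance
  refine ((h1.and h2).and (.of_sig0 h3)).exS.exS.congr fun e => ?_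
  constructor
  · intro H
    obtain ⟨C, hC⟩ := hP' e.toExpansion (len (e.X B)) (fun i => e.X (D i)) (fun j => e.X (E j))
    obtain ⟨C', hC'⟩ := hQ' e.toExpansion (len (e.X B)) (fun i => e.X (D i)) (fun j => e.X (E j))
    exact ⟨C, C', ⟨hC, hC'⟩, fun u hu =>
      (H u hu).trans (and_congr (hC u hu).symm (hC' u hu).symm)⟩
  · rintro ⟨C, C', ⟨hC, hC'⟩, H⟩ u hu
    exact (H u hu).trans (and_congr (hC u hu) (hC' u hu))

theorem SigCodedRel.or (hP : SigCodedRel P) (hQ : SigCodedRel Q) (hP' : ∀ N, CodedRel (P N))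
    (hQ' : ∀ N, CodedRel (Q N)) : SigCodedRel (fun N x X => P N x X ∨ Q N x X) := by
  have h := ((hP.not hP').and (hQ.not hQ') (fun N => (hP' N).not) (fun N => (hQ' N).not)).not
    fun N => ((hP' N).not.and (hQ' N).not)
  have e : (fun N x X => P N x X ∨ Q N x X) = fun N x X => ¬ (¬ P N x X ∧ ¬ Q N x X) := by
    funext N x X; exact propext or_iff_not_and_not
  rw [e]; exact h

section Atomic

variable {f g : ∀ N : Expansion.{u}, (Fin k → N.M.U .num) → (Fin l → N.M.U .str) → N.M.U s}
  {f' : ∀ N : Expansion.{u}, (Fin k → N.M.U .num) → (Fin l → N.M.U .str) → N.M.U .num}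

/-- A relation between the values of two functions, if it is defined by a `Σ₀ᴮ` formula in terms
of the arrays of values. -/
theorem SigCodedRel.of_sigCoded {s' : Srt}
    {g : ∀ N : Expansion.{u}, (Fin k → N.M.U .num) → (Fin l → N.M.U .str) → N.M.U s'}
    (hf : SigCoded f) (hg : SigCoded g) (hf' : ∀ N, Coded (f N)) (hg' : ∀ N, Coded (g N))
    (R : ∀ N : Expansion.{u}, N.M.U s → N.M.U s' → Prop)
    (hR : ∀ q p (V W : Fin p), Sig0.Uniform (fun (e : Env.{u} q p) (v : Fin 1 → _) =>
      R e.toExpansion (row s (e.X V) (v 0)) (row s' (e.X W) (v 0)))) :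
    SigCodedRel (fun N x X => R N (f N x X) (g N x X)) := by
  intro q p B A D E
  have h1 := hf q (p + 1 + 1) B.succ.succ 1 (fun i => (D i).succ.succ) (fun j => (E j).succ.succ)
  have h2 := hg q (p + 1 + 1) B.succ.succ 0 (fun i => (D i).succ.succ) (fun j => (E j).succ.succ)
  have hR1 := hR q (p + 1 + 1) 1 0
  have h3 : Sig0.Uniform (n := 0) (fun (e : Env.{u} q (p + 1 + 1)) _ =>
    ∀ u, u < len (e.X B.succ.succ) → (u ∈ e.X A.succ.succ ↔
      R e.toExpansion (row s (e.X 1) u) (row s' (e.X 0) u))) := inferInstance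
  refine ((h1.and h2).and (.of_sig0 h3)).exS.exS.congr fun e => ?_
  constructor
  · intro H
    obtain ⟨V, hV⟩ := hf' e.toExpansion (len (e.X B)) (fun i => e.X (D i)) (fun j => e.X (E j))
    obtain ⟨W, hW⟩ := hg' e.toExpansion (len (e.X B)) (fun i => e.X (D i)) (fun j => e.X (E j))
    exact ⟨V, W, ⟨hV, hW⟩, fun u hu => (H u hu).trans (iff_of_eq
      (congrArg₂ (R e.toExpansion) (hV u hu) (hW u hu)).symm)⟩
  · rintro ⟨V, W, ⟨hV, hW⟩, H⟩ u hu
    exact (H u hu).trans (iff_of_eq (congrArg₂ (R e.toExpansion) (hV u hu) (hW u hu)))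

end Atomic

theorem SigCodedRel.eq {f g : ∀ N : Expansion.{u}, (Fin k → N.M.U .num) →
    (Fin l → N.M.U .str) → N.M.U s} (hf : SigCoded f) (hg : SigCoded g)
    (hf' : ∀ N, Coded (f N)) (hg' : ∀ N, Coded (g N)) :
    SigCodedRel (fun N x X => f N x X = g N x X) := by
  refine .of_sigCoded hf hg hf' hg' (fun _ a b => a = b) fun q p V W => ?_
  cases s
  · exact inferInstanceAs (Sig0.Uniform (fun (e : Env.{u} q p) (v : Fin 1 → _) =>
      rowN (e.X V) (v 0) = rowN (e.X W) (v 0)))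
  · exact inferInstanceAs (Sig0.Uniform (fun (e : Env.{u} q p) (v : Fin 1 → _) =>
      rowS (e.X V) (v 0) = rowS (e.X W) (v 0)))

theorem SigCodedRel.le {f g : ∀ N : Expansion.{u}, (Fin k → N.M.U .num) →
    (Fin l → N.M.U .str) → N.M.U .num} (hf : SigCoded f) (hg : SigCoded g)
    (hf' : ∀ N, Coded (f N)) (hg' : ∀ N, Coded (g N)) :
    SigCodedRel (fun N x X => f N x X ≤ g N x X) :=
  .of_sigCoded hf hg hf' hg' (fun _ a b => a ≤ b) fun q p V W =>
    inferInstanceAs (Sig0.Uniform (fun (e : Env.{u} q p) (v : Fin 1 → _) =>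
      rowN (e.X V) (v 0) ≤ rowN (e.X W) (v 0)))

theorem SigCodedRel.mem {f : ∀ N : Expansion.{u}, (Fin k → N.M.U .num) →
    (Fin l → N.M.U .str) → N.M.U .num} {g : ∀ N : Expansion.{u}, (Fin k → N.M.U .num) →
    (Fin l → N.M.U .str) → N.M.U .str} (hf : SigCoded f) (hg : SigCoded g)
    (hf' : ∀ N, Coded (f N)) (hg' : ∀ N, Coded (g N)) :
    SigCodedRel (fun N x X => f N x X ∈ g N x X) :=
  .of_sigCoded hf hg hf' hg' (fun _ a b => a ∈ b) fun q p V W =>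
    inferInstanceAs (Sig0.Uniform (fun (e : Env.{u} q p) (v : Fin 1 → _) =>
      rowN (e.X V) (v 0) ∈ rowS (e.X W) (v 0)))

end Relations

end Uniform

/-! ### The graphs of the function symbols -/

section Uniform

variable {k l : ℕ} {s : Srt}

theorem sigF_vars_term_val {q p n : ℕ} {f : ∀ e : Env.{u} q p, (Fin n → e.M.U .num) → e.M.U .num}
    [SigF Params.vars f] (D : Fin k → Fin p) (E : Fin l → Fin p) (t : Term L2A .num k l) :
    SigF (Params.vars (q := q) (p := p)) (fun e v =>
      t.val e.M (fun i => rowN (e.X (D i)) (f e v)) (fun j => rowS (e.X (E j)) (f e v))) :=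
  sigF_term_val (S := fun e : Env.{u} q p => e.M) (D := fun i e => e.X (D i))
    (E := fun j e => e.X (E j)) t

section Pairs

variable {P : ∀ N : Expansion.{u}, (Fin (k + 1) → N.M.U .num) → (Fin l → N.M.U .str) → Prop}

/-- The analogue of `CodedRel.exists_pairs`, in which the additional argument `z` runs through the
numbers below the value of a term. The `Σ¹₁` relation `R` says that the set, which is the last
string of the assignment, arises from arrays that are indexed by pairs. -/
theorem SigCodedRel.exists_pairs (hP : SigCodedRel P) (hP' : ∀ N, CodedRel (P N))
    (t : Term L2A .num k l) {q p : ℕ} (B : Fin p) (D : Fin k → Fin p) (E : Fin l → Fin p) :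
    ∃ R : Env.{u} q (p + 1) → Prop, Sig11 R ∧ (∀ e : Env.{u} q p, ∃ A, R (e.consS A)) ∧
      ∀ e : Env.{u} q p, ∀ A, R (e.consS A) → ∀ u, u < len (e.X B) → ∀ z,
        z < t.val e.M (fun i => rowN (e.X (D i)) u) (fun j => rowS (e.X (E j)) u) →
        (pr u z ∈ A ↔ P e.toExpansion (Fin.cons z fun i => rowN (e.X (D i)) u)
          (fun j => rowS (e.X (E j)) u)) := by
  have ht := sigF_vars_term_val (q := q) (p := p + 1 + 1 + 1 + k + l) (n := 1) (f := fun _ v => v 0)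
    (fun i => castAddIndex l (castAddIndex k (D i).succ.succ.succ))
    (fun i => castAddIndex l (castAddIndex k (E i).succ.succ.succ)) t
  have h1 : Sig0.Uniform (n := 0) (fun (e : Env.{u} q (p + 1 + 1 + 1 + k + l)) _ =>
      ∀ u, u < len (e.X (castAddIndex l (castAddIndex k B.succ.succ.succ))) →
      pr u (t.val e.M (fun i => rowN (e.X (castAddIndex l (castAddIndex k (D i).succ.succ.succ))) u)
        (fun j => rowS (e.X (castAddIndex l (castAddIndex k (E j).succ.succ.succ))) u)) ≤
      len (e.X (castAddIndex l (castAddIndex k 1)))) := inferInstance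
  have h2 : Sig0.Uniform (n := 0) (fun (e : Env.{u} q (p + 1 + 1 + 1 + k + l)) _ =>
      PullSnd (len (e.X (castAddIndex l (castAddIndex k 1))))
        (e.X (castAddIndex l (castAddIndex k 0)))) := by
    unfold PullSnd; infer_instance
  have h3 : ∀ i, Sig0.Uniform (n := 0) (fun (e : Env.{u} q (p + 1 + 1 + 1 + k + l)) _ =>
      PullFst (len (e.X (castAddIndex l (castAddIndex k 1))))
        (e.X (castAddIndex l (castAddIndex k (D i).succ.succ.succ)))
        (e.X (castAddIndex l (natAddIndex (p + 1 + 1 + 1) i)))) := by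
    unfold PullFst; infer_instance
  have h4 : ∀ j, Sig0.Uniform (n := 0) (fun (e : Env.{u} q (p + 1 + 1 + 1 + k + l)) _ =>
      PullFst (len (e.X (castAddIndex l (castAddIndex k 1))))
        (e.X (castAddIndex l (castAddIndex k (E j).succ.succ.succ)))
        (e.X (natAddIndex (p + 1 + 1 + 1 + k) j))) := by
    unfold PullFst; infer_instance
  have h5 := hP q (p + 1 + 1 + 1 + k + l) (castAddIndex l (castAddIndex k 1))
    (castAddIndex l (castAddIndex k 2))
    (Fin.cons (castAddIndex l (castAddIndex k 0)) fun i => castAddIndex l (natAddIndex _ i))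
    (fun j => natAddIndex _ j)
  refine ⟨_, (((((Sig11.of_sig0 h1).and (.of_sig0 h2)).and ((Sig11.forall_fin fun i =>
    .of_sig0 (h3 i)).and (.forall_fin fun j => .of_sig0 (h4 j)))).and h5).exSs.exSs.exS.exS),
    fun e => ?_, fun e A => ?_⟩
  · have ht' : SigF.Local e.M (fun v : Fin 1 → _ =>
      t.val e.M (fun i => rowN (e.X (D i)) (v 0)) (fun j => rowS (e.X (E j)) (v 0))) :=
      sigF_term_val (D := fun i _ => e.X (D i)) (E := fun j _ => e.X (E j)) t
    obtain ⟨c, hc⟩ := ht'.exists_bound (f := fun u =>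
      t.val e.M (fun i => rowN (e.X (D i)) u) (fun j => rowS (e.X (E j)) u)) (len (e.X B))
    obtain ⟨B', hB'⟩ := exists_str (fun z : e.M.U .num => z = z) (pr (len (e.X B)) c)
    have hlen : len B' = pr (len (e.X B)) c := len_eq_of_mem_iff_lt fun z => by simp [hB']
    obtain ⟨Z, hZ⟩ := exists_pullSnd (len B')
    choose D' hD' using fun i => exists_pullFst (len B') (e.X (D i))
    choose E' hE' using fun j => exists_pullFst (len B') (e.X (E j))
    obtain ⟨A, hA⟩ := hP' e.toExpansion (len B') (Fin.cons Z D') E'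
    refine ⟨A, B', Z, D', E', ?_⟩
    simp only [extend_castAddIndex, extend_natAddIndex]
    refine ⟨⟨⟨fun u hu => ?_, hZ⟩, hD', hE'⟩, fun v hv => (hA v hv).trans ?_⟩
    · exact (pr_le_pr hu.le (hc u hu.le)).trans hlen.ge
    · refine iff_of_eq (congrArg (fun x => P e.toExpansion x fun j => rowS (E' j) v) ?_)
      funext i
      refine Fin.cases ?_ (fun i => ?_) i <;>
        simp only [Fin.cons_zero, Fin.cons_succ, extend_castAddIndex, extend_natAddIndex]
  · rintro ⟨B', Z, D', E', ⟨⟨h1, h2⟩, h3, h4⟩, h5⟩ u hu z hz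
    simp only [extend_castAddIndex, extend_natAddIndex] at h1 h2 h3 h4 h5
    have hb : pr u z < len B' := (pr_lt_pr (add_lt_add_right hz u)).trans_le (h1 u hu)
    refine (h5 _ hb).trans (iff_of_eq (congrArg₂ (P e.toExpansion) ?_ ?_))
    · funext i
      refine Fin.cases ?_ (fun i => ?_) i
      · simp only [Fin.cons_zero, extend_castAddIndex]
        exact h2.rowN hb
      · simp only [Fin.cons_succ, extend_castAddIndex, extend_natAddIndex]
        exact (h3 i).rowN hb
    · exact funext fun j => (h4 j).rowS hb

variable {t : Term L2A .num k l}

theorem SigCoded.of_isStrFn {g : ∀ N : Expansion.{u}, (Fin k → N.M.U .num) →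
    (Fin l → N.M.U .str) → N.M.U .str} (hg : ∀ N, IsStrFn (P N) t (g N)) (hP : SigCodedRel P)
    (hP' : ∀ N, CodedRel (P N)) : SigCoded g := by
  intro q p B W D E
  obtain ⟨R, hR, hR', H⟩ := hP.exists_pairs hP' t (q := q) B D E
  have ht := sigF_vars_term_val (q := q) (p := p + 1) (n := 1) (f := fun _ v => v 0)
    (fun i => (D i).succ) (fun j => (E j).succ) t
  have ht' := sigF_vars_term_val (q := q) (p := p + 1) (n := 2)
    (f := fun (_ : Env.{u} q (p + 1)) v => v 1)
    (fun i => (D i).succ) (fun j => (E j).succ) t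
  have h : Sig0.Uniform (n := 0) (fun (e : Env.{u} q (p + 1)) _ => ∀ u, u < len (e.X B.succ) →
      ∀ z, z < len (e.X W.succ) +
          t.val e.M (fun i => rowN (e.X (D i).succ) u) (fun j => rowS (e.X (E j).succ) u) →
        (pr u z ∈ e.X W.succ ↔
          z < t.val e.M (fun i => rowN (e.X (D i).succ) u) (fun j => rowS (e.X (E j).succ) u) ∧
            pr u z ∈ e.X 0)) := inferInstance
  refine (hR.and (.of_sig0 h)).exS.congr fun e => ⟨fun h1 => ?_, ?_⟩
  · obtain ⟨A, hA⟩ := hR' e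
    refine ⟨A, hA, fun u hu z _ => ?_⟩
    change pr u z ∈ e.X W ↔ _
    rw [← mem_rowS]
    refine (iff_of_eq (congrArg (z ∈ ·) (h1 u hu))).trans ((hg _ _ _ z).trans ?_)
    exact and_congr_right fun hz => (H e A hA u hu z hz).symm
  · rintro ⟨A, hA, h1⟩ u hu
    refine str_ext fun z => ((?_ : z ∈ rowS (e.X W) u ↔ _).trans (hg _ _ _ z).symm)
    rw [mem_rowS]
    refine Iff.trans ⟨fun h => (h1 u hu z ?_).1 h, fun h => (h1 u hu z ?_).2 h⟩
      (and_congr_right fun hz => H e A hA u hu z hz)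
    · exact ((right_le_pr u z).trans_lt (lt_len_of_mem h)).trans_le le_self_add
    · exact h.1.trans_le le_add_self

theorem SigCoded.of_isNumFn {g : ∀ N : Expansion.{u}, (Fin k → N.M.U .num) →
    (Fin l → N.M.U .str) → N.M.U .num} (hg : ∀ N, IsNumFn (P N) t (g N)) (hP : SigCodedRel P)
    (hP' : ∀ N, CodedRel (P N)) : SigCoded g := by
  intro q p B W D E
  obtain ⟨R, hR, hR', H⟩ := hP.exists_pairs hP' t (q := q) B D E
  have ht := sigF_vars_term_val (q := q) (p := p + 1) (n := 1) (f := fun _ v => v 0)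
    (fun i => (D i).succ) (fun j => (E j).succ) t
  have h : Sig0.Uniform (n := 0) (fun (e : Env.{u} q (p + 1)) _ => ∀ u, u < len (e.X B.succ) →
      rowN (e.X W.succ) u ≤
        t.val e.M (fun i => rowN (e.X (D i).succ) u) (fun j => rowS (e.X (E j).succ) u) ∧
      (rowN (e.X W.succ) u <
        t.val e.M (fun i => rowN (e.X (D i).succ) u) (fun j => rowS (e.X (E j).succ) u) →
        pr u (rowN (e.X W.succ) u) ∈ e.X 0) ∧
      ∀ z, z < rowN (e.X W.succ) u → ¬ pr u z ∈ e.X 0) := inferInstance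
  refine (hR.and (.of_sig0 h)).exS.congr fun e => ?_
  have key : ∀ A, R (e.consS A) → ∀ u, u < len (e.X B) →
      (rowN (e.X W) u = g e.toExpansion (fun i => rowN (e.X (D i)) u)
        (fun j => rowS (e.X (E j)) u) ↔ rowN (e.X W) u ≤
        t.val e.M (fun i => rowN (e.X (D i)) u) (fun j => rowS (e.X (E j)) u) ∧
      (rowN (e.X W) u <
        t.val e.M (fun i => rowN (e.X (D i)) u) (fun j => rowS (e.X (E j)) u) →
        pr u (rowN (e.X W) u) ∈ A) ∧
      ∀ z, z < rowN (e.X W) u → ¬ pr u z ∈ A) := by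
    intro A hA u hu
    obtain ⟨h1, h2, h3⟩ := hg e.toExpansion (fun i => rowN (e.X (D i)) u)
      (fun j => rowS (e.X (E j)) u)
    exact eq_iff_of_isMin (P := fun z => pr u z ∈ A) h1
      (fun h => (H e A hA u hu _ h).2 (h2 h))
      (fun z hz => (H e A hA u hu _ (hz.trans_le h1)).not.2 (h3 z hz)) _
  constructor
  · intro h1
    obtain ⟨A, hA⟩ := hR' e
    exact ⟨A, hA, fun u hu => (key A hA u hu).1 (h1 u hu)⟩
  · rintro ⟨A, hA, h1⟩ u hu
    exact (key A hA u hu).2 (h1 u hu)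

end Pairs

section Symbols

theorem Expansion.coded (N : Expansion.{u}) (f : LFTC0 s k l) : Coded (N.I f) :=
  coded_of_symSpec N.spec f

theorem Term.All.of_forall {V : Vocabulary} {P : ∀ {s : Srt} {k l : ℕ}, V s k l → Prop}
    (h : ∀ {s : Srt} {k l : ℕ} (f : V s k l), P f) {s : Srt} {n m : ℕ} (t : Term V s n m) :
    t.All P := by
  induction t with
  | nvar | svar => trivial
  | app f xs Xs ih1 ih2 => exact ⟨h f, ih1, ih2⟩

theorem Formula.All.of_forall {V : Vocabulary} {P : ∀ {s : Srt} {k l : ℕ}, V s k l → Prop}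
    (h : ∀ {s : Srt} {k l : ℕ} (f : V s k l), P f) {q : Bool} {n m : ℕ} (φ : Formula V q n m) :
    φ.All P := by
  induction φ with
  | tru | fls => trivial
  | eq t u | le t u | mem t u => exact ⟨.of_forall h t, .of_forall h u⟩
  | not _ ih | exN _ ih | allN _ ih | exS _ ih | allS _ ih => exact ih
  | and _ _ ih1 ih2 | or _ _ ih1 ih2 => exact ⟨ih1, ih2⟩

theorem Expansion.coded_tval (N : Expansion.{u}) (t : Term LFTC0 s k l) : Coded (tval N.I t) :=
  TwoSorted.coded_tval t (.of_forall (fun f => N.coded f) t)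

theorem Expansion.codedRel_holds (N : Expansion.{u}) (α : OpenFormula LFTC0 k l) :
    CodedRel (holds N.I α) :=
  TwoSorted.codedRel_holds α (.of_forall (fun f => N.coded f) α)

theorem sigCoded_tval {n m : ℕ} (t : Term LFTC0 s n m)
    (h : t.All (fun f => SigCoded.{u} (fun N => N.I f))) :
    SigCoded.{u} (fun N => tval N.I t) := by
  induction t with
  | nvar i =>
    exact .of_sig0 fun q p W D E => inferInstanceAs (Sig0.Uniform
      (fun (e : Env.{u} q p) (v : Fin 1 → _) => rowN (e.X W) (v 0) = rowN (e.X (D i)) (v 0)))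
  | svar i =>
    exact .of_sig0 fun q p W D E => inferInstanceAs (Sig0.Uniform
      (fun (e : Env.{u} q p) (v : Fin 1 → _) => rowS (e.X W) (v 0) = rowS (e.X (E i)) (v 0)))
  | app f xs Xs ih1 ih2 =>
    exact h.1.comp (fun i => ih1 i (h.2.1 i)) (fun i => ih2 i (h.2.2 i))
      (fun i N => N.coded_tval (xs i)) (fun i N => N.coded_tval (Xs i))

theorem sigCodedRel_holds {n m : ℕ} : ∀ α : OpenFormula LFTC0 n m,
    α.All (fun f => SigCoded.{u} (fun N => N.I f)) → SigCodedRel.{u} (fun N => holds N.I α)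
  | .tru, _ => .const True
  | .fls, _ => .const False
  | .eq t u, h => .eq (sigCoded_tval t h.1) (sigCoded_tval u h.2) (fun N => N.coded_tval t)
      (fun N => N.coded_tval u)
  | .le t u, h => .le (sigCoded_tval t h.1) (sigCoded_tval u h.2) (fun N => N.coded_tval t)
      (fun N => N.coded_tval u)
  | .mem t T, h => .mem (sigCoded_tval t h.1) (sigCoded_tval T h.2) (fun N => N.coded_tval t)
      (fun N => N.coded_tval T)
  | .not φ, h => (sigCodedRel_holds φ h).not (fun N => N.codedRel_holds φ)
  | .and φ ψ, h => (sigCodedRel_holds φ h.1).and (sigCodedRel_holds ψ h.2)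
      (fun N => N.codedRel_holds φ) (fun N => N.codedRel_holds ψ)
  | .or φ ψ, h => (sigCodedRel_holds φ h.1).or (sigCodedRel_holds ψ h.2)
      (fun N => N.codedRel_holds φ) (fun N => N.codedRel_holds ψ)

/-- The action of every function symbol on arrays is `Σ¹₁` definable, uniformly in all models. -/
theorem sigCoded (f : LFTC0 s k l) : SigCoded.{u} (fun N => N.I f) :=
  LFTC0.induction (P := fun f => SigCoded.{u} (fun N => N.I f))
    (fun f => by
      have h := sigCoded_base.{u} f
      have e : (fun (N : Expansion.{u}) x X => N.M.fn f x X) = fun N => N.I (.base f) := by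
        funext N x X; exact (N.spec (.base f) x X).symm
      rwa [e] at h)
    sigCoded_pd sigCoded_fSE sigCoded_numones
    (fun α t hα => .of_isStrFn (fun N => N.spec (.strFn α t)) (sigCodedRel_holds α hα)
      fun N => N.codedRel_holds α)
    (fun α t hα => .of_isNumFn (fun N => N.spec (.numFn α t)) (sigCodedRel_holds α hα)
      fun N => N.codedRel_holds α) f

theorem exists_rowN_zero_eq {M : Struct.{u} L2A} [IsV0 M] (a : M.U .num) :
    ∃ D : M.U .str, rowN D 0 = a := by
  obtain ⟨D, hD⟩ := exists_array_num (fun _ => a) 1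
  exact ⟨D, hD 0 zero_lt_one⟩

theorem exists_rowS_zero_eq {M : Struct.{u} L2A} [IsV0 M] (A : M.U .str) :
    ∃ E : M.U .str, rowS E 0 = A := by
  obtain ⟨E, hE⟩ := exists_array (fun _ z => z ∈ A) 1 (len A)
  exact ⟨E, str_ext fun z => (hE 0 zero_lt_one z).trans
    ⟨And.right, fun h => ⟨lt_len_of_mem h, h⟩⟩⟩

theorem eq_zero_of_lt_one {M : Struct.{u} L2A} [IsV0 M] {a : M.U .num} (h : a < 1) : a = 0 := by
  rw [← zero_add 1, lt_add_one_iff'] at h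
  exact le_antisymm h (IsBasic.b8 a)

theorem rowS_zero_eq_iff {M : Struct.{u} L2A} [IsV0 M] {E A : M.U .str} :
    rowS E 0 = A ↔ ∀ z, z < len E + len A → (pr 0 z ∈ E ↔ z ∈ A) := by
  constructor
  · rintro rfl z _; exact mem_rowS.symm
  · refine fun h => str_ext fun z => ?_
    rw [mem_rowS]
    exact ⟨fun hz => (h z (((right_le_pr _ _).trans_lt (lt_len_of_mem hz)).trans_le
      le_self_add)).1 hz, fun hz => (h z ((lt_len_of_mem hz).trans_le le_add_self)).2 hz⟩

/-- The graph of a function symbol is `Σ¹₁` definable, uniformly in all models: the arguments and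
the value are the entries of index `0` of arrays. -/
theorem sig11_row_eq (f : LFTC0 s k l) {q p : ℕ} (W : Fin p) (a : Fin k → Fin q)
    (b : Fin l → Fin p) : Sig11 (fun e : Env.{u} q p =>
      row s (e.X W) 0 = e.I f (fun i => e.x (a i)) (fun j => e.X (b j))) := by
  have h1 : Sig0.Uniform (n := 0) (fun (e : Env.{u} q (p + 1 + k + l)) _ =>
    len (e.X (castAddIndex l (castAddIndex k 0))) = 1) := inferInstance
  have h2 : ∀ i, Sig0.Uniform (n := 0) (fun (e : Env.{u} q (p + 1 + k + l)) _ =>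
    rowN (e.X (castAddIndex l (natAddIndex (p + 1) i))) 0 = e.x (a i)) := inferInstance
  have h3 : ∀ j, Sig0.Uniform (n := 0) (fun (e : Env.{u} q (p + 1 + k + l)) _ =>
    rowS (e.X (natAddIndex (p + 1 + k) j)) 0 =
      e.X (castAddIndex l (castAddIndex k (b j).succ))) := by
    simp only [rowS_zero_eq_iff]; infer_instance
  have h4 := sigCoded.{u} f q (p + 1 + k + l) (castAddIndex l (castAddIndex k 0))
    (castAddIndex l (castAddIndex k W.succ)) (fun i => castAddIndex l (natAddIndex (p + 1) i))
    (fun j => natAddIndex (p + 1 + k) j)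
  refine (((Sig11.of_sig0 h1).and ((Sig11.forall_fin fun i => .of_sig0 (h2 i)).and
    (.forall_fin fun j => .of_sig0 (h3 j)))).and h4).exSs.exSs.exS.congr fun e => ?_
  simp only [extend_castAddIndex, extend_natAddIndex, Fin.cons_zero, Fin.cons_succ]
  constructor
  · intro h
    obtain ⟨B, hB⟩ := exists_str (fun z : e.M.U .num => z = z) 1
    have hlen : len B = 1 := len_eq_of_mem_iff_lt fun z => by simp [hB]
    choose D hD using fun i => exists_rowN_zero_eq (e.x (a i))
    choose E hE using fun j => exists_rowS_zero_eq (e.X (b j))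
    refine ⟨B, D, E, ⟨hlen, hD, hE⟩, fun u hu => ?_⟩
    obtain rfl := eq_zero_of_lt_one (hu.trans_eq hlen)
    rw [h, funext hD, funext hE]
  · rintro ⟨B, D, E, ⟨hlen, hD, hE⟩, h⟩
    rw [h 0 (hlen ▸ zero_lt_one)]
    simp only [hD, hE]

/-- A `Σ¹₁` formula that defines the graph of a string function symbol in all models. -/
theorem exists_graph_str (F : LFTC0 .str k l) : ∃ φ : Formula L2A true k (l + 1), φ.IsSigma11 ∧
    ∀ (N : Expansion.{u}) (x : Fin k → N.M.U .num) (X : Fin l → N.M.U .str) (Y : N.M.U .str),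
      φ.Holds N.M x (Fin.cons Y X) ↔ Y = N.I F x X := by
  have h1 : Sig0.Uniform (n := 0)
      (fun (e : Env.{u} k (l + 1 + 1)) _ => rowS (e.X 0) 0 = e.X 1) := by
    simp only [rowS_zero_eq_iff]; infer_instance
  obtain ⟨φ, hφ, H⟩ := ((Sig11.of_sig0 h1).and
    (sig11_row_eq F 0 (fun i => i) (fun j => j.succ.succ))).exS
  refine ⟨φ, hφ, fun N x X Y => (H ⟨N, x, Fin.cons Y X⟩).trans ⟨?_, fun h => ?_⟩⟩
  · rintro ⟨W, h1, h2⟩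
    exact h1.symm.trans h2
  · obtain ⟨W, hW⟩ := exists_rowS_zero_eq Y
    exact ⟨W, hW, hW.trans h⟩

/-- A `Σ¹₁` formula that defines the graph of a number function symbol in all models. -/
theorem exists_graph_num (f : LFTC0 .num k l) : ∃ φ : Formula L2A true (k + 1) l, φ.IsSigma11 ∧
    ∀ (N : Expansion.{u}) (x : Fin k → N.M.U .num) (X : Fin l → N.M.U .str) (y : N.M.U .num),
      φ.Holds N.M (Fin.cons y x) X ↔ y = N.I f x X := by
  have h1 : Sig0.Uniform (n := 0) (fun (e : Env.{u} (k + 1) (l + 1)) _ => rowN (e.X 0) 0 = e.x 0) :=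
    inferInstance
  obtain ⟨φ, hφ, H⟩ := ((Sig11.of_sig0 h1).and
    (sig11_row_eq f 0 (fun i => i.succ) (fun j => j.succ))).exS
  refine ⟨φ, hφ, fun N x X y => (H ⟨N, Fin.cons y x, X⟩).trans ⟨?_, fun h => ?_⟩⟩
  · rintro ⟨W, h1, h2⟩
    exact h1.symm.trans h2
  · obtain ⟨W, hW⟩ := exists_rowN_zero_eq y
    exact ⟨W, hW, hW.trans h⟩

end Symbols

end Uniform

/-! ### The standard structure -/

/-- The standard structure for `L_FTC⁰`, in any universe. -/
noncomputable def stdLFTC0 : Struct.{u} LFTC0 where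
  U s := ULift.{u} s.Std
  nonempty s := (stdL2A.nonempty s).map ULift.up
  fn f x X := ⟨f.std (fun i => (x i).down) (fun j => (X j).down)⟩
  le a b := (show ℕ from a.down) ≤ (show ℕ from b.down)
  mem a A := (show ℕ from a.down) ∈ (show Finset ℕ from A.down)

section Std

theorem down_val {s : Srt} {n m : ℕ} (t : Term LFTC0 s n m) (x : Fin n → ULift.{u} ℕ)
    (X : Fin m → ULift.{u} (Finset ℕ)) :
    (t.val stdLFTC0.{u} x X : ULift.{u} s.Std).down =
      t.stdVal (fun i => (x i).down) (fun j => (X j).down) := by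
  induction t with
  | nvar i => simp only [Term.stdVal]; rfl
  | svar i => simp only [Term.stdVal]; rfl
  | app f xs Xs ih1 ih2 => simp only [Term.stdVal, ← ih1, ← ih2]; rfl

theorem holds_stdLFTC0 {n m : ℕ} (x : Fin n → ULift.{u} ℕ) (X : Fin m → ULift.{u} (Finset ℕ)) :
    ∀ α : OpenFormula LFTC0 n m, α.Holds stdLFTC0.{u} x X ↔
      α.stdHolds (fun i => (x i).down) (fun j => (X j).down)
  | .tru => by simp only [Formula.stdHolds]; rfl
  | .fls => by simp only [Formula.stdHolds]; rfl
  | .eq t u => by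
      simp only [Formula.stdHolds, ← down_val]
      exact ULift.down_inj.symm
  | .le t u => by simp only [Formula.stdHolds, ← down_val]; rfl
  | .mem t u => by simp only [Formula.stdHolds, ← down_val]; rfl
  | .not φ => by simp only [Formula.stdHolds, ← holds_stdLFTC0 x X φ]; rfl
  | .and φ ψ => by simp only [Formula.stdHolds, ← holds_stdLFTC0 x X φ, ← holds_stdLFTC0 x X ψ]; rfl
  | .or φ ψ => by simp only [Formula.stdHolds, ← holds_stdLFTC0 x X φ, ← holds_stdLFTC0 x X ψ]; rfl

theorem LFTC0.std_base {s : Srt} {k l : ℕ} (f : L2A s k l) (x : Fin k → ℕ)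
    (X : Fin l → Finset ℕ) : LFTC0.std (.base f) x X = f.std x X := by
  simp only [LFTC0.std]

theorem LFTC0.std_pd (x : Fin 1 → ℕ) (X : Fin 0 → Finset ℕ) : LFTC0.std .pd x X = x 0 - 1 := by
  simp only [LFTC0.std]

theorem LFTC0.std_fSE (x : Fin 0 → ℕ) (X : Fin 2 → Finset ℕ) : LFTC0.std .fSE x X =
    sInf {z : ℕ | ¬ (z ∈ X 0 ↔ z ∈ X 1) ∨ z = (X 0).sup (fun i => i + 1)} := by
  simp only [LFTC0.std]

theorem LFTC0.std_numones (x : Fin 1 → ℕ) (X : Fin 1 → Finset ℕ) :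
    LFTC0.std .numones x X = ((X 0).filter (fun i => i < x 0)).card := by
  simp only [LFTC0.std]

open Classical in
theorem LFTC0.std_strFn {n m : ℕ} (α : OpenFormula LFTC0 (n + 1) m) (t : Term L2A .num n m)
    (x : Fin n → ℕ) (X : Fin m → Finset ℕ) : LFTC0.std (.strFn α t) x X =
      (Finset.range (t.val stdL2A x X)).filter (fun z => α.stdHolds (Fin.cons z x) X) := by
  simp only [LFTC0.std]

theorem LFTC0.std_numFn {n m : ℕ} (α : OpenFormula LFTC0 (n + 1) m) (t : Term L2A .num n m)
    (x : Fin n → ℕ) (X : Fin m → Finset ℕ) : LFTC0.std (.numFn α t) x X =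
      sInf {z : ℕ | α.stdHolds (Fin.cons z x) X ∨ z = t.val stdL2A x X} := by
  simp only [LFTC0.std]

theorem down_val_L2A {s : Srt} {n m : ℕ} (t : Term L2A s n m) (x : Fin n → ULift.{u} ℕ)
    (X : Fin m → ULift.{u} (Finset ℕ)) :
    (t.val stdLFTC0.{u}.reduct x X : ULift.{u} s.Std).down =
      t.val stdL2A (fun i => (x i).down) (fun j => (X j).down) := by
  induction t with
  | nvar i => rfl
  | svar i => rfl
  | app f xs Xs ih1 ih2 =>
    have h1 : (fun i => (xs i).val stdL2A (fun i => (x i).down) (fun j => (X j).down)) = _ :=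
      funext fun i => (ih1 i x X).symm
    have h2 : (fun i => (Xs i).val stdL2A (fun i => (x i).down) (fun j => (X j).down)) = _ :=
      funext fun i => (ih2 i x X).symm
    simp only [Term.val]
    rw [h1, h2]
    exact LFTC0.std_base f _ _

theorem down_cons {α : Type*} {n : ℕ} (a : ULift.{u} α) (x : Fin n → ULift.{u} α) :
    (fun i => ((Fin.cons a x : Fin (n + 1) → ULift.{u} α) i).down) =
      Fin.cons a.down fun i => (x i).down :=
  fun_cons_eq rfl fun _ => rfl

theorem holds_reduct_stdLFTC0 {q : Bool} {n m : ℕ} (φ : Formula L2A q n m) :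
    ∀ (x : Fin n → ULift.{u} ℕ) (X : Fin m → ULift.{u} (Finset ℕ)),
      φ.Holds stdLFTC0.{u}.reduct x X ↔
      φ.Holds stdL2A (fun i => (x i).down) (fun j => (X j).down) := by
  induction φ with
  | tru => exact fun _ _ => Iff.rfl
  | fls => exact fun _ _ => Iff.rfl
  | eq t u =>
    intro x X
    simp only [Formula.holds_eq, ← down_val_L2A]
    exact ULift.down_inj.symm
  | le t u => intro x X; simp only [Formula.holds_le, ← down_val_L2A]; rfl
  | mem t u => intro x X; simp only [Formula.holds_mem, ← down_val_L2A]; rfl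
  | not φ ih => exact fun x X => not_congr (ih x X)
  | and φ ψ ih1 ih2 => exact fun x X => and_congr (ih1 x X) (ih2 x X)
  | or φ ψ ih1 ih2 => exact fun x X => or_congr (ih1 x X) (ih2 x X)
  | exN φ ih =>
    exact fun x X => Equiv.ulift.exists_congr fun a => (ih _ X).trans
      (iff_of_eq (congrArg (fun y => φ.Holds stdL2A y _) (down_cons a x)))
  | allN φ ih =>
    exact fun x X => Equiv.ulift.forall_congr fun a => (ih _ X).trans
      (iff_of_eq (congrArg (fun y => φ.Holds stdL2A y _) (down_cons a x)))
  | exS φ ih =>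
    exact fun x X => Equiv.ulift.exists_congr fun a => (ih x _).trans
      (iff_of_eq (congrArg (fun Y => φ.Holds stdL2A _ Y) (down_cons a X)))
  | allS φ ih =>
    exact fun x X => Equiv.ulift.forall_congr fun a => (ih x _).trans
      (iff_of_eq (congrArg (fun Y => φ.Holds stdL2A _ Y) (down_cons a X)))

/-- The natural number that is an element of the standard structure. -/
def toNat (a : stdLFTC0.{u}.reduct.U .num) : ℕ := ULift.down (α := ℕ) a

/-- The finite set that is an element of the standard structure. -/
def toFinset (A : stdLFTC0.{u}.reduct.U .str) : Finset ℕ := ULift.down (α := Finset ℕ) A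

variable {a b : stdLFTC0.{u}.reduct.U .num} {A B : stdLFTC0.{u}.reduct.U .str}

theorem toNat_inj : a = b ↔ toNat a = toNat b := ULift.down_inj.symm

theorem toFinset_inj : A = B ↔ toFinset A = toFinset B := ULift.down_inj.symm

theorem exists_toNat (n : ℕ) : ∃ a : stdLFTC0.{u}.reduct.U .num, toNat a = n := ⟨⟨n⟩, rfl⟩

theorem exists_toFinset (s : Finset ℕ) : ∃ A : stdLFTC0.{u}.reduct.U .str, toFinset A = s :=
  ⟨⟨s⟩, rfl⟩

@[simp] theorem toNat_zero : toNat.{u} 0 = 0 := by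
  change LFTC0.std _ _ _ = _
  exact LFTC0.std_base _ _ _

@[simp] theorem toNat_one : toNat.{u} 1 = 1 := by
  change LFTC0.std _ _ _ = _
  exact LFTC0.std_base _ _ _

@[simp] theorem toNat_add : toNat (a + b) = toNat a + toNat b := by
  change LFTC0.std _ _ _ = _
  exact LFTC0.std_base _ _ _

@[simp] theorem toNat_mul : toNat (a * b) = toNat a * toNat b := by
  change LFTC0.std _ _ _ = _
  exact LFTC0.std_base _ _ _

@[simp] theorem toNat_len : toNat (len A) = (toFinset A).sup (fun i => i + 1) := by
  change LFTC0.std _ _ _ = _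
  exact LFTC0.std_base _ _ _

theorem le_iff_toNat : a ≤ b ↔ toNat a ≤ toNat b := Iff.rfl

theorem lt_iff_toNat : a < b ↔ toNat a < toNat b := by
  rw [lt_def, le_iff_toNat, ne_eq, toNat_inj]; omega

theorem mem_iff_toNat : a ∈ A ↔ toNat a ∈ toFinset A := Iff.rfl

theorem sup_le_iff_forall_lt {s : Finset ℕ} {n : ℕ} : s.sup (fun i => i + 1) ≤ n ↔ ∀ i ∈ s, i < n :=
  Finset.sup_le_iff

open Classical in
instance : IsV0 stdLFTC0.{u}.reduct where
  b1 a := by simp [toNat_inj]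
  b2 a b := by simp [toNat_inj]
  b3 a := by simp [toNat_inj]
  b4 a b := by simp [toNat_inj, add_assoc]
  b5 a := by simp [toNat_inj]
  b6 a b := by simp [toNat_inj, mul_add]
  b7 a b := by simp only [toNat_inj, le_iff_toNat]; omega
  b8 a := by simp [le_iff_toNat]
  b9 a b c := by simp only [le_iff_toNat]; omega
  b10 a b := by simp only [le_iff_toNat]; omega
  b11 a b := by simp only [le_iff_toNat, lt_iff_toNat, toNat_add, toNat_one]; omega
  l1 a A h := by
    rw [lt_iff_toNat, toNat_len]
    exact sup_le_iff_forall_lt.1 le_rfl _ h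
  l2 a A h := by
    rw [toNat_inj, toNat_add, toNat_len, toNat_one] at h
    obtain ⟨i, hi, h'⟩ := Finset.exists_mem_eq_sup (toFinset A)
      (Finset.nonempty_iff_ne_empty.2 fun h0 => by simp [h0] at h) (fun i => i + 1)
    rw [mem_iff_toNat]
    have : toNat a = i := by omega
    rwa [this]
  b12 a ha := by
    simp only [toNat_inj, toNat_zero, ne_eq] at ha
    obtain ⟨b, hb⟩ := exists_toNat.{u} (toNat a - 1)
    refine ⟨b, ?_, ?_⟩
    · rw [lt_iff_toNat]; omega
    · rw [toNat_inj, toNat_add, toNat_one]; omega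
  se A B := by
    refine ⟨fun h => ⟨by rw [h], fun _ _ => by rw [h]⟩, fun ⟨h1, h2⟩ => ?_⟩
    have hlt : ∀ {C : stdLFTC0.{u}.reduct.U .str} {i : ℕ}, i ∈ toFinset C →
      i < toNat (len C) := fun {C i} h => by
        rw [toNat_len]; exact sup_le_iff_forall_lt.1 le_rfl i h
    rw [toFinset_inj]
    ext i
    obtain ⟨z, rfl⟩ := exists_toNat.{u} i
    exact ⟨fun h => (h2 z (lt_iff_toNat.2 (hlt h))).1 h,
      fun h => (h2 z (lt_iff_toNat.2 (h1 ▸ hlt h))).2 h⟩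
  comp φ _ x X a := by
    obtain ⟨A, hA⟩ := exists_toFinset.{u} ((Finset.range (toNat a)).filter
      (fun n => φ.Holds stdLFTC0.{u}.reduct (Fin.cons ⟨n⟩ x) X))
    refine ⟨A, ?_, fun z hz => ?_⟩
    · rw [le_iff_toNat, toNat_len, sup_le_iff_forall_lt, hA]
      intro i hi
      exact Finset.mem_range.1 (Finset.mem_filter.1 hi).1
    · rw [mem_iff_toNat, hA, Finset.mem_filter, Finset.mem_range]
      exact and_iff_right (lt_iff_toNat.1 hz)

/-- The infimum is the least `z < t` with `P z`, or `t` if there is none, as the axioms for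
`f_{α,t}` demand. -/
theorem isLeast_spec (P : ℕ → Prop) (t : ℕ) :
    sInf {z | P z ∨ z = t} ≤ t ∧ (sInf {z | P z ∨ z = t} < t → P (sInf {z | P z ∨ z = t})) ∧
      ∀ z < sInf {z | P z ∨ z = t}, ¬ P z := by
  have hne : {z | P z ∨ z = t}.Nonempty := ⟨t, Or.inr rfl⟩
  refine ⟨Nat.sInf_le (Or.inr rfl), fun h => ?_, fun z hz h => ?_⟩
  · exact (Nat.sInf_mem hne).resolve_right h.ne
  · exact Nat.notMem_of_lt_sInf hz (Or.inl h)

theorem isNumones_std :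
    IsNumones (fun a A => stdLFTC0.{u}.interpOf .numones ![a] ![A]) := by
  have h : ∀ a A, toNat (stdLFTC0.{u}.interpOf .numones ![a] ![A]) =
      ((toFinset A).filter (fun i => i < toNat a)).card := fun a A => by
    change LFTC0.std _ _ _ = _
    exact LFTC0.std_numones _ _
  refine ⟨fun A => ?_, fun z A hz => ?_, fun z A hz => ?_, fun A b => ?_⟩
  · rw [toNat_inj, h]; simp
  · rw [toNat_inj, h, toNat_add, toNat_add, h, toNat_one]
    rw [← Finset.card_insert_of_notMem (a := toNat z) (by simp)]
    congr 1
    ext i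
    simp only [Finset.mem_filter, Finset.mem_insert]
    constructor
    · rintro ⟨h1, h2⟩; by_cases h3 : i = toNat z
      · exact .inl h3
      · exact .inr ⟨h1, by omega⟩
    · rintro (rfl | ⟨h1, h2⟩)
      · exact ⟨hz, by omega⟩
      · exact ⟨h1, by omega⟩
  · rw [toNat_inj, h, h, toNat_add, toNat_one]
    congr 1
    ext i
    simp only [Finset.mem_filter]
    refine and_congr_right fun hi => ?_
    have : i ≠ toNat z := fun e => hz (mem_iff_toNat.2 (e ▸ hi))
    omega
  · obtain ⟨Y, hY⟩ := exists_toFinset.{u} ((Finset.range (toNat b)).image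
      (fun n => toNat (pr (⟨n⟩ : stdLFTC0.{u}.reduct.U .num)
        (stdLFTC0.{u}.interpOf .numones ![⟨n⟩] ![A]))))
    refine ⟨Y, fun z hz y => ?_⟩
    rw [mem_iff_toNat, hY]
    simp only [Finset.mem_image, Finset.mem_range]
    constructor
    · rintro ⟨n, -, hn⟩
      obtain ⟨h1, h2⟩ := pr_inj.1 (toNat_inj.2 hn)
      subst h1
      exact h2.symm
    · rintro rfl
      exact ⟨toNat z, lt_iff_toNat.1 hz, rfl⟩

open Classical in
theorem symSpec_std {s : Srt} {k l : ℕ} : ∀ f : LFTC0 s k l, SymSpec stdLFTC0.{u}.interpOf f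
  | .base _ => fun _ _ => rfl
  | .pd => by
    have h : ∀ a, toNat (stdLFTC0.{u}.interpOf .pd ![a] ![]) = toNat a - 1 :=
      fun a => by
        change LFTC0.std _ _ _ = _
        exact LFTC0.std_pd _ _
    refine ⟨?_, fun a ha => ?_⟩
    · rw [toNat_inj, h]; simp
    · rw [ne_eq, toNat_inj, toNat_zero] at ha
      change stdLFTC0.{u}.interpOf .pd ![a] ![] + 1 = a
      rw [toNat_inj, toNat_add, h, toNat_one]
      omega
  | .fSE => by
    intro X Y
    have h : toNat (stdLFTC0.{u}.interpOf .fSE ![] ![X, Y]) =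
        sInf {z | ¬ (z ∈ toFinset X ↔ z ∈ toFinset Y) ∨ z = toNat (len X)} := by
      rw [toNat_len]
      change LFTC0.std _ _ _ = _
      exact LFTC0.std_fSE _ _
    obtain ⟨h1, h2, h3⟩ := isLeast_spec (fun z => ¬ (z ∈ toFinset X ↔ z ∈ toFinset Y))
      (toNat (len X))
    rw [← h] at h1 h2 h3
    exact ⟨h1, fun hlt => h2 (lt_iff_toNat.1 hlt),
      fun z hz => not_not.1 (h3 _ (lt_iff_toNat.1 hz))⟩
  | .numones => isNumones_std
  | .strFn α t => by
    intro x X z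
    have h1 : toFinset (stdLFTC0.{u}.interpOf (.strFn α t) x X) = _ := LFTC0.std_strFn α t _ _
    rw [mem_iff_toNat, h1, Finset.mem_filter, Finset.mem_range, lt_iff_toNat]
    have h2 : toNat (t.val stdLFTC0.{u}.reduct x X) = _ := down_val_L2A t x X
    rw [h2]
    refine and_congr_right fun _ => Iff.trans ?_ (holds_stdLFTC0 (Fin.cons z x) X α).symm
    exact iff_of_eq (congrArg (fun y => α.stdHolds y _) (down_cons z x).symm)
  | .numFn α t => by
    intro x X
    have h1 : toNat (stdLFTC0.{u}.interpOf (.numFn α t) x X) =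
        sInf {z | α.stdHolds (Fin.cons z fun i => toNat (x i)) (fun j => toFinset (X j)) ∨
          z = toNat (t.val stdLFTC0.{u}.reduct x X)} := by
      change LFTC0.std _ _ _ = _
      have h0 : toNat (t.val stdLFTC0.{u}.reduct x X) = _ := down_val_L2A t x X
      rw [h0]
      exact LFTC0.std_numFn α t _ _
    have h2 : ∀ z : stdLFTC0.{u}.reduct.U .num, α.Holds stdLFTC0.{u} (Fin.cons z x) X ↔
        α.stdHolds (Fin.cons (toNat z) fun i => toNat (x i)) (fun j => toFinset (X j)) :=
      fun z => (holds_stdLFTC0 (Fin.cons z x) X α).trans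
        (iff_of_eq (congrArg (fun y => α.stdHolds y _) (down_cons z x)))
    obtain ⟨h3, h4, h5⟩ := isLeast_spec
      (fun z => α.stdHolds (Fin.cons z fun i => toNat (x i)) (fun j => toFinset (X j)))
      (toNat (t.val stdLFTC0.{u}.reduct x X))
    rw [← h1] at h3 h4 h5
    exact ⟨h3, fun h => (h2 _).2 (h4 (lt_iff_toNat.1 h)),
      fun z hz => (h2 z).not.2 (h5 _ (lt_iff_toNat.1 hz))⟩

end Std

/-! ### Definability in the theories -/

/-- A model of `VTC⁰`-bar as an expansion of its reduct. -/
def Struct.toExpansion {N : Struct.{u} LFTC0} (h : N.Models VTC0bar) : Expansion.{u} :=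
  ⟨N.reduct, isV0_of_models h, N.interpOf, symSpec_of_models h⟩

/-- The standard structure as an expansion. -/
noncomputable def stdExpansion : Expansion.{u} :=
  ⟨stdLFTC0.reduct, inferInstance, stdLFTC0.interpOf, symSpec_std⟩

section Definability

variable {k l : ℕ}

theorem isSigma11DefS_of_graph {F : LFTC0 .str k l} {φ : Formula L2A true k (l + 1)}
    (hφ : φ.IsSigma11) (H : ∀ (N : Expansion.{u}) (x : Fin k → N.M.U .num)
      (X : Fin l → N.M.U .str) (Y : N.M.U .str),
      φ.Holds N.M x (Fin.cons Y X) ↔ Y = N.I F x X) :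
    IsSigma11DefS.{u} VTC0 F.std φ := by
  refine ⟨hφ, fun x X Y => ?_, fun M hM x X => ?_⟩
  · have h1 := H stdExpansion.{u} (fun i => ⟨x i⟩) (fun j => ⟨X j⟩) ⟨Y⟩
    have h2 := holds_reduct_stdLFTC0.{u} φ (fun i => ⟨x i⟩) (Fin.cons ⟨Y⟩ fun j => ⟨X j⟩)
    rw [down_cons] at h2
    have h3 : ULift.up.{u} Y = ⟨F.std x X⟩ ↔ Y = F.std x X := ULift.up_inj
    exact h3.symm.trans (h1.symm.trans h2)
  · obtain ⟨N, rfl, hN⟩ := exists_expansion hM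
    rw [Formula.holds_exUniqueS]
    exact ⟨_, (H (toExpansion hN) x X _).2 rfl, fun Y hY => (H (toExpansion hN) x X Y).1 hY⟩

theorem isSigma11DefN_of_graph {f : LFTC0 .num k l} {φ : Formula L2A true (k + 1) l}
    (hφ : φ.IsSigma11) (H : ∀ (N : Expansion.{u}) (x : Fin k → N.M.U .num)
      (X : Fin l → N.M.U .str) (y : N.M.U .num),
      φ.Holds N.M (Fin.cons y x) X ↔ y = N.I f x X) :
    IsSigma11DefN.{u} VTC0 f.std φ := by
  refine ⟨hφ, fun x X y => ?_, fun M hM x X => ?_⟩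
  · have h1 := H stdExpansion.{u} (fun i => ⟨x i⟩) (fun j => ⟨X j⟩) ⟨y⟩
    have h2 := holds_reduct_stdLFTC0.{u} φ (Fin.cons ⟨y⟩ fun i => ⟨x i⟩) (fun j => ⟨X j⟩)
    rw [down_cons] at h2
    have h3 : ULift.up.{u} y = ⟨f.std x X⟩ ↔ y = f.std x X := ULift.up_inj
    exact h3.symm.trans (h1.symm.trans h2)
  · obtain ⟨N, rfl, hN⟩ := exists_expansion hM
    rw [Formula.holds_exUniqueN]
    exact ⟨_, (H (toExpansion hN) x X _).2 rfl, fun y hy => (H (toExpansion hN) x X y).1 hy⟩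

theorem VTC0bar_proves_of_graph_str {F : LFTC0 .str k l} {φ : Formula L2A true k (l + 1)}
    (H : ∀ (N : Expansion.{u}) (x : Fin k → N.M.U .num)
      (X : Fin l → N.M.U .str) (Y : N.M.U .str),
      φ.Holds N.M x (Fin.cons Y X) ↔ Y = N.I F x X) :
    VTC0bar.Proves.{u} (Formula.iff (.eq (.svar 0) (Term.ofSymbol F).shiftS) φ.lift) := by
  intro N hN x X
  obtain ⟨Y, X, rfl⟩ : ∃ Y Z, X = Fin.cons Y Z := ⟨X 0, Fin.tail X, by simp⟩
  rw [Formula.holds_iff, Formula.holds_lift, Formula.holds_eq, Term.val_shiftS]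
  exact (H (toExpansion hN) x X Y).symm

theorem VTC0bar_proves_of_graph_num {f : LFTC0 .num k l} {φ : Formula L2A true (k + 1) l}
    (H : ∀ (N : Expansion.{u}) (x : Fin k → N.M.U .num)
      (X : Fin l → N.M.U .str) (y : N.M.U .num),
      φ.Holds N.M (Fin.cons y x) X ↔ y = N.I f x X) :
    VTC0bar.Proves.{u} (Formula.iff (.eq (.nvar 0) (Term.ofSymbol f).shiftN) φ.lift) := by
  intro N hN x X
  obtain ⟨y, x, rfl⟩ : ∃ y z, x = Fin.cons y z := ⟨x 0, Fin.tail x, by simp⟩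
  rw [Formula.holds_iff, Formula.holds_lift, Formula.holds_eq, Term.val_shiftN]
  exact (H (toExpansion hN) x X y).symm

end Definability

end TwoSorted

theorem corollaryt :
    -- `VTC⁰`-bar is a conservative extension of `VTC⁰`
    VTC0bar.IsConservativeExtension.{u} VTC0 ∧
    -- every string function symbol of `L_FTC⁰` is `Σ¹₁`-definable in `VTC⁰`, by a formula that
    -- defines it also in `VTC⁰`-bar
    (∀ (k l : ℕ) (F : LFTC0 .str k l), ∃ φ : Formula L2A true k (l + 1),
      IsSigma11DefS.{u} VTC0 F.std φ ∧
      VTC0bar.Proves.{u} (Formula.iff (.eq (.svar 0) (Term.ofSymbol F).shiftS) φ.lift)) ∧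
    -- the same for the number function symbols
    (∀ (k l : ℕ) (f : LFTC0 .num k l), ∃ φ : Formula L2A true (k + 1) l,
      IsSigma11DefN.{u} VTC0 f.std φ ∧
      VTC0bar.Proves.{u} (Formula.iff (.eq (.nvar 0) (Term.ofSymbol f).shiftN) φ.lift)) := by
  refine ⟨isConservativeExtension, fun k l F => ?_, fun k l f => ?_⟩
  · obtain ⟨φ, hφ, H⟩ := exists_graph_str.{u} F
    exact ⟨φ, isSigma11DefS_of_graph hφ H, VTC0bar_proves_of_graph_str H⟩
  · obtain ⟨φ, hφ, H⟩ := exists_graph_num.{u} f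
    exact ⟨φ, isSigma11DefN_of_graph hφ H, VTC0bar_proves_of_graph_num H⟩
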